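/- **Setting.** Let $d\ge 1$, let $\Theta\subset\mathbb R^d$ be compact, and for $\theta\in\Theta$ let $f_\theta$ be a measurable real function on $[0,\infty)^{\{1,2,\dots\}}$ such that $\theta\mapsto f_\theta(y)$ is twice continuously differentiable on $\Theta$ for every $y$. Let $\theta^*$ be an interior point of $\Theta$. Let $Y=(Y_t)_{t\in\mathbb Z}$ be a process with values in $\{0,1,2,\dots\}$, $\mathcal F_t=\sigma(Y_s,\ s\le t)$, such that $$Y_t\mid\mathcal F_{t-1}\sim\mathrm{Poisson}(\lambda_t),\qquad \lambda_t=f_{\theta^*}(Y_{t-1},Y_{t-2},\dots)\qquad\text{for all } t>0,$$ and such that for every $r\ge1$ there is $C_r$ with $\mathbb E\,Y_t^r\le C_r$ for all $t\le0$; nothing else is assumed about $(Y_t)_{t\le0}$. Let $\|\cdot\|$ be the sum of the absolute values of the entries of a number, vector or matrix, and $\|g\|_\Theta=\sup_{\theta\in\Theta}\|g(\theta)\|$ (if $g$ is a derivative with respect to $\theta$, it suffices to take the supremum over the interior of $\Theta$). Assume: * $\mathrm D(\Theta)$: there is $\underline c>0$ with $f_\theta(y)\ge\underline c$ for all $\theta\in\Theta$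 and all $y$. * $\mathrm{Id}(\Theta)$: for all $\theta,\theta'\in\Theta$, if $f_\theta(Y_{t-1},Y_{t-2},\dots)=f_{\theta'}(Y_{t-1},Y_{t-2},\dots)$ a.s. for some $t>0$, then $\theta=\theta'$. * $\mathrm{Var}(\Theta)$: for all $\theta$ in the interior of $\Theta$, all $t>0$ and $u\in\mathbb R^d$, if $u'\,\frac{\partial f_\theta}{\partial\theta}(Y_{t-1},Y_{t-2},\dots)=0$ a.s., then $u=0$. * $\mathrm A_i(\Theta)$, $i=0,1,2$: $\|\partial^if_\theta(0)/\partial\theta^i\|_\Theta<\infty$, and there are $\alpha^{(i)}_k\ge0$, $k\ge1$, with $\sum_k\alpha^{(0)}_k<1$ and $\sum_k\alpha_k^{(i)}<\infty$ for $i=1,2$, such that for all $y,y'$ $$\Big\|\frac{\partial^if_\theta(y)}{\partial\theta^i}-\frac{\partial^if_\theta(y')}{\partial\theta^i}\Big\|_\Theta\le\sum_{k\ge1}\alpha_k^{(i)}|y_k-y'_k| .$$ * For some $\gamma>3/2$, $\alpha^{(i)}_j=O(j^{-\gamma})$ for $i=0,1,2$. Put $\widehat f^{\,t}_\theta=f_\theta(Y_{t-1},\dots,Y_1,0,0,\dots)$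 and let $\widehat\theta(T_{1,n})$ be a measurable choice of a maximizer over $\theta\in\Theta$ of $\widehat L_n(\theta)=\sum_{t=1}^n\big(Y_t\log\widehat f^{\,t}_\theta-\widehat f^{\,t}_\theta\big)$. **Theorem 3.2.** There is a strictly stationary process $\widetilde Y=(\widetilde Y_t)_{t\in\mathbb Z}$ with values in $\{0,1,2,\dots\}$ and finite moments of every order such that, for all $t\in\mathbb Z$, the conditional law of $\widetilde Y_t$ given $\sigma(\widetilde Y_s,\ s<t)$ is $\mathrm{Poisson}\big(f_{\theta^*}(\widetilde Y_{t-1},\widetilde Y_{t-2},\dots)\big)$. For every such process, with $\widetilde f^{\,0}_\theta=f_\theta(\widetilde Y_{-1},\widetilde Y_{-2},\dots)$, the matrix $$\widetilde\Sigma=\mathbb E\Big(\frac1{\widetilde f^{\,0}_{\theta^*}}\Big(\frac{\partial}{\partial\theta}\widetilde f^{\,0}_{\theta^*}\Big)\Big(\frac{\partial}{\partial\theta}\widetilde f^{\,0}_{\theta^*}\Big)'\Big)$$ is well defined (the entries are integrable) and positive definite, $$\sqrt n\,\big(\widehat\theta(T_{1,n})-\theta^*\big)\xrightarrow[n\to\infty]{\mathcal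 D}\mathcal N\big(0,\widetilde\Sigma^{-1}\big),$$ and $$\widehat\Sigma_n=\Big(\frac1n\sum_{t=1}^n\frac1{\widehat f^{\,t}_\theta}\Big(\frac{\partial}{\partial\theta}\widehat f^{\,t}_\theta\Big)\Big(\frac{\partial}{\partial\theta}\widehat f^{\,t}_\theta\Big)'\Big)\Big|_{\theta=\widehat\theta(T_{1,n})}\longrightarrow\widetilde\Sigma\quad\text{almost surely as } n\to\infty .$$ -/

import Mathlib

open MeasureTheory ProbabilityTheory Filter Topology
open scoped NNReal ENNReal

namespace PoissonAR

noncomputable section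

/-- The parameter space `ℝ^d`. -/
abbrev Param (d : ℕ) : Type := EuclideanSpace ℝ (Fin d)

/-- Sequences `(y₁, y₂, …)` of non-negative reals; the entry of index `k : ℕ` is `y_{k+1}`.
Likewise a coefficient sequence `α : ℕ → ℝ` lists `α₁, α₂, …`, and `α k` is `α_{k+1}`. -/
abbrev Hist : Type := ℕ → ℝ≥0

/-- A parametric family of conditional means: `f θ y` is `f_θ(y₁, y₂, …)`. -/
abbrev MeanFamily (d : ℕ) : Type := Param d → Hist → ℝ

section Family

variable {d : ℕ}

/-- The partial derivative `∂f_θ(y)/∂θ_i`, taken within `Θ`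
(at interior points of `Θ` this is the ordinary partial derivative). -/
def partialDeriv (f : MeanFamily d) (Θ : Set (Param d)) (i : Fin d) (θ : Param d) (y : Hist) : ℝ :=
  fderivWithin ℝ (fun ϑ => f ϑ y) Θ θ (EuclideanSpace.single i 1)

/-- The second partial derivative `∂²f_θ(y)/∂θ_j∂θ_i`, taken within `Θ`. -/
def partialDeriv₂ (f : MeanFamily d) (Θ : Set (Param d)) (i j : Fin d) (θ : Param d)
    (y : Hist) : ℝ :=
  fderivWithin ℝ (fun ϑ => partialDeriv f Θ i ϑ y) Θ θ (EuclideanSpace.single j 1)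

/-- `α` is a non-negative sequence with `α_j = O(j^{-γ})`. -/
def HasDecay (α : ℕ → ℝ) (γ : ℝ) : Prop :=
  (∀ k, 0 ≤ α k) ∧ α =O[atTop] fun k : ℕ => ((k : ℝ) + 1) ^ (-γ)

/-- The inequality `N(y, y') ≤ ∑_{k ≥ 1} α_k |y_k - y'_k|` for all `y, y'`, where the series may
be infinite, in which case nothing is required. -/
def LipBound (α : ℕ → ℝ) (N : Hist → Hist → ℝ) : Prop :=
  ∀ y y' : Hist, Summable (fun k => α k * |(y k : ℝ) - y' k|) →
    N y y' ≤ ∑' k, α k * |(y k : ℝ) - y' k|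

/-- Condition `A₀(Θ)` with coefficients `α`. -/
def CondA0 (f : MeanFamily d) (Θ : Set (Param d)) (α : ℕ → ℝ) : Prop :=
  (∃ C : ℝ, ∀ θ ∈ Θ, |f θ 0| ≤ C) ∧ (∀ k, 0 ≤ α k) ∧ Summable α ∧ ∑' k, α k < 1 ∧
    ∀ θ ∈ Θ, LipBound α fun y y' => |f θ y - f θ y'|

/-- Condition `A₁(Θ)` with coefficients `α`, for the `ℓ¹` norm of the gradient. Only interior
points of `Θ` are used: the gradient is continuous on `Θ`, so that for the usual `Θ`
(the closure of its interior) the supremum over `Θ` is the supremum over the interior, and in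
general this asks for less. -/
def CondA1 (f : MeanFamily d) (Θ : Set (Param d)) (α : ℕ → ℝ) : Prop :=
  (∃ C : ℝ, ∀ θ ∈ interior Θ, ∑ i, |partialDeriv f Θ i θ 0| ≤ C) ∧
    (∀ k, 0 ≤ α k) ∧ Summable α ∧
    ∀ θ ∈ interior Θ,
      LipBound α fun y y' => ∑ i, |partialDeriv f Θ i θ y - partialDeriv f Θ i θ y'|

/-- Condition `A₂(Θ)` with coefficients `α`, for the `ℓ¹` norm of the Hessian; see `CondA1`. -/
def CondA2 (f : MeanFamily d) (Θ : Set (Param d)) (α : ℕ → ℝ) : Prop :=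
  (∃ C : ℝ, ∀ θ ∈ interior Θ, ∑ i, ∑ j, |partialDeriv₂ f Θ i j θ 0| ≤ C) ∧
    (∀ k, 0 ≤ α k) ∧ Summable α ∧
    ∀ θ ∈ interior Θ,
      LipBound α fun y y' => ∑ i, ∑ j, |partialDeriv₂ f Θ i j θ y - partialDeriv₂ f Θ i j θ y'|

/-- Condition `D(Θ)`: the conditional means are bounded below by a positive constant. -/
def CondD (f : MeanFamily d) (Θ : Set (Param d)) : Prop :=
  ∃ c : ℝ, 0 < c ∧ ∀ θ ∈ Θ, ∀ y : Hist, c ≤ f θ y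

end Family

section Proc

variable {d : ℕ} {Ω : Type*}

/-- The past `(Y_{t-1}, Y_{t-2}, …)`. -/
def past (Y : ℤ → Ω → ℕ) (t : ℤ) (ω : Ω) : Hist :=
  fun k => (Y (t - 1 - k) ω : ℝ≥0)

/-- The truncated past `(Y_{t-1}, …, Y_1, 0, 0, …)`. -/
def truncPast (Y : ℤ → Ω → ℕ) (t : ℤ) (ω : Ω) : Hist :=
  fun k => if 1 ≤ t - 1 - (k : ℤ) then (Y (t - 1 - k) ω : ℝ≥0) else 0

/-- The σ-algebra `ℱ_t = σ(Y_s, s ≤ t)`. -/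
abbrev history (Y : ℤ → Ω → ℕ) (t : ℤ) : MeasurableSpace Ω :=
  ⨆ s : {s : ℤ // s ≤ t}, MeasurableSpace.comap (Y s) ⊤

/-- `Y_t | ℱ_{t-1} ~ Poisson(λ_t)` with `λ_t = f_θ(Y_{t-1}, Y_{t-2}, …)`: for every `m`, the
conditional probability of `{Y_t = m}` given `ℱ_{t-1}` is `exp(-λ_t) λ_t^m / m!`. -/
def CondPoisson [MeasurableSpace Ω] (μ : Measure Ω) (Y : ℤ → Ω → ℕ) (f : MeanFamily d)
    (θ : Param d) (t : ℤ) : Prop :=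
  ∀ m : ℕ, μ[Set.indicator {ω | Y t ω = m} (fun _ => (1 : ℝ)) | history Y (t - 1)] =ᵐ[μ]
    fun ω => Real.exp (-f θ (past Y t ω)) * f θ (past Y t ω) ^ m / (m.factorial : ℝ)

/-- Condition `Id(Θ)`. -/
def CondId [MeasurableSpace Ω] (μ : Measure Ω) (Y : ℤ → Ω → ℕ) (f : MeanFamily d)
    (Θ : Set (Param d)) : Prop :=
  ∀ θ ∈ Θ, ∀ θ' ∈ Θ,
    (∃ t : ℤ, 0 < t ∧ ∀ᵐ ω ∂μ, f θ (past Y t ω) = f θ' (past Y t ω)) → θ = θ'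

/-- Condition `Var(Θ)`: for `t > 0`, no non-trivial linear combination of the components of
`∂f_θ/∂θ (Y_{t-1}, …)` vanishes almost surely. As in `CondA1`, only interior `θ` are used. -/
def CondVar [MeasurableSpace Ω] (μ : Measure Ω) (Y : ℤ → Ω → ℕ) (f : MeanFamily d)
    (Θ : Set (Param d)) : Prop :=
  ∀ θ ∈ interior Θ, ∀ t : ℤ, 0 < t → ∀ u : Fin d → ℝ,
    (∀ᵐ ω ∂μ, ∑ i, u i * partialDeriv f Θ i θ (past Y t ω) = 0) → u = 0

/-- The observable log-likelihood
`L̂_n(T_{1,n}, θ) = ∑_{t=1}^n (Y_t log λ̂_t(θ) - λ̂_t(θ))`, with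
`λ̂_t(θ) = f_θ(Y_{t-1}, …, Y_1, 0, …)`. -/
def logLik (Y : ℤ → Ω → ℕ) (f : MeanFamily d) (n : ℕ) (ω : Ω) (θ : Param d) : ℝ :=
  ∑ t ∈ Finset.Icc 1 n,
    ((Y (t : ℤ) ω : ℝ) * Real.log (f θ (truncPast Y t ω)) - f θ (truncPast Y t ω))

/-- `θ` is a maximum likelihood estimate computed on `Y_1(ω), …, Y_n(ω)`. -/
def IsMLE (Y : ℤ → Ω → ℕ) (f : MeanFamily d) (Θ : Set (Param d)) (n : ℕ) (ω : Ω)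
    (θ : Param d) : Prop :=
  θ ∈ Θ ∧ IsMaxOn (logLik Y f n ω) Θ θ

/-- The matrix `n⁻¹ ∑_{t=1}^n (f̂_θ^t)⁻¹ (∂f̂_θ^t/∂θ) (∂f̂_θ^t/∂θ)'`, where
`f̂_θ^t = f_θ(Y_{t-1}, …, Y_1, 0, …)`. -/
def empFisher (Y : ℤ → Ω → ℕ) (f : MeanFamily d) (Θ : Set (Param d)) (n : ℕ) (ω : Ω)
    (θ : Param d) : Matrix (Fin d) (Fin d) ℝ :=
  Matrix.of fun i j => (n : ℝ)⁻¹ * ∑ t ∈ Finset.Icc 1 n,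
    (f θ (truncPast Y t ω))⁻¹ * partialDeriv f Θ i θ (truncPast Y t ω) *
      partialDeriv f Θ j θ (truncPast Y t ω)

end Proc

section Stationary

variable {d : ℕ}

/-- The coordinate process on path space. -/
def coord (t : ℤ) (x : ℤ → ℕ) : ℕ := x t

/-- `Q` is the law of a stationary solution `(Ỹ_t)_{t ∈ ℤ}` of the model with parameter `θ`: it
is strictly stationary, has finite moments of every order, and
`Ỹ_t | Ỹ_{t-1}, Ỹ_{t-2}, … ~ Poisson(f_θ(Ỹ_{t-1}, Ỹ_{t-2}, …))` for all `t ∈ ℤ`. -/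
structure IsStationaryLaw (f : MeanFamily d) (θ : Param d) (Q : Measure (ℤ → ℕ)) : Prop where
  isProbabilityMeasure : IsProbabilityMeasure Q
  stationary : Q.map (fun x t => x (t + 1)) = Q
  moments : ∀ r : ℕ, ∀ t : ℤ, ∫⁻ x, (coord t x : ℝ≥0∞) ^ r ∂Q < ∞
  condPoisson : ∀ t : ℤ, CondPoisson Q coord f θ t

/-- The `(i, j)` entry of `(f̃_θ^0)⁻¹ (∂f̃_θ^0/∂θ) (∂f̃_θ^0/∂θ)'` along the path `x`, where
`f̃_θ^0 = f_θ(Ỹ_{-1}, Ỹ_{-2}, …)`. -/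
def fisherIntegrand (f : MeanFamily d) (Θ : Set (Param d)) (θ : Param d) (i j : Fin d)
    (x : ℤ → ℕ) : ℝ :=
  (f θ (past coord 0 x))⁻¹ * partialDeriv f Θ i θ (past coord 0 x) *
    partialDeriv f Θ j θ (past coord 0 x)

/-- The Fisher information matrix `Σ̃` of the stationary regime with law `Q`. -/
def fisher (f : MeanFamily d) (Θ : Set (Param d)) (θ : Param d) (Q : Measure (ℤ → ℕ)) :
    Matrix (Fin d) (Fin d) ℝ :=
  Matrix.of fun i j => ∫ x, fisherIntegrand f Θ θ i j x ∂Q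

end Stationary

end

end PoissonAR

/-!
The autoregression forgets its past: if the conditional mean is Lipschitz with coefficients of sum
less than one, then `Φ ↦ P Φ`, the transition operator of the history process
`(Y_t, Y_{t-1}, …)`, maps a Lipschitz function with coefficients `w` to one with coefficients
`A w`, `(A w)_k = w_0 α_k + w_{k+1}`, and the iterates `A^m w` tend to zero in `ℓ¹`. The same
inequality, through Jensen's inequality, bounds the moments of the observed process uniformly in
time, whatever its dynamics before time zero (`exists_moment_bound`). A stationary solution is a
weak limit point of the Cesàro averages of the laws of the shifted process (`exists_stationary`).

The observed process obeys an ergodic theorem towards any stationary law: by the strong law for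
square-integrable martingale differences, averages of a bounded Lipschitz function along the truncated
histories behave as those of its images under the powers of the transition operator, and these
become constant in the limit. Hence, almost surely, the empirical laws of the truncated histories have bounded
moments and converge on cylinders to the stationary law (`ae_emp_good`). The conditional means, their
two derivatives, and all that is built from them are *tame*: they grow at most polynomially in, and
are locally Lipschitz with respect to, a weighted `ℓ¹` size of the history, uniformly in the parameter.
For tame families, convergence on cylinders with bounded moments gives a uniform law of large
numbers. Moreover replacing the full past by the truncated one changes a sum of `n` tame terms by
`o(√n)`; here the decay exponent must exceed `3/2` (`Tame.ae_tendsto_sum_sub_posPart`).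

Consistency is then the classical argument of Wald: the limit of the normalized log-likelihood is a
Kullback–Leibler functional, maximal only where the conditional means agree on all admissible
histories, because a tame function vanishing almost everywhere under the stationary law vanishes
identically on admissible histories (`Tame.eq_zero_of_ae`). The same fact carries the conditions of
identifiability and non-degenerate gradient from the observed process to the stationary one, and
makes the Fisher information positive definite. The likelihood equation is linearized around the
true parameter by the mean value inequality, with an error that is small relative to the
estimation error (`IsRegular.eventually_norm_info_sub_score_le`). The normalized score with the
full past is asymptotically Gaussian: `exp (i ∑ a (Y - λ) - ∑ λ (e^{ia} - 1 - i a))` is an exact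
martingale for conditional Poisson laws, which, for weights `a` of order `1/√n` stopped when their
quadratic variation gets large, gives the limit of the characteristic functions
(`IsRegular.tendsto_charFun_normScore`), and Lévy's continuity theorem and Slutsky's lemma conclude.
-/

namespace PoissonAR

noncomputable section

set_option linter.unusedSectionVars false

/-! ### Poisson integrals -/

lemma lintegral_poisson (r : ℝ≥0) (g : ℕ → ℝ≥0∞) :
    ∫⁻ n, g n ∂(poissonMeasure r) =
      ∑' n : ℕ, ENNReal.ofReal (Real.exp (-r) * r ^ n / n.factorial) * g n := by
  rw [poissonMeasure, lintegral_sum_measure]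
  simp [lintegral_smul_measure, lintegral_dirac]

/-- The Stein–Chen identity `E[N g(N)] = r E[g(N + 1)]` for `N ~ Poisson(r)`. -/
lemma lintegral_poisson_mul (r : ℝ≥0) (g : ℕ → ℝ≥0∞) :
    ∫⁻ n, n * g n ∂(poissonMeasure r) = r * ∫⁻ n, g (n + 1) ∂(poissonMeasure r) := by
  rw [lintegral_poisson, lintegral_poisson, tsum_eq_zero_add' ENNReal.summable]
  simp only [Nat.cast_zero, zero_mul, mul_zero, zero_add]
  rw [← ENNReal.tsum_mul_left]
  refine tsum_congr fun n => ?_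
  rw [← mul_assoc, ← mul_assoc]
  congr 1
  have h1 : ((n + 1 : ℕ) : ℝ≥0∞) = ENNReal.ofReal ((n : ℝ) + 1) := by
    rw [ENNReal.ofReal_add (by positivity) (by positivity)]; simp
  have h2 : (r : ℝ≥0∞) = ENNReal.ofReal (r : ℝ) := by simp
  rw [h1, h2, ← ENNReal.ofReal_mul (by positivity), ← ENNReal.ofReal_mul (by positivity)]
  congr 1
  rw [Nat.factorial_succ, pow_succ]
  push_cast
  field_simp

/-- Since `(r + c + m)^m` dominates `E(N + c)^m`, the `L^m` norm of a Poisson variable exceeds its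
mean by at most `m`. -/
lemma lintegral_poisson_add_pow_le (r : ℝ≥0) (m : ℕ) : ∀ c : ℕ,
    ∫⁻ n, ((n : ℝ≥0∞) + c) ^ m ∂(poissonMeasure r) ≤ ((r : ℝ≥0∞) + c + m) ^ m := by
  induction m with
  | zero => intro c; simp
  | succ m ih =>
    intro c
    have h : ∫⁻ n, ((n : ℝ≥0∞) + c) ^ (m + 1) ∂(poissonMeasure r) =
        r * ∫⁻ n, ((n : ℝ≥0∞) + (c + 1 : ℕ)) ^ m ∂(poissonMeasure r) +
          c * ∫⁻ n, ((n : ℝ≥0∞) + c) ^ m ∂(poissonMeasure r) := by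
      have := lintegral_poisson_mul r (fun n => ((n : ℝ≥0∞) + c) ^ m)
      push_cast at this ⊢
      have e : ∀ n : ℕ, (n : ℝ≥0∞) + (c + 1) = n + 1 + c := fun n => by ring
      simp_rw [e]
      rw [← this, ← lintegral_const_mul _ .of_discrete, ← lintegral_add_left .of_discrete]
      refine lintegral_congr fun n => ?_
      ring
    rw [h]
    calc _ ≤ (r : ℝ≥0∞) * ((r : ℝ≥0∞) + (c + 1 : ℕ) + m) ^ m
        + c * ((r : ℝ≥0∞) + c + m) ^ m := by gcongr <;> apply ih
      _ ≤ (r : ℝ≥0∞) * ((r : ℝ≥0∞) + c + (m + 1 : ℕ)) ^ m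
        + c * ((r : ℝ≥0∞) + c + (m + 1 : ℕ)) ^ m := by
          have e1 : (r : ℝ≥0∞) + (c + 1 : ℕ) + m = r + c + (m + 1 : ℕ) := by push_cast; ring
          rw [e1]
          gcongr
          exact Nat.le_succ m
      _ = (r + c : ℝ≥0∞) * ((r : ℝ≥0∞) + c + (m + 1 : ℕ)) ^ m := by ring
      _ ≤ ((r : ℝ≥0∞) + c + (m + 1 : ℕ)) * ((r : ℝ≥0∞) + c + (m + 1 : ℕ)) ^ m := by
          exact mul_le_mul_left le_self_add _
      _ = _ := by ring

lemma lintegral_poisson_pow_le (r : ℝ≥0) (m : ℕ) :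
    ∫⁻ n, (n : ℝ≥0∞) ^ m ∂(poissonMeasure r) ≤ ((r : ℝ≥0∞) + m) ^ m := by
  simpa using lintegral_poisson_add_pow_le r m 0

lemma lintegral_poisson_id (r : ℝ≥0) : ∫⁻ n, (n : ℝ≥0∞) ∂(poissonMeasure r) = r := by
  simpa using lintegral_poisson_mul r 1

lemma integrable_poisson_id (r : ℝ≥0) : Integrable (fun n : ℕ => (n : ℝ)) (poissonMeasure r) := by
  refine ⟨.of_discrete, ?_⟩
  rw [hasFiniteIntegral_iff_enorm]
  have : ∀ n : ℕ, ‖(n : ℝ)‖ₑ = n := fun n => by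
    rw [Real.enorm_eq_ofReal (by positivity)]; simp
  simp_rw [this, lintegral_poisson_id]
  exact ENNReal.coe_lt_top

lemma integral_poisson_id (r : ℝ≥0) : ∫ n, (n : ℝ) ∂(poissonMeasure r) = r := by
  rw [integral_eq_lintegral_of_nonneg_ae (.of_forall fun n => by positivity) .of_discrete]
  simp [lintegral_poisson_id]

/-- The Kantorovich distance between two Poisson laws is at most the distance of their means:
the larger one is the smaller one convolved with a Poisson law. -/
lemma abs_integral_poisson_sub_le_of_le {g : ℕ → ℝ} {L B : ℝ} (hB : ∀ n, |g n| ≤ B)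
    (hL : ∀ n k, |g (n + k) - g n| ≤ L * k) (r s : ℝ≥0) :
    |∫ n, g n ∂(poissonMeasure (r + s)) - ∫ n, g n ∂(poissonMeasure r)| ≤ L * s := by
  have hint : ∀ r' : ℝ≥0, Integrable g (poissonMeasure r') := fun r' =>
    Integrable.of_bound .of_discrete B (.of_forall fun n => by simpa using hB n)
  have h1 : ∫ n, g n ∂(poissonMeasure (r + s)) =
      ∫ n, ∫ k, g (n + k) ∂(poissonMeasure s) ∂(poissonMeasure r) := by
    rw [← poissonMeasure_conv_poissonMeasure, integral_conv]
    rw [poissonMeasure_conv_poissonMeasure]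
    exact hint _
  have hint2 : Integrable (fun n => ∫ k, g (n + k) ∂(poissonMeasure s)) (poissonMeasure r) := by
    refine Integrable.of_bound .of_discrete B (.of_forall fun n => ?_)
    refine (norm_integral_le_of_norm_le_const (C := B) (.of_forall fun k => ?_)).trans ?_
    · simpa using hB _
    · simp
  rw [h1, ← integral_sub hint2 (hint r), ← Real.norm_eq_abs]
  have h3 : ∀ n, ‖∫ k, g (n + k) ∂(poissonMeasure s) - g n‖ ≤ L * s := by
    intro n
    have : g n = ∫ _k : ℕ, g n ∂(poissonMeasure s) := by simp
    have hi : Integrable (fun k => g (n + k)) (poissonMeasure s) :=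
      Integrable.of_bound .of_discrete B (.of_forall fun k => by simpa using hB _)
    conv_lhs => rw [this]
    rw [← integral_sub hi (integrable_const _)]
    calc _ ≤ ∫ k : ℕ, L * k ∂(poissonMeasure s) :=
          norm_integral_le_of_norm_le ((integrable_poisson_id s).const_mul L)
            (.of_forall fun k => by simpa using hL n k)
      _ = L * s := by rw [integral_const_mul, integral_poisson_id]
  simpa using norm_integral_le_of_norm_le_const (μ := poissonMeasure r) (.of_forall h3)

lemma abs_integral_poisson_sub_le {g : ℕ → ℝ} {L B : ℝ} (hB : ∀ n, |g n| ≤ B)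
    (hL : ∀ n k, |g (n + k) - g n| ≤ L * k) (r s : ℝ≥0) :
    |∫ n, g n ∂(poissonMeasure r) - ∫ n, g n ∂(poissonMeasure s)| ≤ L * |(r : ℝ) - s| := by
  rcases le_total r s with h | h
  · obtain ⟨t, rfl⟩ := exists_add_of_le h
    rw [abs_sub_comm]
    simpa using abs_integral_poisson_sub_le_of_le hB hL r t
  · obtain ⟨t, rfl⟩ := exists_add_of_le h
    simpa using abs_integral_poisson_sub_le_of_le hB hL s t

lemma integral_cexp_poisson (r : ℝ≥0) (a : ℝ) :
    ∫ n : ℕ, Complex.exp (a * n * Complex.I) ∂(poissonMeasure r) =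
      Complex.exp (r * (Complex.exp (a * Complex.I) - 1)) := by
  have := charFun_map_cast_poissonMeasure r a
  rw [charFun_apply_real, integral_map .of_discrete (by fun_prop)] at this
  simpa using this

/-! ### Convexity and Kronecker-type lemmas -/

lemma ennreal_tsum_mul_pow_le (w z : ℕ → ℝ≥0∞) (r : ℕ) :
    (∑' k, w k * z k) ^ (r + 1) ≤ (∑' k, w k) ^ r * ∑' k, w k * z k ^ (r + 1) := by
  have hfin : ∀ s : Finset ℕ, (∑ k ∈ s, w k * z k) ^ (r + 1) ≤
      (∑ k ∈ s, w k) ^ r * ∑ k ∈ s, w k * z k ^ (r + 1) := by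
    intro s
    have h := ENNReal.inner_le_weight_mul_Lp_of_nonneg s (p := (r + 1 : ℕ))
      (by norm_cast; omega) w z
    have h2 := pow_le_pow_left' h (r + 1)
    refine h2.trans (le_of_eq ?_)
    rw [mul_pow, ← ENNReal.rpow_natCast, ← ENNReal.rpow_natCast, ← ENNReal.rpow_mul,
      ← ENNReal.rpow_mul, inv_mul_cancel₀ (by positivity), ENNReal.rpow_one]
    have : (1 - ((r + 1 : ℕ) : ℝ)⁻¹) * ((r + 1 : ℕ) : ℝ) = r := by
      push_cast; field_simp; ring
    rw [this, ENNReal.rpow_natCast]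
    simp_rw [ENNReal.rpow_natCast]
  refine le_of_tendsto ((ENNReal.continuous_pow (r + 1)).tendsto _ |>.comp
    (ENNReal.summable (f := fun k => w k * z k)).hasSum) (.of_forall fun s => ?_)
  refine (hfin s).trans ?_
  gcongr
  · exact ENNReal.sum_le_tsum s
  · exact ENNReal.sum_le_tsum s

lemma tendsto_inv_mul_sum_of_tendsto_sum_div {D : ℕ → ℝ} {l : ℝ}
    (h : Tendsto (fun n => ∑ t ∈ Finset.range n, D t / (t + 1)) atTop (𝓝 l)) :
    Tendsto (fun n : ℕ => (n : ℝ)⁻¹ * ∑ t ∈ Finset.range n, D t) atTop (𝓝 0) := by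
  set M : ℕ → ℝ := fun n => ∑ t ∈ Finset.range n, D t / (t + 1) with hM
  have key : ∀ n, ∑ t ∈ Finset.range n, D t = n * M n - ∑ t ∈ Finset.range n, M t := by
    intro n
    induction n with
    | zero => simp
    | succ n ih =>
      rw [Finset.sum_range_succ, ih, Finset.sum_range_succ]
      have : M (n + 1) = M n + D n / (n + 1) := by simp [hM, Finset.sum_range_succ]
      rw [this]
      have : (n : ℝ) + 1 ≠ 0 := by positivity
      push_cast
      field_simp
      ring
  have h2 := h.sub h.cesaro
  rw [sub_self] at h2
  refine h2.congr' ?_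
  filter_upwards [eventually_gt_atTop 0] with n hn
  rw [key]
  have : (n : ℝ) ≠ 0 := by positivity
  field_simp

lemma tendsto_inv_sqrt_mul_sum {x : ℕ → ℝ} (hx : ∀ t, 0 ≤ x t)
    (h : Summable fun t : ℕ => x t / √((t : ℝ) + 1)) :
    Tendsto (fun n : ℕ => (√(n : ℝ))⁻¹ * ∑ t ∈ Finset.range n, x t) atTop (𝓝 0) := by
  have h1 : ∀ n : ℕ, (√(n : ℝ))⁻¹ * ∑ t ∈ Finset.range n, x t =
      ∑' t, if t < n then x t / √(n : ℝ) else 0 := by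
    intro n
    rw [tsum_eq_sum (s := Finset.range n) (by simp +contextual)]
    rw [Finset.mul_sum]
    refine Finset.sum_congr rfl fun t ht => ?_
    rw [if_pos (Finset.mem_range.1 ht)]
    ring
  simp_rw [h1]
  rw [← tsum_zero (β := ℕ)]
  refine tendsto_tsum_of_dominated_convergence h (fun t => ?_) (.of_forall fun n t => ?_)
  · have : Tendsto (fun n : ℕ => x t / √(n : ℝ)) atTop (𝓝 0) :=
      Tendsto.div_atTop tendsto_const_nhds
        (Real.tendsto_sqrt_atTop.comp tendsto_natCast_atTop_atTop)
    refine this.congr' ?_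
    filter_upwards [eventually_gt_atTop t] with n hn
    simp [hn]
  · split_ifs with htn
    · rw [Real.norm_of_nonneg (div_nonneg (hx t) (Real.sqrt_nonneg _))]
      refine div_le_div_of_nonneg_left (hx t) (by positivity) (Real.sqrt_le_sqrt ?_)
      exact_mod_cast htn
    · rw [tsum_zero, norm_zero]; exact div_nonneg (hx t) (Real.sqrt_nonneg _)

lemma tendsto_inv_mul_sum_of_sqrt {x : ℕ → ℝ} (hx : ∀ t, 0 ≤ x t)
    (h : Tendsto (fun n : ℕ => (√(n : ℝ))⁻¹ * ∑ t ∈ Finset.range n, x t) atTop (𝓝 0)) :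
    Tendsto (fun n : ℕ => (n : ℝ)⁻¹ * ∑ t ∈ Finset.range n, x t) atTop (𝓝 0) := by
  refine squeeze_zero' (.of_forall fun n => ?_) ?_ h
  · exact mul_nonneg (by positivity) (Finset.sum_nonneg fun t _ => hx t)
  · filter_upwards [eventually_ge_atTop 1] with n hn
    have hn' : (1 : ℝ) ≤ n := by exact_mod_cast hn
    refine mul_le_mul_of_nonneg_right ?_ (Finset.sum_nonneg fun t _ => hx t)
    refine inv_anti₀ (by positivity) ?_
    rw [Real.sqrt_le_left (by positivity)]
    nlinarith

/-! ### Integer histories and the transition kernel -/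

/-- An integer-valued history, most recent value first. -/
abbrev NHist : Type := ℕ → ℕ

/-- An integer history seen as a sequence of non-negative reals. -/
def toHist (y : NHist) : Hist := fun k => (y k : ℝ≥0)

/-- The history with `m` put in front of `y`. -/
def cons (m : ℕ) (y : NHist) : NHist := fun k => Nat.casesOn k m y

/-- The history without its most recent value. -/
def tl (y : NHist) : NHist := fun k => y (k + 1)

@[simp] lemma cons_zero (m : ℕ) (y : NHist) : cons m y 0 = m := rfl
@[simp] lemma cons_succ (m : ℕ) (y : NHist) (k : ℕ) : cons m y (k + 1) = y k := rfl
@[simp] lemma tl_cons (m : ℕ) (y : NHist) : tl (cons m y) = y := rfl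

lemma measurable_toHist : Measurable toHist :=
  measurable_pi_lambda _ fun k => measurable_from_nat.comp (measurable_pi_apply k)

lemma measurable_tl : Measurable tl := measurable_pi_lambda _ fun k => measurable_pi_apply (k + 1)

lemma measurable_cons : Measurable fun p : NHist × ℕ => cons p.2 p.1 := by
  refine measurable_pi_lambda _ fun k => ?_
  cases k with
  | zero => exact measurable_snd
  | succ k => exact (measurable_pi_apply k).comp measurable_fst

/-- The history `(Y_t, Y_{t-1}, …)` of a process up to and including time `t`. -/
def hist {Ω : Type*} (Y : ℤ → Ω → ℕ) (t : ℤ) (ω : Ω) : NHist := fun k => Y (t - k) ω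

/-- The process `Y` with the values at times `t ≤ 0` replaced by `0`. -/
def posPart {Ω : Type*} (Y : ℤ → Ω → ℕ) (t : ℤ) (ω : Ω) : ℕ := if 1 ≤ t then Y t ω else 0

section Proc

variable {Ω : Type*} (Y : ℤ → Ω → ℕ)

lemma hist_succ (t : ℤ) (ω : Ω) : hist Y (t + 1) ω = cons (Y (t + 1) ω) (hist Y t ω) := by
  funext k
  cases k with
  | zero => simp [hist]
  | succ k => simp only [hist, cons_succ]; congr 1; push_cast; ring

@[simp] lemma tl_hist_succ (t : ℤ) (ω : Ω) : tl (hist Y (t + 1) ω) = hist Y t ω := by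
  rw [hist_succ, tl_cons]

lemma past_eq (t : ℤ) (ω : Ω) : past Y (t + 1) ω = toHist (hist Y t ω) := by
  funext k; simp [past, toHist, hist]

lemma truncPast_eq (t : ℤ) (ω : Ω) :
    truncPast Y (t + 1) ω = toHist (hist (posPart Y) t ω) := by
  funext k
  simp only [truncPast, toHist, hist, posPart, add_sub_cancel_right]
  split_ifs <;> simp

variable [MeasurableSpace Ω] {Y}

lemma measurable_hist (hY : ∀ t, Measurable (Y t)) (t : ℤ) : Measurable (hist Y t) :=
  measurable_pi_lambda _ fun k => hY (t - k)

lemma measurable_posPart (hY : ∀ t, Measurable (Y t)) (t : ℤ) : Measurable (posPart Y t) := by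
  unfold posPart
  split_ifs
  · exact hY t
  · exact measurable_const

lemma history_eq_comap (Y : ℤ → Ω → ℕ) (t : ℤ) :
    history Y t = MeasurableSpace.comap (hist Y t) inferInstance := by
  rw [history, MeasurableSpace.pi, MeasurableSpace.comap_iSup]
  apply le_antisymm
  · refine iSup_le fun s => ?_
    refine le_trans ?_ (le_iSup _ (t - s.1).toNat)
    rw [MeasurableSpace.comap_comp]
    refine le_of_eq ?_
    congr 1
    funext ω
    have := s.2
    simp only [Function.comp, hist]
    congr 1
    omega
  · refine iSup_le fun k => ?_
    refine le_trans ?_ (le_iSup _ (⟨t - k, by omega⟩ : {s : ℤ // s ≤ t}))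
    rw [MeasurableSpace.comap_comp]
    exact le_of_eq rfl

lemma history_le (hY : ∀ t, Measurable (Y t)) (t : ℤ) : history Y t ≤ ‹MeasurableSpace Ω› :=
  iSup_le fun s => (hY s.1).comap_le

lemma history_mono (Y : ℤ → Ω → ℕ) {s t : ℤ} (h : s ≤ t) : history Y s ≤ history Y t :=
  iSup_le fun r => le_iSup (fun r : {s : ℤ // s ≤ t} => MeasurableSpace.comap (Y r) ⊤)
    ⟨r.1, r.2.trans h⟩

end Proc

/-- The kernel `y ↦ Poisson(lam y)`. -/
def poissonKernel (lam : NHist → ℝ≥0) (hlam : Measurable lam) : Kernel NHist ℕ where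
  toFun y := poissonMeasure (lam y)
  measurable' := by
    refine Measure.measurable_of_measurable_coe _ fun s _ => ?_
    have : ∀ y, poissonMeasure (lam y) s = ∑' n : ℕ,
        ENNReal.ofReal (Real.exp (-lam y) * lam y ^ n / n.factorial) *
          s.indicator 1 n := fun y => by
      rw [← lintegral_poisson, lintegral_indicator_one .of_discrete]
    simp_rw [this]
    fun_prop

variable {lam : NHist → ℝ≥0} {hlam : Measurable lam}

lemma poissonKernel_apply (y : NHist) : poissonKernel lam hlam y = poissonMeasure (lam y) := rfl

instance : IsMarkovKernel (poissonKernel lam hlam) := ⟨fun y => by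
  rw [poissonKernel_apply]; infer_instance⟩

/-- `Y_{t+1}` given `Y_t, Y_{t-1}, …` is Poisson with parameter `lam (Y_t, Y_{t-1}, …)`, expressed
through the joint law. -/
def CondLaw {Ω : Type*} [MeasurableSpace Ω] (μ : Measure Ω) (Y : ℤ → Ω → ℕ) (lam : NHist → ℝ≥0)
    (hlam : Measurable lam) (t : ℤ) : Prop :=
  μ.map (fun ω => (hist Y t ω, Y (t + 1) ω)) = (μ.map (hist Y t)) ⊗ₘ (poissonKernel lam hlam)

/-- The transition operator of the history process: the expectation of `g` at the next history. -/
def trans (lam : NHist → ℝ≥0) (g : NHist → ℝ) (y : NHist) : ℝ :=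
  ∫ k, g (cons k y) ∂(poissonMeasure (lam y))

section CondLaw

variable {Ω : Type*} [mΩ : MeasurableSpace Ω] {μ : Measure Ω} [IsProbabilityMeasure μ]
  {Y : ℤ → Ω → ℕ} {t : ℤ}

lemma prod_nat_eq_of_slices {ρ ρ' : Measure (NHist × ℕ)}
    (h : ∀ (s : Set NHist) (m : ℕ), MeasurableSet s → ρ (s ×ˢ {m}) = ρ' (s ×ˢ {m})) : ρ = ρ' := by
  ext S hS
  have hU : S = ⋃ m : ℕ, ((fun y => (y, m)) ⁻¹' S) ×ˢ {m} := by
    ext ⟨y, n⟩; simp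
  have hm : ∀ m : ℕ, MeasurableSet ((fun y : NHist => (y, m)) ⁻¹' S) := fun m =>
    measurable_prodMk_right hS
  have hd : Pairwise (Function.onFun Disjoint fun m : ℕ =>
      ((fun y : NHist => (y, m)) ⁻¹' S) ×ˢ ({m} : Set ℕ)) := by
    intro m n hmn
    refine Set.disjoint_left.2 ?_
    rintro ⟨y, k⟩ ⟨_, h1⟩ ⟨_, h2⟩
    simp only [Set.mem_singleton_iff] at h1 h2
    exact hmn (h1.symm.trans h2)
  rw [hU, measure_iUnion hd fun m => (hm m).prod (measurableSet_singleton m),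
    measure_iUnion hd fun m => (hm m).prod (measurableSet_singleton m)]
  exact tsum_congr fun m => h _ m (hm m)

lemma CondLaw.lintegral (hY : ∀ t, Measurable (Y t)) (h : CondLaw μ Y lam hlam t)
    {Φ : NHist → ℝ≥0∞} (hΦ : Measurable Φ) :
    ∫⁻ ω, Φ (hist Y (t + 1) ω) ∂μ =
      ∫⁻ ω, ∫⁻ k, Φ (cons k (hist Y t ω)) ∂(poissonMeasure (lam (hist Y t ω))) ∂μ := by
  have hm : Measurable fun p : NHist × ℕ => Φ (cons p.2 p.1) := hΦ.comp measurable_cons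
  have h1 : ∫⁻ ω, Φ (hist Y (t + 1) ω) ∂μ =
      ∫⁻ p, Φ (cons p.2 p.1) ∂(μ.map (fun ω => (hist Y t ω, Y (t + 1) ω))) := by
    rw [lintegral_map hm ((measurable_hist hY t).prodMk (hY _))]
    simp_rw [hist_succ]
  rw [h1, h, Measure.lintegral_compProd hm, lintegral_map _ (measurable_hist hY t)]
  · rfl
  · exact Measurable.lintegral_kernel_prod_right' hm

lemma integral_cons_measurable {E : Type*} [NormedAddCommGroup E] [NormedSpace ℝ E]
    {Φ : NHist → E} (hΦ : StronglyMeasurable Φ) :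
    StronglyMeasurable fun y => ∫ k, Φ (cons k y) ∂(poissonKernel lam hlam y) :=
  StronglyMeasurable.integral_kernel_prod_right' (hΦ.comp_measurable measurable_cons)

lemma measurable_trans {g : NHist → ℝ} (hlam : Measurable lam) (hg : Measurable g) :
    Measurable (trans lam g) :=
  (integral_cons_measurable (hlam := hlam) hg.stronglyMeasurable).measurable

lemma CondLaw.integrable_compProd {E : Type*} [NormedAddCommGroup E]
    (hY : ∀ t, Measurable (Y t)) (h : CondLaw μ Y lam hlam t)
    {Φ : NHist → E} (hΦ : StronglyMeasurable Φ)
    (hint : Integrable (fun ω => Φ (hist Y (t + 1) ω)) μ) :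
    Integrable (fun p : NHist × ℕ => Φ (cons p.2 p.1))
      ((μ.map (hist Y t)) ⊗ₘ (poissonKernel lam hlam)) := by
  have hm : StronglyMeasurable fun p : NHist × ℕ => Φ (cons p.2 p.1) :=
    hΦ.comp_measurable measurable_cons
  rw [← h, integrable_map_measure hm.aestronglyMeasurable
    ((measurable_hist hY t).prodMk (hY _)).aemeasurable]
  simpa [Function.comp_def, hist_succ] using hint

lemma CondLaw.integral {E : Type*} [NormedAddCommGroup E] [NormedSpace ℝ E]
    (hY : ∀ t, Measurable (Y t)) (h : CondLaw μ Y lam hlam t)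
    {Φ : NHist → E} (hΦ : StronglyMeasurable Φ)
    (hint : Integrable (fun ω => Φ (hist Y (t + 1) ω)) μ) :
    Integrable (fun ω => ∫ k, Φ (cons k (hist Y t ω)) ∂(poissonMeasure (lam (hist Y t ω)))) μ ∧
    ∫ ω, Φ (hist Y (t + 1) ω) ∂μ =
      ∫ ω, ∫ k, Φ (cons k (hist Y t ω)) ∂(poissonMeasure (lam (hist Y t ω))) ∂μ := by
  have hi := h.integrable_compProd hY hΦ hint
  have hm : StronglyMeasurable fun y => ∫ k, Φ (cons k y) ∂(poissonKernel lam hlam y) :=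
    integral_cons_measurable hΦ
  have h1 : ∫ ω, Φ (hist Y (t + 1) ω) ∂μ =
      ∫ p, Φ (cons p.2 p.1) ∂(μ.map (fun ω => (hist Y t ω, Y (t + 1) ω))) := by
    have hm' : StronglyMeasurable fun p : NHist × ℕ => Φ (cons p.2 p.1) :=
      hΦ.comp_measurable measurable_cons
    rw [integral_map ((measurable_hist hY t).prodMk (hY _)).aemeasurable
      hm'.aestronglyMeasurable]
    simp_rw [hist_succ]
  constructor
  · have := ((Measure.integrable_compProd_iff hi.1).1 hi).2.mono' hm.aestronglyMeasurable
      (.of_forall fun y => norm_integral_le_integral_norm _)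
    rw [integrable_map_measure hm.aestronglyMeasurable (measurable_hist hY t).aemeasurable] at this
    exact this
  · rw [h1, h, Measure.integral_compProd hi,
      integral_map (measurable_hist hY t).aemeasurable hm.aestronglyMeasurable]
    rfl

lemma CondLaw.condExp (hY : ∀ t, Measurable (Y t)) (h : CondLaw μ Y lam hlam t)
    {Φ : NHist → ℝ} (hΦ : Measurable Φ)
    (hint : Integrable (fun ω => Φ (hist Y (t + 1) ω)) μ) :
    μ[fun ω => Φ (hist Y (t + 1) ω) | history Y t] =ᵐ[μ] fun ω => trans lam Φ (hist Y t ω) := by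
  have hle := history_le hY t
  have hT := (h.integral hY hΦ.stronglyMeasurable hint).1
  refine (ae_eq_condExp_of_forall_setIntegral_eq hle hint (fun s _ _ => hT.integrableOn)
    (fun s hs _ => ?_) ?_).symm
  · have hs' := hle _ hs
    rw [history_eq_comap] at hs
    obtain ⟨A, hA, rfl⟩ := hs
    rw [← integral_indicator hs', ← integral_indicator hs']
    have hm : StronglyMeasurable fun y => (tl ⁻¹' A).indicator Φ y :=
      (hΦ.indicator (measurable_tl hA)).stronglyMeasurable
    have e : ∀ ω, (hist Y t ⁻¹' A).indicator (fun ω => Φ (hist Y (t + 1) ω)) ω =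
        (tl ⁻¹' A).indicator Φ (hist Y (t + 1) ω) := fun ω => by
      by_cases hω : hist Y t ω ∈ A
      · simp [hω]
      · simp [hω]
    have := (h.integral hY hm ?_).2
    · simp_rw [e, this]
      congr 1
      funext ω
      by_cases hω : hist Y t ω ∈ A
      · simp [hω, Set.indicator]
      · simp [hω, Set.indicator]
    · refine (hint.indicator hs').congr (.of_forall fun ω => e ω)
  · refine StronglyMeasurable.aestronglyMeasurable ?_
    rw [history_eq_comap]
    exact ((measurable_trans hlam hΦ).comp (comap_measurable _)).stronglyMeasurable

/-- Masses of slices under the joint law of a history and a Poisson variable. -/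
lemma compProd_slice (ρ : Measure NHist) [SFinite ρ] {s : Set NHist} (hs : MeasurableSet s)
    (m : ℕ) : (ρ ⊗ₘ (poissonKernel lam hlam)) (s ×ˢ {m}) =
      ∫⁻ y in s, ENNReal.ofReal (Real.exp (-lam y) * lam y ^ m / m.factorial) ∂ρ := by
  rw [Measure.compProd_apply_prod hs (measurableSet_singleton m)]
  simp_rw [poissonKernel_apply, poissonMeasure_singleton]

variable {d : ℕ} {f : MeanFamily d} {θ : Param d}

lemma setIntegral_indicator_eq (hY : ∀ t, Measurable (Y t)) (A : Set NHist) (m : ℕ) (s t : ℤ) : ∫ ω in hist Y t ⁻¹' A, Set.indicator {ω | Y s ω = m} (fun _ => (1 : ℝ)) ω ∂μ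
      = μ.real {ω | hist Y t ω ∈ A ∧ Y s ω = m} := by
  have hm : MeasurableSet {ω | Y s ω = m} := hY s (measurableSet_singleton m)
  rw [integral_indicator hm, Measure.restrict_restrict hm]
  simp only [integral_const, smul_eq_mul, mul_one, Measure.real, Measure.restrict_apply_univ]
  congr 2
  ext ω
  simp [and_comm]

lemma CondPoisson.condLaw (hY : ∀ t, Measurable (Y t)) (hf : ∀ y, f θ (toHist y) = lam y)
    (h : CondPoisson μ Y f θ (t + 1)) : CondLaw μ Y lam hlam t := by
  refine prod_nat_eq_of_slices fun A m hA => ?_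
  have hle := history_le hY t
  have hmm : MeasurableSet {ω | Y (t + 1) ω = m} := hY _ (measurableSet_singleton m)
  have hp := h m
  rw [add_sub_cancel_right] at hp
  have hsA : MeasurableSet[history Y t] (hist Y t ⁻¹' A) := by
    rw [history_eq_comap]; exact ⟨A, hA, rfl⟩
  have hint : Integrable (Set.indicator {ω | Y (t + 1) ω = m} fun _ => (1 : ℝ)) μ :=
    (integrable_const _).indicator hmm
  have h1 := setIntegral_condExp hle hint hsA
  rw [setIntegral_congr_ae (hle _ hsA) (hp.mono fun ω hω _ => hω),
    setIntegral_indicator_eq hY A] at h1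
  have hset : (fun ω => (hist Y t ω, Y (t + 1) ω)) ⁻¹' (A ×ˢ {m}) =
    {ω | hist Y t ω ∈ A ∧ Y (t + 1) ω = m} := rfl
  have hmeas : Measurable fun y =>
      ENNReal.ofReal (Real.exp (-lam y) * (lam y : ℝ) ^ m / m.factorial) := by fun_prop
  rw [compProd_slice _ hA, Measure.map_apply ((measurable_hist hY t).prodMk (hY _))
    (hA.prod (measurableSet_singleton m)), hset, ← ofReal_measureReal, ← h1,
    setLIntegral_map hA hmeas (measurable_hist hY t)]
  simp_rw [past_eq, hf]
  refine ofReal_integral_eq_lintegral_ofReal ?_ (.of_forall fun ω => by positivity)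
  refine Integrable.integrableOn ?_
  have : Integrable (fun ω => Real.exp (-f θ (past Y (t + 1) ω)) * f θ (past Y (t + 1) ω) ^ m /
      (m.factorial : ℝ)) μ := integrable_condExp.congr hp
  simpa only [past_eq, hf] using this

lemma CondLaw.condPoisson (hY : ∀ t, Measurable (Y t)) (hf : ∀ y, f θ (toHist y) = lam y)
    (h : CondLaw μ Y lam hlam t) : CondPoisson μ Y f θ (t + 1) := by
  intro m
  rw [add_sub_cancel_right]
  have hΦ : Measurable fun y : NHist => Set.indicator {n : ℕ | n = m} (fun _ => (1 : ℝ)) (y 0) :=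
    (measurable_from_nat (f := Set.indicator {n : ℕ | n = m} (fun _ => (1 : ℝ)))).comp
      (measurable_pi_apply 0)
  have h1 := h.condExp hY hΦ ?_
  · have e1 : (fun ω => Set.indicator {n : ℕ | n = m} (fun _ => (1 : ℝ)) (hist Y (t + 1) ω 0)) =
        Set.indicator {ω | Y (t + 1) ω = m} fun _ => (1 : ℝ) := by
      funext ω
      simp [Set.indicator, hist]
    rw [e1] at h1
    refine h1.trans (.of_forall fun ω => ?_)
    simp only [trans, cons_zero]
    rw [past_eq, hf, integral_indicator .of_discrete]
    simp only [integral_const, smul_eq_mul, mul_one, Measure.real, Measure.restrict_apply_univ]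
    simp only [Set.ofPred_eq_eq_singleton]
    exact poissonMeasure_real_singleton _ _
  · refine Integrable.of_bound
      (hΦ.comp (measurable_hist hY (t + 1))).aestronglyMeasurable 1 (.of_forall fun ω => ?_)
    simp only [Set.indicator]
    split_ifs <;> simp

end CondLaw

/-! ### Contractive conditional means and moment bounds -/

/-- The weighted `ℓ¹` distance of two integer histories, possibly infinite. -/
def wd (w : ℕ → ℝ≥0) (y y' : NHist) : ℝ≥0∞ := ∑' k, (w k : ℝ≥0∞) * edist (y k) (y' k)

/-- The conditional mean `lam` is Lipschitz in the history, with coefficients `α` of sum less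
than one. -/
structure Contractive (lam : NHist → ℝ≥0) (α : ℕ → ℝ≥0) : Prop where
  summable : Summable α
  sum_lt : ∑' k, α k < 1
  lip : ∀ y y', edist (lam y) (lam y') ≤ wd α y y'

lemma edist_nat_zero (n : ℕ) : edist n 0 = (n : ℝ≥0∞) := by
  rw [edist_dist, Nat.dist_eq]; simp

lemma wd_zero (w : ℕ → ℝ≥0) (y : NHist) : wd w y 0 = ∑' k, (w k : ℝ≥0∞) * y k :=
  tsum_congr fun k => by rw [Pi.zero_apply, edist_nat_zero]

variable {lam : NHist → ℝ≥0} {hlam : Measurable lam} {α : ℕ → ℝ≥0}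

lemma Contractive.le (h : Contractive lam α) (y : NHist) :
    (lam y : ℝ≥0∞) ≤ lam 0 + ∑' k, (α k : ℝ≥0∞) * y k := by
  rw [← wd_zero]
  have h1 : (lam y : ℝ≥0∞) ≤ lam 0 + edist (lam y) (lam 0) := by
    have h0 := edist_triangle (lam y) (lam 0) 0
    have e : ∀ x : ℝ≥0, edist x 0 = (x : ℝ≥0∞) := fun x => by
      rw [edist_nndist]; simp
    rw [e, e] at h0
    rwa [add_comm]
  exact h1.trans (by gcongr; exact h.lip y 0)

lemma Contractive.tsum_coe (h : Contractive lam α) :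
    ∑' k, (α k : ℝ≥0∞) = ((∑' k, α k : ℝ≥0) : ℝ≥0∞) := (ENNReal.coe_tsum h.summable).symm

/-- Lyapunov-type inequality: the conditional moment of order `r + 1` of the next value is at most
a constant plus a weighted sum of past powers with weights of sum less than one. The `L^p` norm of
a Poisson variable exceeds its mean by a constant only, so that convexity of the power function
suffices. -/
lemma Contractive.exists_drift (h : Contractive lam α) (r : ℕ) : ∃ K : ℝ≥0, ∀ y : NHist,
    ∫⁻ k, (k : ℝ≥0∞) ^ (r + 1) ∂(poissonMeasure (lam y)) ≤
      K + ∑' k, (α k : ℝ≥0∞) * (y k : ℝ≥0∞) ^ (r + 1) := by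
  set a : ℝ≥0 := ∑' k, α k with ha
  set c : ℝ≥0 := 1 - a with hc
  have hc0 : c ≠ 0 := (tsub_pos_of_lt h.sum_lt).ne'
  set C : ℝ≥0 := lam 0 + (r + 1 : ℕ) with hC
  refine ⟨c * (C / c) ^ (r + 1), fun y => ?_⟩
  have h0 : ∀ g : ℕ → ℝ≥0∞, ∑' k, g k = g 0 + ∑' k, g (k + 1) := fun g =>
    tsum_eq_zero_add' ENNReal.summable
  -- Jensen's inequality for the weights `c, α₀, α₁, …` of total mass one
  let w : ℕ → ℝ≥0∞ := fun k => Nat.casesOn k (c : ℝ≥0∞) fun k => (α k : ℝ≥0∞)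
  let z : ℕ → ℝ≥0∞ := fun k => Nat.casesOn k ((C / c : ℝ≥0) : ℝ≥0∞) fun k => (y k : ℝ≥0∞)
  have h1 := ennreal_tsum_mul_pow_le w z r
  rw [h0 (fun k => w k * z k), h0 w, h0 (fun k => w k * z k ^ (r + 1))] at h1
  change ((c : ℝ≥0∞) * ((C / c : ℝ≥0) : ℝ≥0∞) + ∑' k, (α k : ℝ≥0∞) * y k) ^ (r + 1) ≤
    ((c : ℝ≥0∞) + ∑' k, (α k : ℝ≥0∞)) ^ r * ((c : ℝ≥0∞) * ((C / c : ℝ≥0) : ℝ≥0∞) ^ (r + 1) +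
      ∑' k, (α k : ℝ≥0∞) * (y k : ℝ≥0∞) ^ (r + 1)) at h1
  have hsum : (c : ℝ≥0∞) + ∑' k, (α k : ℝ≥0∞) = 1 := by
    rw [h.tsum_coe, ← ENNReal.coe_add, hc, tsub_add_cancel_of_le h.sum_lt.le, ENNReal.coe_one]
  have hcC : (c : ℝ≥0∞) * ((C / c : ℝ≥0) : ℝ≥0∞) = C := by
    rw [← ENNReal.coe_mul, mul_div_cancel₀ _ hc0]
  rw [hsum, one_pow, one_mul, hcC] at h1
  refine (lintegral_poisson_pow_le _ _).trans (le_trans ?_ (h1.trans (le_of_eq ?_)))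
  · refine pow_le_pow_left' ?_ _
    rw [hC]
    push_cast
    calc (lam y : ℝ≥0∞) + (r + 1) ≤ (lam 0 + ∑' k, (α k : ℝ≥0∞) * y k) + (r + 1) := by
          gcongr; exact h.le y
      _ = _ := by ring
  · push_cast; rfl

section Moments

variable {Ω : Type*} [mΩ : MeasurableSpace Ω] {μ : Measure Ω} [IsProbabilityMeasure μ]
  {Y : ℤ → Ω → ℕ}

lemma measurable_natCast_pow (hY : ∀ t, Measurable (Y t)) (t : ℤ) (r : ℕ) :
    Measurable fun ω => (Y t ω : ℝ≥0∞) ^ r :=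
  (measurable_from_nat (f := fun n : ℕ => (n : ℝ≥0∞) ^ r)).comp (hY t)

lemma exists_moment_bound (hY : ∀ t, Measurable (Y t)) (h : Contractive lam α)
    (hlaw : ∀ t : ℕ, CondLaw μ Y lam hlam t)
    (hpast : ∀ r : ℕ, ∃ C : ℝ≥0, ∀ t : ℤ, t ≤ 0 → ∫⁻ ω, (Y t ω : ℝ≥0∞) ^ r ∂μ ≤ C) (r : ℕ) :
    ∃ C : ℝ≥0, ∀ t : ℤ, ∫⁻ ω, (Y t ω : ℝ≥0∞) ^ r ∂μ ≤ C := by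
  cases r with
  | zero => exact ⟨1, fun t => by simp⟩
  | succ r =>
    obtain ⟨C, hC⟩ := hpast (r + 1)
    obtain ⟨K, hK⟩ := h.exists_drift r
    set a : ℝ≥0 := ∑' k, α k with ha
    have hc0 : 1 - a ≠ 0 := (tsub_pos_of_lt h.sum_lt).ne'
    set B : ℝ≥0 := max C (K / (1 - a)) with hB
    have hKB : K + a * B ≤ B := by
      have : K ≤ (1 - a) * B := by
        have : K = (1 - a) * (K / (1 - a)) := (mul_div_cancel₀ _ hc0).symm
        rw [this]
        gcongr
        exact le_max_right _ _
      calc K + a * B ≤ (1 - a) * B + a * B := by gcongr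
        _ = B := by rw [← add_mul, tsub_add_cancel_of_le h.sum_lt.le, one_mul]
    have key : ∀ n : ℕ, ∀ t : ℤ, t ≤ n → ∫⁻ ω, (Y t ω : ℝ≥0∞) ^ (r + 1) ∂μ ≤ B := by
      intro n
      induction n with
      | zero =>
        intro t ht
        exact (hC t (by simpa using ht)).trans (by exact_mod_cast le_max_left _ _)
      | succ n ih =>
        intro t ht
        rcases (Int.lt_or_eq_of_le ht) with h' | h'
        · exact ih t (by push_cast at h'; omega)
        · have ht' : t = (n : ℤ) + 1 := by rw [h']; push_cast; rfl
          subst ht'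
          have hΦ : Measurable fun y : NHist => (y 0 : ℝ≥0∞) ^ (r + 1) :=
            (measurable_from_nat (f := fun n : ℕ => (n : ℝ≥0∞) ^ (r + 1))).comp
              (measurable_pi_apply 0)
          have h1 := (hlaw n).lintegral hY hΦ
          have e : ∀ ω, hist Y ((n : ℤ) + 1) ω 0 = Y ((n : ℤ) + 1) ω := fun ω => by simp [hist]
          simp only [e, cons_zero] at h1
          rw [h1]
          calc _ ≤ ∫⁻ ω, (K + ∑' k, (α k : ℝ≥0∞) * (Y ((n : ℤ) - k) ω : ℝ≥0∞) ^ (r + 1)) ∂μ :=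
                lintegral_mono fun ω => hK _
            _ = K + ∑' k : ℕ, (α k : ℝ≥0∞) * ∫⁻ ω, (Y ((n : ℤ) - k) ω : ℝ≥0∞) ^ (r + 1) ∂μ := by
                rw [lintegral_add_left measurable_const, lintegral_tsum fun k =>
                  ((measurable_natCast_pow hY _ _).const_mul _).aemeasurable]
                simp only [lintegral_const, measure_univ, mul_one]
                congr 1
                exact tsum_congr fun k => lintegral_const_mul _ (measurable_natCast_pow hY _ _)
            _ ≤ K + ∑' k : ℕ, (α k : ℝ≥0∞) * B := by
                gcongr with k
                exact ih _ (by omega)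
            _ = ((K + a * B : ℝ≥0) : ℝ≥0∞) := by
                rw [ENNReal.tsum_mul_right, h.tsum_coe]; push_cast; rfl
            _ ≤ B := by exact_mod_cast hKB
    exact ⟨B, fun t => key t.toNat t (Int.self_le_toNat t)⟩

end Moments

/-! ### Contraction of the transition operator -/

/-- If `g` is Lipschitz with coefficients `w`, then the expectation of `g` after one transition is
Lipschitz with coefficients `shiftW α w`. -/
def shiftW (α w : ℕ → ℝ≥0) : ℕ → ℝ≥0 := fun k => w 0 * α k + w (k + 1)

lemma wd_shiftW (w : ℕ → ℝ≥0) (y y' : NHist) :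
    wd (shiftW α w) y y' = w 0 * wd α y y' + ∑' k, (w (k + 1) : ℝ≥0∞) * edist (y k) (y' k) := by
  simp only [wd, shiftW]
  rw [← ENNReal.tsum_mul_left, ← ENNReal.tsum_add]
  refine tsum_congr fun k => ?_
  push_cast
  ring

lemma wd_cons (w : ℕ → ℝ≥0) (m n : ℕ) (y y' : NHist) : wd w (cons m y) (cons n y') =
    w 0 * edist m n + ∑' k, (w (k + 1) : ℝ≥0∞) * edist (y k) (y' k) := by
  rw [wd, tsum_eq_zero_add' ENNReal.summable]
  simp

lemma abs_trans_le {g : NHist → ℝ} {B : ℝ} (hg : ∀ y, |g y| ≤ B) (y : NHist) :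
    |trans lam g y| ≤ B := by
  have := norm_integral_le_of_norm_le_const (μ := poissonMeasure (lam y)) (C := B)
    (f := fun k => g (cons k y)) (.of_forall fun k => hg _)
  simpa [trans] using this

lemma Contractive.trans_lip (h : Contractive lam α) {g : NHist → ℝ} {B : ℝ} (hg : ∀ y, |g y| ≤ B)
    {w : ℕ → ℝ≥0} (hw : ∀ y y', edist (g y) (g y') ≤ wd w y y') (y y' : NHist) :
    edist (trans lam g y) (trans lam g y') ≤ wd (shiftW α w) y y' := by
  have hint : ∀ (z : NHist) (s : ℝ≥0), Integrable (fun k => g (cons k z)) (poissonMeasure s) :=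
    fun z s => Integrable.of_bound .of_discrete B (.of_forall fun n => hg _)
  rw [wd_shiftW]
  refine (edist_triangle _ (∫ k, g (cons k y) ∂(poissonMeasure (lam y'))) _).trans ?_
  refine add_le_add ?_ ?_
  · have h1 := abs_integral_poisson_sub_le (g := fun k => g (cons k y)) (L := w 0) (B := B)
      (fun n => hg _) (fun n k => ?_) (lam y) (lam y')
    · calc edist (trans lam g y) (∫ k, g (cons k y) ∂(poissonMeasure (lam y')))
          ≤ ENNReal.ofReal (w 0 * |(lam y : ℝ) - lam y'|) := by
            rw [edist_dist, Real.dist_eq]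
            exact ENNReal.ofReal_le_ofReal h1
        _ = w 0 * edist (lam y) (lam y') := by
            rw [ENNReal.ofReal_mul (by positivity), edist_dist, NNReal.dist_eq]
            simp
        _ ≤ _ := by gcongr; exact h.lip y y'
    · have h2 := hw (cons (n + k) y) (cons n y)
      rw [wd_cons] at h2
      simp only [edist_self, mul_zero, tsum_zero, add_zero] at h2
      rw [edist_dist, edist_dist, Real.dist_eq, Nat.dist_eq] at h2
      have h3 : (w 0 : ℝ≥0∞) * ENNReal.ofReal |((n + k : ℕ) : ℝ) - n| =
          ENNReal.ofReal (w 0 * k) := by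
        rw [ENNReal.ofReal_mul (by positivity)]
        simp
      rw [h3] at h2
      exact (ENNReal.ofReal_le_ofReal_iff (by positivity)).1 h2
  · rw [trans, edist_eq_enorm_sub, ← integral_sub (hint _ _) (hint _ _)]
    refine (enorm_integral_le_lintegral_enorm _).trans ?_
    calc _ ≤ ∫⁻ _k : ℕ, ∑' k, (w (k + 1) : ℝ≥0∞) * edist (y k) (y' k)
          ∂(poissonMeasure (lam y')) := by
          refine lintegral_mono fun k => ?_
          rw [← edist_eq_enorm_sub]
          have := hw (cons k y) (cons k y')
          rwa [wd_cons, edist_self, mul_zero, zero_add] at this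
      _ = _ := by simp

lemma summable_shiftW {w : ℕ → ℝ≥0} (hα : Summable α) (hw : Summable w) :
    Summable (shiftW α w) := (hα.mul_left _).add ((NNReal.summable_nat_add_iff 1).2 hw)

lemma summable_iterate_shiftW {w : ℕ → ℝ≥0} (hα : Summable α) (hw : Summable w) (m : ℕ) :
    Summable ((shiftW α)^[m] w) := by
  induction m with
  | zero => exact hw
  | succ m ih => rw [Function.iterate_succ_apply']; exact summable_shiftW hα ih

lemma iterate_shiftW_apply (w : ℕ → ℝ≥0) (m : ℕ) : ∀ k, (shiftW α)^[m] w k =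
    w (k + m) + ∑ j ∈ Finset.range m, (shiftW α)^[j] w 0 * α (k + (m - 1 - j)) := by
  induction m with
  | zero => intro k; simp
  | succ m ih =>
    intro k
    rw [Function.iterate_succ_apply', shiftW, ih (k + 1), Finset.sum_range_succ]
    have : ∀ j ∈ Finset.range m, (shiftW α)^[j] w 0 * α (k + 1 + (m - 1 - j)) =
        (shiftW α)^[j] w 0 * α (k + (m + 1 - 1 - j)) := fun j hj => by
      have := Finset.mem_range.1 hj
      congr 2
      omega
    rw [Finset.sum_congr rfl this]
    have e1 : k + 1 + m = k + (m + 1) := by ring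
    have e2 : k + (m + 1 - 1 - m) = k := by omega
    rw [e1, e2]
    ring

/-- The total mass of the Lipschitz coefficients after `m` transitions tends to zero. Each
transition loses the mass `(1 - ∑ α) w₀`, so that the leading coefficients are summable, and all
mass is a shift of `w` or of an `α` created earlier. -/
lemma tendsto_tsum_iterate_shiftW (hα : Summable α) (hα1 : ∑' k, α k < 1) {w : ℕ → ℝ≥0}
    (hw : Summable w) :
    Tendsto (fun m => ∑' k, ((shiftW α)^[m] w k : ℝ)) atTop (𝓝 0) := by
  set a : ℕ → ℝ := fun j => ((shiftW α)^[j] w 0 : ℝ) with ha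
  have hsum : ∀ m, Summable fun k => ((shiftW α)^[m] w k : ℝ) := fun m =>
    NNReal.summable_coe.2 (summable_iterate_shiftW hα hw m)
  have hα' : Summable fun k => (α k : ℝ) := NNReal.summable_coe.2 hα
  have hw' : Summable fun k => (w k : ℝ) := NNReal.summable_coe.2 hw
  have hα1' : ∑' k, (α k : ℝ) < 1 := by rw [← NNReal.coe_tsum]; exact_mod_cast hα1
  set S : ℕ → ℝ := fun m => ∑' k, ((shiftW α)^[m] w k : ℝ) with hS
  have hrec : ∀ m, S (m + 1) = S m - (1 - ∑' k, (α k : ℝ)) * a m := by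
    intro m
    have h1 : ∀ k, ((shiftW α)^[m + 1] w k : ℝ) =
        a m * α k + ((shiftW α)^[m] w (k + 1) : ℝ) := fun k => by
      rw [Function.iterate_succ_apply', shiftW]; push_cast; rfl
    simp only [hS]
    rw [tsum_congr h1, Summable.tsum_add (hα'.mul_left _) ((summable_nat_add_iff 1).2 (hsum m)),
      (hsum m).tsum_eq_zero_add, tsum_mul_left]
    simp only [ha]
    ring
  have ha0 : ∀ m, 0 ≤ a m := fun m => NNReal.coe_nonneg _
  have hasum : Summable a := by
    refine summable_of_sum_range_le (c := S 0 / (1 - ∑' k, (α k : ℝ))) ha0 fun n => ?_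
    have h1 : ∀ n, (1 - ∑' k, (α k : ℝ)) * ∑ i ∈ Finset.range n, a i = S 0 - S n := by
      intro n
      induction n with
      | zero => simp
      | succ n ih => rw [Finset.sum_range_succ, mul_add, ih, hrec n]; ring
    rw [le_div_iff₀ (by linarith), mul_comm, h1]
    have : 0 ≤ S n := tsum_nonneg fun k => NNReal.coe_nonneg _
    linarith
  set T : ℕ → ℝ := fun n => ∑' k, (α (k + n) : ℝ) with hT
  have hT0 : Tendsto T atTop (𝓝 0) := tendsto_sum_nat_add fun k => (α k : ℝ)
  have hTw : Tendsto (fun n => ∑' k, (w (k + n) : ℝ)) atTop (𝓝 0) :=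
    tendsto_sum_nat_add fun k => (w k : ℝ)
  have hTle : ∀ n, 0 ≤ T n ∧ T n ≤ ∑' k, (α k : ℝ) := fun n => by
    refine ⟨tsum_nonneg fun k => NNReal.coe_nonneg _, ?_⟩
    have := hα'.sum_add_tsum_nat_add n
    have h2 : 0 ≤ ∑ i ∈ Finset.range n, (α i : ℝ) :=
      Finset.sum_nonneg fun i _ => NNReal.coe_nonneg _
    simp only [hT]
    linarith
  have hform : ∀ m, S m = ∑' k, (w (k + m) : ℝ) +
      ∑' j, if j < m then a j * T (m - 1 - j) else 0 := by
    intro m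
    have hs : ∀ j, Summable fun k => a j * (α (k + (m - 1 - j)) : ℝ) := fun j =>
      ((summable_nat_add_iff (m - 1 - j)).2 hα').mul_left _
    rw [tsum_eq_sum (f := fun j => if j < m then a j * T (m - 1 - j) else 0)
      (s := Finset.range m) (by simp +contextual)]
    simp only [hS]
    have : ∀ k, ((shiftW α)^[m] w k : ℝ) = (w (k + m) : ℝ) +
        ∑ j ∈ Finset.range m, a j * (α (k + (m - 1 - j)) : ℝ) := fun k => by
      rw [iterate_shiftW_apply]; push_cast; rfl
    rw [tsum_congr this, Summable.tsum_add ((summable_nat_add_iff m).2 hw')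
      (summable_sum fun j _ => hs j), Summable.tsum_finsetSum fun j _ => hs j]
    congr 1
    refine Finset.sum_congr rfl fun j hj => ?_
    rw [if_pos (Finset.mem_range.1 hj), tsum_mul_left]
  have hconv : Tendsto (fun m => ∑' j, if j < m then a j * T (m - 1 - j) else 0) atTop
      (𝓝 (∑' _j : ℕ, (0 : ℝ))) := by
    refine tendsto_tsum_of_dominated_convergence
      (bound := fun j => a j * ∑' k, (α k : ℝ)) (hasum.mul_right _) (fun j => ?_)
      (.of_forall fun m j => ?_)
    · have h1 : Tendsto (fun m => a j * T (m - 1 - j)) atTop (𝓝 (a j * 0)) := by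
        refine (hT0.comp ?_).const_mul _
        exact tendsto_atTop_mono (fun m => by omega) (tendsto_sub_atTop_nat (1 + j))
      rw [mul_zero] at h1
      refine h1.congr' ?_
      filter_upwards [eventually_gt_atTop j] with m hm
      rw [if_pos hm]
    · split_ifs
      · rw [Real.norm_of_nonneg (mul_nonneg (ha0 j) (hTle _).1)]
        exact mul_le_mul_of_nonneg_left (hTle _).2 (ha0 j)
      · rw [norm_zero]
        exact mul_nonneg (ha0 j) (tsum_nonneg fun k => NNReal.coe_nonneg _)
  rw [tsum_zero] at hconv
  have := hTw.add hconv
  rw [add_zero] at this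
  exact this.congr fun m => (hform m).symm

/-- Decreasing weights `b` on past values, decaying no faster than geometrically and fast enough
for truncating the past at time `0` to have an effect of order `o(√n)` on sums over `n` terms. -/
structure IsWeight (b : ℕ → ℝ≥0) : Prop where
  pos : ∀ k, 0 < b k
  zero : b 0 = 1
  anti : Antitone b
  shift : ∃ R : ℝ≥0, ∀ k, b k ≤ R * b (k + 1)
  summable : Summable b
  summable_sqrt : Summable fun k : ℕ => (b k : ℝ) * √((k : ℝ) + 1)

lemma iterate_shiftW_le {b w : ℕ → ℝ≥0} (hb : IsWeight b) (hα : ∃ C : ℝ≥0, ∀ k, α k ≤ C * b k)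
    (hw : ∃ C : ℝ≥0, ∀ k, w k ≤ C * b k) (m : ℕ) :
    ∃ C : ℝ≥0, ∀ k, (shiftW α)^[m] w k ≤ C * b k := by
  induction m with
  | zero => exact hw
  | succ m ih =>
    obtain ⟨C, hC⟩ := ih
    obtain ⟨C', hC'⟩ := hα
    refine ⟨(shiftW α)^[m] w 0 * C' + C, fun k => ?_⟩
    rw [Function.iterate_succ_apply', shiftW, add_mul, mul_assoc]
    gcongr
    · exact hC' k
    · exact (hC _).trans (by gcongr; exact hb.anti (Nat.le_succ k))

/-! ### A strong law for martingale differences -/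

section SLLN

variable {Ω : Type*} [mΩ : MeasurableSpace Ω] {μ : Measure Ω} [IsProbabilityMeasure μ]

lemma summable_inv_sq : Summable fun t : ℕ => (((t : ℝ) + 1) ^ 2)⁻¹ := by
  have h := (summable_nat_add_iff 1).2 (Real.summable_nat_pow_inv (p := 2).2 one_lt_two)
  exact_mod_cast h

/-- A strong law of large numbers for martingale differences bounded in `L²`: the martingale
`∑ D_t / (t + 1)` is bounded in `L²` and converges, and Kronecker's lemma applies. -/
lemma ae_tendsto_average_martingale_diff {ℱ : Filtration ℕ mΩ} {D : ℕ → Ω → ℝ}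
    (hmeas : ∀ t, StronglyMeasurable[ℱ (t + 1)] (D t)) (hL2 : ∀ t, MemLp (D t) 2 μ)
    (hD : ∀ t, μ[D t | ℱ t] =ᵐ[μ] 0) {C : ℝ} (hC : ∀ t, ∫ ω, D t ω ^ 2 ∂μ ≤ C) :
    ∀ᵐ ω ∂μ, Tendsto (fun n : ℕ => (n : ℝ)⁻¹ * ∑ t ∈ Finset.range n, D t ω) atTop (𝓝 0) := by
  set M : ℕ → Ω → ℝ := fun n ω => ∑ t ∈ Finset.range n, D t ω / (t + 1) with hM
  have hMs : ∀ n, M (n + 1) = M n + fun ω => D n ω / (n + 1) := fun n => by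
    funext ω; simp [hM, Finset.sum_range_succ]
  have hadp : StronglyAdapted ℱ M := fun n => by
    refine Finset.stronglyMeasurable_fun_sum _ fun t ht => ?_
    simp only [div_eq_mul_inv]
    exact ((hmeas t).mono (ℱ.mono (Finset.mem_range.1 ht))).mul_const _
  have hML2 : ∀ n, MemLp (M n) 2 μ := fun n => by
    refine memLp_finsetSum _ fun t _ => ?_
    simpa [div_eq_mul_inv, mul_comm] using (hL2 t).const_mul (((t : ℝ) + 1)⁻¹)
  have hMint : ∀ n, Integrable (M n) μ := fun n => (hML2 n).integrable one_le_two
  have hC0 : 0 ≤ C := (integral_nonneg fun ω => sq_nonneg _).trans (hC 0)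
  have hDint : ∀ n, Integrable (D n) μ := fun n => (hL2 n).integrable one_le_two
  have hmart : Martingale M ℱ μ := by
    refine martingale_of_condExp_sub_eq_zero_nat hadp hMint fun n => ?_
    have : M (n + 1) - M n = (((n : ℝ) + 1)⁻¹) • D n := by
      rw [hMs]; funext ω; simp [div_eq_mul_inv, mul_comm]
    rw [this]
    refine (condExp_smul _ _ _).trans ?_
    filter_upwards [hD n] with ω hω
    simp [hω]
  have hcross : ∀ n, ∫ ω, M n ω * D n ω ∂μ = 0 := by
    intro n
    have hi : Integrable (M n * D n) μ := (hML2 n).integrable_mul (hL2 n)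
    have h1 := condExp_mul_of_stronglyMeasurable_left (hadp n) hi (hDint n)
    have h2 : μ[M n * D n | ℱ n] =ᵐ[μ] 0 := by
      filter_upwards [h1, hD n] with ω h1 h2
      rw [h1]; simp [h2]
    have h3 := integral_condExp (ℱ.le n) (f := M n * D n) (μ := μ)
    rw [integral_congr_ae h2] at h3
    simpa using h3.symm
  have hsq : ∀ n, ∫ ω, M n ω ^ 2 ∂μ ≤ ∑ t ∈ Finset.range n, C * (((t : ℝ) + 1) ^ 2)⁻¹ := by
    intro n
    induction n with
    | zero => simp [hM]
    | succ n ih =>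
      have e : ∀ ω, M (n + 1) ω ^ 2 = M n ω ^ 2 + (2 * ((n : ℝ) + 1)⁻¹) * (M n ω * D n ω) +
          (((n : ℝ) + 1) ^ 2)⁻¹ * D n ω ^ 2 := fun ω => by
        rw [hMs]; simp only [Pi.add_apply]; field_simp; ring
      simp_rw [e]
      have i1 : Integrable (fun ω => M n ω ^ 2) μ := (hML2 n).integrable_sq
      have i2 : Integrable (fun ω => (2 * ((n : ℝ) + 1)⁻¹) * (M n ω * D n ω)) μ :=
        ((hML2 n).integrable_mul (hL2 n)).const_mul _
      have i3 : Integrable (fun ω => (((n : ℝ) + 1) ^ 2)⁻¹ * D n ω ^ 2) μ :=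
        (hL2 n).integrable_sq.const_mul _
      have i12 : Integrable (fun ω => M n ω ^ 2 + (2 * ((n : ℝ) + 1)⁻¹) * (M n ω * D n ω)) μ :=
        i1.add i2
      rw [integral_add i12 i3, integral_add i1 i2, integral_const_mul, integral_const_mul,
        hcross, mul_zero, add_zero, Finset.sum_range_succ]
      refine add_le_add ih ?_
      rw [mul_comm C]
      exact mul_le_mul_of_nonneg_left (hC n) (by positivity)
  set R : ℝ := 1 + C * ∑' t : ℕ, (((t : ℝ) + 1) ^ 2)⁻¹ with hR
  have hbdd : ∀ n, eLpNorm (M n) 1 μ ≤ (R.toNNReal : ℝ≥0∞) := by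
    intro n
    rw [eLpNorm_one_eq_lintegral_enorm, ← ofReal_integral_norm_eq_lintegral_enorm (hMint n)]
    refine ENNReal.ofReal_le_ofReal ?_
    calc ∫ ω, ‖M n ω‖ ∂μ ≤ ∫ ω, (1 + M n ω ^ 2) ∂μ := by
          refine integral_mono (hMint n).norm ((integrable_const _).add (hML2 n).integrable_sq)
            fun ω => ?_
          simp only [Real.norm_eq_abs]
          nlinarith [sq_abs (M n ω), sq_nonneg (|M n ω| - 1), abs_nonneg (M n ω)]
      _ = 1 + ∫ ω, M n ω ^ 2 ∂μ := by
          rw [integral_add (integrable_const _) (hML2 n).integrable_sq]; simp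
      _ ≤ R := by
          rw [hR]
          gcongr
          refine (hsq n).trans ?_
          rw [← Finset.mul_sum]
          gcongr
          exact summable_inv_sq.sum_le_tsum _ fun t _ => by positivity
  filter_upwards [hmart.submartingale.ae_tendsto_limitProcess hbdd] with ω hω
  exact tendsto_inv_mul_sum_of_tendsto_sum_div hω

end SLLN

/-! ### Laws of large numbers for the observed process -/

lemma eLpNorm_two_sq {Ω : Type*} [MeasurableSpace Ω] {μ : Measure Ω} (g : Ω → ℝ) :
    eLpNorm g 2 μ ^ 2 = ∫⁻ ω, ‖g ω‖ₑ ^ 2 ∂μ := by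
  have := eLpNorm_nnreal_pow_eq_lintegral (μ := μ) (f := g) (p := 2) two_ne_zero
  simpa using this

lemma integral_sq_le_of_eLpNorm_le {Ω : Type*} [MeasurableSpace Ω] {μ : Measure Ω} {g : Ω → ℝ}
    (hg : AEStronglyMeasurable g μ) {C : ℝ≥0} (h : eLpNorm g 2 μ ≤ C) :
    ∫ ω, g ω ^ 2 ∂μ ≤ (C : ℝ) ^ 2 := by
  rw [integral_eq_lintegral_of_nonneg_ae (.of_forall fun ω => sq_nonneg _) (hg.pow 2)]
  have : ∀ ω, ENNReal.ofReal (g ω ^ 2) = ‖g ω‖ₑ ^ 2 := fun ω => by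
    rw [← sq_abs, ENNReal.ofReal_pow (abs_nonneg _), Real.enorm_eq_ofReal_abs]
  simp_rw [this, ← eLpNorm_two_sq]
  refine ENNReal.toReal_le_of_le_ofReal (by positivity) ?_
  rw [ENNReal.ofReal_pow (by positivity), ENNReal.ofReal_coe_nnreal]
  exact pow_le_pow_left' h 2

lemma sum_shift_le {g : ℤ → ℝ≥0∞} (hg : ∀ t ≤ 0, g t = 0) (k : ℕ) : ∀ n : ℕ,
    ∑ t ∈ Finset.range n, g ((t : ℤ) + 1 - k) ≤ ∑ t ∈ Finset.range n, g ((t : ℤ) + 1) := by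
  induction k with
  | zero => intro n; simp
  | succ k ih =>
    intro n
    cases n with
    | zero => simp
    | succ n =>
      rw [Finset.sum_range_succ', Finset.sum_range_succ, hg _ (by push_cast; omega), add_zero]
      refine le_trans (le_of_eq ?_) ((ih n).trans le_self_add)
      refine Finset.sum_congr rfl fun t _ => ?_
      congr 1
      push_cast
      ring

lemma ennreal_tsum_eq_tail {g : ℕ → ℝ≥0∞} {t : ℕ} (h : ∀ k < t, g k = 0) :
    ∑' k, g k = ∑' j, g (t + j) := by
  have h1 := Summable.sum_add_tsum_nat_add' (f := g) (k := t) ENNReal.summable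
  rw [← h1, Finset.sum_eq_zero fun k hk => h k (Finset.mem_range.1 hk), zero_add]
  exact tsum_congr fun j => by rw [add_comm]

lemma sum_inv_sqrt_le (n : ℕ) :
    ∑ t ∈ Finset.range n, (√((t : ℝ) + 1))⁻¹ ≤ 2 * √(n : ℝ) := by
  induction n with
  | zero => simp
  | succ n ih =>
    rw [Finset.sum_range_succ]
    push_cast
    have h1 : 0 < √((n : ℝ) + 1) := Real.sqrt_pos.2 (by positivity)
    have h2 := Real.sq_sqrt (show (0 : ℝ) ≤ (n : ℝ) + 1 by positivity)
    have h3 := Real.sq_sqrt (show (0 : ℝ) ≤ (n : ℝ) by positivity)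
    have h4 := Real.sqrt_nonneg (n : ℝ)
    have h5 : (√((n : ℝ) + 1))⁻¹ ≤ 2 * √((n : ℝ) + 1) - 2 * √(n : ℝ) := by
      rw [inv_le_iff_one_le_mul₀ h1]
      nlinarith [sq_nonneg (√((n : ℝ) + 1) - √(n : ℝ))]
    linarith

lemma IsWeight.tsum_tail_ne_top {b : ℕ → ℝ≥0} (hb : IsWeight b) :
    ∑' t : ℕ, ENNReal.ofReal (√((t : ℝ) + 1))⁻¹ * ∑' j : ℕ, (b (t + j) : ℝ≥0∞) ≠ ∞ := by
  have h1 : ∀ t : ℕ, ∑' j : ℕ, (b (t + j) : ℝ≥0∞) = ∑' m : ℕ, if t ≤ m then (b m : ℝ≥0∞) else 0 := by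
    intro t
    rw [ennreal_tsum_eq_tail (t := t) fun k hk => if_neg (by omega)]
    exact tsum_congr fun j => (if_pos (by omega)).symm
  simp_rw [h1, ← ENNReal.tsum_mul_left]
  rw [ENNReal.tsum_comm]
  have h2 : ∀ m : ℕ, ∑' t : ℕ, ENNReal.ofReal (√((t : ℝ) + 1))⁻¹ *
      (if t ≤ m then (b m : ℝ≥0∞) else 0) ≤ ENNReal.ofReal (2 * (b m * √((m : ℝ) + 1))) := by
    intro m
    rw [tsum_eq_sum (s := Finset.range (m + 1)) (fun t ht => by
      rw [if_neg (by simpa [Nat.lt_succ_iff] using ht), mul_zero])]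
    have h3 : ∀ t ∈ Finset.range (m + 1), ENNReal.ofReal (√((t : ℝ) + 1))⁻¹ *
        (if t ≤ m then (b m : ℝ≥0∞) else 0) = ENNReal.ofReal ((√((t : ℝ) + 1))⁻¹ * b m) :=
      fun t ht => by
        rw [if_pos (by have := Finset.mem_range.1 ht; omega), ENNReal.ofReal_mul (by positivity),
          ENNReal.ofReal_coe_nnreal]
    rw [Finset.sum_congr rfl h3, ← ENNReal.ofReal_sum_of_nonneg fun t _ => by positivity,
      ← Finset.sum_mul]
    refine ENNReal.ofReal_le_ofReal ?_
    have := sum_inv_sqrt_le (m + 1)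
    push_cast at this
    nlinarith [(b m).coe_nonneg]
  refine ne_top_of_le_ne_top ?_ (ENNReal.tsum_le_tsum h2)
  exact (hb.summable_sqrt.mul_left 2).tsum_ofReal_ne_top

section Chain

variable {Ω : Type*} [mΩ : MeasurableSpace Ω] {μ : Measure Ω} [IsProbabilityMeasure μ]
  {Y : ℤ → Ω → ℕ} {lam : NHist → ℝ≥0} {hlam : Measurable lam} {α b : ℕ → ℝ≥0}

/-- Terms whose expectations are dominated by tails of `b` have negligible sums, even after
division by `√n` only. -/
lemma IsWeight.ae_tendsto_inv_sqrt_mul_sum (hb : IsWeight b) {x : ℕ → Ω → ℝ≥0∞}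
    (hx : ∀ t, AEMeasurable (x t) μ) {K : ℝ≥0}
    (hK : ∀ t, ∫⁻ ω, x t ω ∂μ ≤ K * ∑' j : ℕ, (b (t + j) : ℝ≥0∞)) :
    ∀ᵐ ω ∂μ, (∀ t, x t ω ≠ ∞) ∧
      Tendsto (fun n : ℕ => (√(n : ℝ))⁻¹ * ∑ t ∈ Finset.range n, (x t ω).toReal) atTop (𝓝 0) := by
  have h1 : ∫⁻ ω, ∑' t : ℕ, ENNReal.ofReal (√((t : ℝ) + 1))⁻¹ * x t ω ∂μ ≠ ∞ := by
    rw [lintegral_tsum fun t => (hx t).const_mul _]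
    refine ne_top_of_le_ne_top (ENNReal.mul_ne_top (ENNReal.coe_ne_top (r := K))
      hb.tsum_tail_ne_top) ?_
    rw [← ENNReal.tsum_mul_left]
    refine ENNReal.tsum_le_tsum fun t => ?_
    rw [lintegral_const_mul'' _ (hx t), mul_left_comm]
    gcongr
    exact hK t
  have hm : AEMeasurable (fun ω => ∑' t : ℕ, ENNReal.ofReal (√((t : ℝ) + 1))⁻¹ * x t ω) μ :=
    AEMeasurable.tsum fun t => (hx t).const_mul _
  filter_upwards [ae_lt_top' hm h1] with ω hω
  have hs := ENNReal.summable_toReal hω.ne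
  have e : ∀ t : ℕ, (ENNReal.ofReal (√((t : ℝ) + 1))⁻¹ * x t ω).toReal =
      (x t ω).toReal / √((t : ℝ) + 1) := fun t => by
    rw [ENNReal.toReal_mul, ENNReal.toReal_ofReal (by positivity), div_eq_mul_inv, mul_comm]
  simp_rw [e] at hs
  refine ⟨fun t ht => ?_, tendsto_inv_sqrt_mul_sum (fun t => ENNReal.toReal_nonneg) hs⟩
  have := ENNReal.le_tsum (f := fun t : ℕ => ENNReal.ofReal (√((t : ℝ) + 1))⁻¹ * x t ω) t
  simp only [ht] at this
  rw [ENNReal.mul_top (by positivity)] at this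
  exact (this.trans_lt hω).ne rfl

/-- The filtration generated by the process from time `0` on (with all of the past). -/
def natFiltration (hY : ∀ t, Measurable (Y t)) : Filtration ℕ mΩ where
  seq n := history Y n
  mono' _ _ h := history_mono Y (by exact_mod_cast h)
  le' n := history_le hY n

/-- The average of a function of the history and the average of its one-step predictions are
asymptotically equal. -/
lemma ae_tendsto_average_sub_trans (hY : ∀ t, Measurable (Y t))
    (hlaw : ∀ t : ℕ, CondLaw μ Y lam hlam t) {Φ : NHist → ℝ} (hΦ : Measurable Φ) {C : ℝ≥0}
    (hC : ∀ t : ℕ, eLpNorm (fun ω => Φ (hist Y ((t : ℤ) + 1) ω)) 2 μ ≤ C) :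
    ∀ᵐ ω ∂μ, Tendsto (fun n : ℕ => (n : ℝ)⁻¹ * ∑ t ∈ Finset.range n,
      (Φ (hist Y ((t : ℤ) + 1) ω) - trans lam Φ (hist Y t ω))) atTop (𝓝 0) := by
  have hm : ∀ t : ℤ, Measurable[history Y t] (hist Y t) := fun t => by
    rw [history_eq_comap]; exact comap_measurable _
  have hL2 : ∀ t : ℕ, MemLp (fun ω => Φ (hist Y ((t : ℤ) + 1) ω)) 2 μ := fun t =>
    ⟨(hΦ.comp (measurable_hist hY _)).aestronglyMeasurable, (hC t).trans_lt ENNReal.coe_lt_top⟩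
  have hint := fun t => (hL2 t).integrable one_le_two
  have hce := fun t : ℕ => (hlaw t).condExp hY hΦ (hint t)
  have hT2 : ∀ t : ℕ, MemLp (fun ω => trans lam Φ (hist Y t ω)) 2 μ := fun t =>
    ((hL2 t).condExp (m := history Y t) one_le_two).ae_eq (hce t)
  have hD2 := fun t : ℕ => (hL2 t).sub (hT2 t)
  refine ae_tendsto_average_martingale_diff (ℱ := natFiltration hY) (C := ((C + C : ℝ≥0) : ℝ) ^ 2)
    (fun t => ?_) hD2 (fun t => ?_) fun t => ?_
  · refine StronglyMeasurable.sub ?_ ?_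
    · have := (hΦ.comp (hm ((t : ℤ) + 1))).stronglyMeasurable
      exact_mod_cast this
    · have := ((measurable_trans hlam hΦ).comp (hm t)).stronglyMeasurable
      exact this.mono (history_mono Y (by push_cast; omega))
  · have hle : history Y t ≤ mΩ := history_le hY t
    have hT : μ[fun ω => trans lam Φ (hist Y t ω) | history Y t] =
        fun ω => trans lam Φ (hist Y t ω) :=
      condExp_of_stronglyMeasurable hle ((measurable_trans hlam hΦ).comp (hm t)).stronglyMeasurable
        ((hT2 t).integrable one_le_two)
    have h1 := condExp_sub (hint t) ((hT2 t).integrable one_le_two) (history Y t)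
    refine h1.trans ?_
    filter_upwards [hce t] with ω hω
    simp only [Pi.sub_apply, Pi.zero_apply]
    rw [hT, hω, sub_self]
  · refine integral_sq_le_of_eLpNorm_le (hD2 t).1 ?_
    refine (eLpNorm_sub_le (hL2 t).1 (hT2 t).1 one_le_two).trans ?_
    push_cast
    refine add_le_add (hC t) ?_
    rw [← eLpNorm_congr_ae (hce t)]
    exact (eLpNorm_condExp_le_eLpNorm _ one_le_two).trans (hC t)

lemma ofReal_trans_natCast_pow (r : ℕ) {K : ℝ≥0}
    (hK : ∀ y : NHist, ∫⁻ k, (k : ℝ≥0∞) ^ (r + 1) ∂(poissonMeasure (lam y)) ≤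
      K + ∑' k, (α k : ℝ≥0∞) * (y k : ℝ≥0∞) ^ (r + 1)) (y : NHist) :
    ENNReal.ofReal (trans lam (fun y => (y 0 : ℝ) ^ (r + 1)) y) ≤
      K + ∑' k, (α k : ℝ≥0∞) * (y k : ℝ≥0∞) ^ (r + 1) := by
  refine le_trans ?_ (hK y)
  simp only [trans, cons_zero]
  rw [integral_eq_lintegral_of_nonneg_ae (.of_forall fun k => by positivity) .of_discrete]
  refine ENNReal.ofReal_toReal_le.trans (le_of_eq (lintegral_congr fun k => ?_))
  rw [ENNReal.ofReal_pow (by positivity), ENNReal.ofReal_natCast]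

/-- Almost surely, the averages of the powers of the observations stay bounded: a pathwise use of
the drift inequality. -/
lemma ae_exists_average_pow_le (hY : ∀ t, Measurable (Y t)) (h : Contractive lam α)
    (hlaw : ∀ t : ℕ, CondLaw μ Y lam hlam t)
    (hmom : ∀ r : ℕ, ∃ C : ℝ≥0, ∀ t : ℤ, ∫⁻ ω, (Y t ω : ℝ≥0∞) ^ r ∂μ ≤ C)
    (hb : IsWeight b) (hα : ∃ C : ℝ≥0, ∀ k, α k ≤ C * b k) (r : ℕ) :
    ∀ᵐ ω ∂μ, ∃ C : ℝ≥0, ∀ n : ℕ,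
      ∑ t ∈ Finset.range n, (Y ((t : ℤ) + 1) ω : ℝ≥0∞) ^ r ≤ C * n := by
  cases r with
  | zero => exact .of_forall fun ω => ⟨1, fun n => by simp⟩
  | succ r =>
  obtain ⟨K, hK⟩ := h.exists_drift r
  obtain ⟨C1, hC1⟩ := hmom (r + 1)
  obtain ⟨C2, hC2⟩ := hmom (2 * (r + 1))
  obtain ⟨Cα, hCα⟩ := hα
  have hΦ : Measurable fun y : NHist => (y 0 : ℝ) ^ (r + 1) :=
    (measurable_from_nat (f := fun n : ℕ => (n : ℝ) ^ (r + 1))).comp (measurable_pi_apply 0)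
  have hslln := ae_tendsto_average_sub_trans (C := C2 + 1) hY hlaw hΦ fun t => by
    have h1 : eLpNorm (fun ω => (hist Y ((t : ℤ) + 1) ω 0 : ℝ) ^ (r + 1)) 2 μ ^ 2 ≤
        ((C2 + 1 : ℝ≥0) : ℝ≥0∞) ^ 2 := by
      rw [eLpNorm_two_sq]
      refine le_trans (le_of_eq (lintegral_congr fun ω => ?_)) ((hC2 ((t : ℤ) + 1)).trans ?_)
      · rw [Real.enorm_eq_ofReal (by positivity), ENNReal.ofReal_pow (by positivity),
          ENNReal.ofReal_natCast, ← pow_mul, mul_comm]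
        simp [hist]
      · norm_cast
        nlinarith [C2.2]
    exact (ENNReal.pow_le_pow_left_iff two_ne_zero).1 h1
  -- the contribution of the values at times `≤ 0`
  let neg : ℤ → Ω → ℝ≥0∞ := fun s ω => if s ≤ 0 then (Y s ω : ℝ≥0∞) ^ (r + 1) else 0
  let pos : ℤ → Ω → ℝ≥0∞ := fun s ω => if s ≤ 0 then 0 else (Y s ω : ℝ≥0∞) ^ (r + 1)
  have hnegm : ∀ s, Measurable (neg s) := fun s => by
    simp only [neg]
    split_ifs
    · exact measurable_natCast_pow hY s (r + 1)
    · exact measurable_const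
  have hneg := hb.ae_tendsto_inv_sqrt_mul_sum (μ := μ)
    (x := fun t ω => ∑' k : ℕ, (α k : ℝ≥0∞) * neg ((t : ℤ) - k) ω) (K := Cα * C1)
    (fun t => AEMeasurable.tsum fun k => ((hnegm _).const_mul _).aemeasurable)
    (fun t => by
      rw [lintegral_tsum fun k => ((hnegm _).const_mul _).aemeasurable,
        ennreal_tsum_eq_tail (t := t), ← ENNReal.tsum_mul_left]
      · refine ENNReal.tsum_le_tsum fun j => ?_
        rw [lintegral_const_mul _ (hnegm _)]
        calc (α (t + j) : ℝ≥0∞) * ∫⁻ ω, neg ((t : ℤ) - (t + j : ℕ)) ω ∂μ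
            ≤ ((Cα * b (t + j) : ℝ≥0) : ℝ≥0∞) * C1 := by
              gcongr
              · exact hCα _
              · refine le_trans (lintegral_mono fun ω => ?_) (hC1 ((t : ℤ) - (t + j : ℕ)))
                simp only [neg]
                split_ifs
                · exact le_rfl
                · exact zero_le
          _ = _ := by push_cast; ring
      · intro k hk
        have h0 : ∀ ω, neg ((t : ℤ) - k) ω = 0 := fun ω => if_neg (by omega)
        simp [h0])
  filter_upwards [hslln, hneg] with ω hD hN
  obtain ⟨hNf, hN⟩ := hN
  have hN' := tendsto_inv_mul_sum_of_sqrt (fun t => ENNReal.toReal_nonneg) hN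
  set D : ℕ → ℝ := fun n => (n : ℝ)⁻¹ * ∑ t ∈ Finset.range n, ((hist Y ((t : ℤ) + 1) ω 0 : ℝ) ^ (r + 1)
    - trans lam (fun y : NHist => (y 0 : ℝ) ^ (r + 1)) (hist Y t ω)) with hDdef
  set x : ℕ → ℝ≥0∞ := fun t => ∑' k : ℕ, (α k : ℝ≥0∞) * neg ((t : ℤ) - k) ω with hx
  obtain ⟨B, hB⟩ := (hD.add hN').bddAbove_range
  set a : ℝ≥0 := ∑' k, α k with ha
  have ha1 : (a : ℝ) < 1 := by exact_mod_cast h.sum_lt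
  set S : ℕ → ℝ := fun n => ∑ t ∈ Finset.range n, (Y ((t : ℤ) + 1) ω : ℝ) ^ (r + 1) with hS
  have hSE : ∀ n, ∑ t ∈ Finset.range n, (Y ((t : ℤ) + 1) ω : ℝ≥0∞) ^ (r + 1) =
      ENNReal.ofReal (S n) := fun n => by
    rw [hS, ENNReal.ofReal_sum_of_nonneg fun t _ => by positivity]
    refine Finset.sum_congr rfl fun t _ => ?_
    rw [ENNReal.ofReal_pow (by positivity), ENNReal.ofReal_natCast]
  have hS0 : ∀ n, 0 ≤ S n := fun n => Finset.sum_nonneg fun t _ => by positivity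
  have htr : ∀ n : ℕ, ∑ t ∈ Finset.range n, trans lam (fun y : NHist => (y 0 : ℝ) ^ (r + 1))
      (hist Y t ω) ≤ n * K + a * S n + ∑ t ∈ Finset.range n, (x t).toReal := by
    intro n
    have hnn : ∀ y, 0 ≤ trans lam (fun y : NHist => (y 0 : ℝ) ^ (r + 1)) y := fun y =>
      integral_nonneg fun k => by positivity
    have h1 : ENNReal.ofReal (∑ t ∈ Finset.range n, trans lam (fun y : NHist => (y 0 : ℝ) ^ (r + 1))
        (hist Y t ω)) ≤ n * K + a * ENNReal.ofReal (S n) + ∑ t ∈ Finset.range n, x t := by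
      rw [ENNReal.ofReal_sum_of_nonneg fun t _ => hnn _]
      calc _ ≤ ∑ t ∈ Finset.range n, ((K : ℝ≥0∞) + ((∑' k : ℕ, (α k : ℝ≥0∞) * pos ((t : ℤ) - k) ω)
            + x t)) := by
            refine Finset.sum_le_sum fun t _ => ?_
            refine (ofReal_trans_natCast_pow r hK _).trans ?_
            rw [hx, ← ENNReal.tsum_add]
            gcongr with k
            rw [← mul_add]
            gcongr
            simp only [pos, neg, hist]
            split_ifs <;> simp
        _ = n * K + (∑' k : ℕ, (α k : ℝ≥0∞) * ∑ t ∈ Finset.range n, pos ((t : ℤ) - k) ω) +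
            ∑ t ∈ Finset.range n, x t := by
            rw [Finset.sum_add_distrib, Finset.sum_add_distrib, ← Summable.tsum_finsetSum fun _ _ =>
              ENNReal.summable]
            simp only [Finset.sum_const, Finset.card_range, nsmul_eq_mul, Finset.mul_sum, add_assoc]
        _ ≤ _ := by
            rw [← hSE, ← h.tsum_coe, ← ENNReal.tsum_mul_right]
            refine add_le_add (add_le_add le_rfl (ENNReal.tsum_le_tsum fun k =>
              mul_le_mul' le_rfl ?_)) le_rfl
            have h2 := sum_shift_le (g := fun s => pos s ω) (fun s hs => if_pos hs) (k + 1) n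
            refine le_trans (le_of_eq ?_) (h2.trans (le_of_eq ?_))
            · refine Finset.sum_congr rfl fun t _ => ?_
              congr 1
              push_cast
              ring
            · exact Finset.sum_congr rfl fun t _ => if_neg (by omega)
    have h2 : n * K + a * ENNReal.ofReal (S n) + ∑ t ∈ Finset.range n, x t =
        ENNReal.ofReal (n * K + a * S n + ∑ t ∈ Finset.range n, (x t).toReal) := by
      have hxn : ∑ t ∈ Finset.range n, x t =
          ENNReal.ofReal (∑ t ∈ Finset.range n, (x t).toReal) := by
        rw [ENNReal.ofReal_sum_of_nonneg fun t _ => ENNReal.toReal_nonneg]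
        exact Finset.sum_congr rfl fun t _ => (ENNReal.ofReal_toReal (hNf t)).symm
      have hsn : 0 ≤ ∑ t ∈ Finset.range n, (x t).toReal :=
        Finset.sum_nonneg fun t _ => ENNReal.toReal_nonneg
      have := hS0 n
      rw [hxn, ENNReal.ofReal_add (by positivity) hsn, ENNReal.ofReal_add (by positivity)
        (by positivity), ENNReal.ofReal_mul (by positivity), ENNReal.ofReal_mul (by positivity)]
      simp
    rw [h2] at h1
    have hsn : 0 ≤ ∑ t ∈ Finset.range n, (x t).toReal :=
      Finset.sum_nonneg fun t _ => ENNReal.toReal_nonneg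
    have := hS0 n
    exact (ENNReal.ofReal_le_ofReal_iff (by positivity)).1 h1
  refine ⟨((K + B) / (1 - a)).toNNReal, fun n => ?_⟩
  rcases Nat.eq_zero_or_pos n with rfl | hn
  · simp
  have hn' : (0 : ℝ) < n := by exact_mod_cast hn
  have h1 : S n = n * D n + ∑ t ∈ Finset.range n, trans lam (fun y : NHist => (y 0 : ℝ) ^ (r + 1))
      (hist Y t ω) := by
    simp only [hDdef, hS]
    rw [mul_inv_cancel_left₀ hn'.ne', ← Finset.sum_add_distrib]
    exact Finset.sum_congr rfl fun t _ => by simp [hist]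
  have h2 := hB ⟨n, rfl⟩
  simp only at h2
  have h3 : n * D n + ∑ t ∈ Finset.range n, (x t).toReal ≤ n * B := by
    have := mul_le_mul_of_nonneg_left h2 hn'.le
    rw [mul_add] at this
    have e := mul_inv_cancel_left₀ hn'.ne' (∑ t ∈ Finset.range n, (x t).toReal)
    rwa [e] at this
  have h4 : S n ≤ (K + B) / (1 - a) * n := by
    rw [div_mul_eq_mul_div, le_div_iff₀ (by linarith)]
    have := htr n
    nlinarith
  rw [hSE]
  refine (ENNReal.ofReal_le_ofReal (h4.trans
    (mul_le_mul_of_nonneg_right (Real.le_coe_toNNReal _) hn'.le))).trans (le_of_eq ?_)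
  rw [ENNReal.ofReal_mul (by positivity), ENNReal.ofReal_coe_nnreal, ENNReal.ofReal_natCast]

end Chain

/-- The set of histories whose first `N` values, capped at `N`, are given by `p`. -/
def cyl (N : ℕ) (p : Fin N → ℕ) : Set NHist := {y | ∀ k : Fin N, min (y k) N = p k}

lemma measurableSet_cyl (N : ℕ) (p : Fin N → ℕ) : MeasurableSet (cyl N p) := by
  have : cyl N p = ⋂ k : Fin N, (fun y : NHist => y k) ⁻¹' {n | min n N = p k} := by
    ext y; simp [cyl]
  rw [this]
  exact MeasurableSet.iInter fun k => measurable_pi_apply (k : ℕ) .of_discrete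

/-- The empirical law of the truncated histories `(Y_t, …, Y_1, 0, …)`, `t = 1, …, n`. -/
def emp {Ω : Type*} (Y : ℤ → Ω → ℕ) (n : ℕ) (ω : Ω) : Measure NHist :=
  (n : ℝ≥0∞)⁻¹ • ∑ t ∈ Finset.range n, Measure.dirac (hist (posPart Y) ((t : ℤ) + 1) ω)

lemma isProbabilityMeasure_emp {Ω : Type*} (Y : ℤ → Ω → ℕ) (n : ℕ) (ω : Ω) :
    IsProbabilityMeasure (emp Y (n + 1) ω) := by
  constructor
  simp only [emp, Measure.smul_apply, Measure.finsetSum_apply, measure_univ, Finset.sum_const,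
    Finset.card_range, nsmul_eq_mul, mul_one, smul_eq_mul]
  exact ENNReal.inv_mul_cancel (by positivity) (ENNReal.natCast_ne_top _)

lemma integral_emp {Ω : Type*} (Y : ℤ → Ω → ℕ) (n : ℕ) (ω : Ω) (g : NHist → ℝ) :
    ∫ y, g y ∂(emp Y n ω) =
      (n : ℝ)⁻¹ * ∑ t ∈ Finset.range n, g (hist (posPart Y) ((t : ℤ) + 1) ω) := by
  rw [emp, integral_smul_measure, integral_finsetSum_measure fun i _ => integrable_dirac (by simp)]
  simp [integral_dirac]

lemma lintegral_emp {Ω : Type*} (Y : ℤ → Ω → ℕ) (n : ℕ) (ω : Ω) (g : NHist → ℝ≥0∞) :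
    ∫⁻ y, g y ∂(emp Y n ω) =
      (n : ℝ≥0∞)⁻¹ * ∑ t ∈ Finset.range n, g (hist (posPart Y) ((t : ℤ) + 1) ω) := by
  rw [emp, lintegral_smul_measure, lintegral_finsetSum_measure]
  simp [lintegral_dirac]

/-- All coordinate moments are bounded, uniformly in the measure and the coordinate. -/
def MomentBdd {ι : Type*} (ν : ι → Measure NHist) : Prop :=
  ∀ r : ℕ, ∃ C : ℝ≥0, ∀ (i : ι) (k : ℕ), ∫⁻ y, (y k : ℝ≥0∞) ^ r ∂(ν i) ≤ C

/-- The law `π` on histories is invariant for the transition operator. -/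
def IsInvariant (lam : NHist → ℝ≥0) (π : Measure NHist) : Prop :=
  ∀ (g : NHist → ℝ) (B : ℝ), Measurable g → (∀ y, |g y| ≤ B) →
    ∫ y, trans lam g y ∂π = ∫ y, g y ∂π

section Chain

variable {Ω : Type*} [mΩ : MeasurableSpace Ω] {μ : Measure Ω} [IsProbabilityMeasure μ]
  {Y : ℤ → Ω → ℕ} {lam : NHist → ℝ≥0} {hlam : Measurable lam} {α b : ℕ → ℝ≥0}

lemma edist_posPart (Y : ℤ → Ω → ℕ) (s : ℤ) (ω : Ω) :
    edist (Y s ω) (posPart Y s ω) = if s ≤ 0 then (Y s ω : ℝ≥0∞) else 0 := by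
  unfold posPart
  by_cases h : s ≤ 0
  · rw [if_neg (by omega), if_pos h, edist_nat_zero]
  · rw [if_pos (by omega), if_neg h, edist_self]

lemma measurable_edist_nat {X Z : Ω → ℕ} (hX : Measurable X) (hZ : Measurable Z) :
    Measurable fun ω => edist (X ω) (Z ω) := hX.edist hZ

lemma measurable_wd_hist (hY : ∀ t, Measurable (Y t)) (w : ℕ → ℝ≥0) (t : ℤ) :
    Measurable fun ω => wd w (hist Y t ω) (hist (posPart Y) t ω) :=
  Measurable.tsum fun _ =>
    (measurable_edist_nat (hY _) (measurable_posPart hY _)).const_mul _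

/-- The distance between the full and the truncated history, weighted by an arbitrary factor of
bounded moments, is dominated by a tail of the weights. -/
lemma lintegral_mul_wd_le (hY : ∀ t, Measurable (Y t)) {b : ℕ → ℝ≥0} (hb : IsWeight b)
    {X : Ω → ℝ≥0∞} (hX : Measurable X) {K : ℝ≥0∞} (hK : ∀ s : ℤ, ∫⁻ ω, X ω * Y s ω ∂μ ≤ K) (t : ℕ) :
    ∫⁻ ω, X ω * wd b (hist Y ((t : ℤ) + 1) ω) (hist (posPart Y) ((t : ℤ) + 1) ω) ∂μ ≤
      K * ∑' j : ℕ, (b (t + j) : ℝ≥0∞) := by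
  have hYm : ∀ s, Measurable fun ω => (Y s ω : ℝ≥0∞) := fun s => by
    simpa using measurable_natCast_pow hY s 1
  have hXY : ∀ s, Measurable fun ω => X ω * Y s ω := fun s => hX.mul (hYm s)
  have e : ∀ ω, X ω * wd b (hist Y ((t : ℤ) + 1) ω) (hist (posPart Y) ((t : ℤ) + 1) ω) =
      ∑' j : ℕ, (b (t + 1 + j) : ℝ≥0∞) * (X ω * Y (-j) ω) := fun ω => by
    rw [wd, ennreal_tsum_eq_tail (t := t + 1), ← ENNReal.tsum_mul_left]
    · refine tsum_congr fun j => ?_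
      have e1 : (t : ℤ) + 1 - (t + 1 + j : ℕ) = -j := by push_cast; ring
      simp only [hist, e1]
      rw [edist_posPart, if_pos (by omega)]
      ring
    · intro k hk
      simp only [hist]
      rw [edist_posPart, if_neg (by omega), mul_zero]
  simp_rw [e]
  rw [lintegral_tsum fun j => ((hXY _).const_mul _).aemeasurable, ← ENNReal.tsum_mul_left]
  refine ENNReal.tsum_le_tsum fun j => ?_
  rw [lintegral_const_mul _ (hXY _), mul_comm]
  gcongr
  · exact hK _
  · exact hb.anti (by omega)

lemma ae_tendsto_sum_wd (hY : ∀ t, Measurable (Y t))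
    (hmom : ∀ r : ℕ, ∃ C : ℝ≥0, ∀ t : ℤ, ∫⁻ ω, (Y t ω : ℝ≥0∞) ^ r ∂μ ≤ C) (hb : IsWeight b) :
    ∀ᵐ ω ∂μ, (∀ t : ℕ, wd b (hist Y ((t : ℤ) + 1) ω) (hist (posPart Y) ((t : ℤ) + 1) ω) ≠ ∞) ∧
      Tendsto (fun n : ℕ => (√(n : ℝ))⁻¹ * ∑ t ∈ Finset.range n,
        (wd b (hist Y ((t : ℤ) + 1) ω) (hist (posPart Y) ((t : ℤ) + 1) ω)).toReal) atTop (𝓝 0) := by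
  obtain ⟨C, hC⟩ := hmom 1
  refine hb.ae_tendsto_inv_sqrt_mul_sum (K := C)
    (fun t => (measurable_wd_hist hY b _).aemeasurable) fun t => ?_
  simpa using lintegral_mul_wd_le (μ := μ) hY hb (X := fun _ => 1) measurable_const
    (K := C) (fun s => by simpa using hC s) t

lemma measurable_iterate_trans (hlam : Measurable lam) {g : NHist → ℝ} (hg : Measurable g)
    (m : ℕ) : Measurable ((trans lam)^[m] g) := by
  induction m with
  | zero => exact hg
  | succ m ih => rw [Function.iterate_succ_apply']; exact measurable_trans hlam ih

lemma abs_iterate_trans_le {g : NHist → ℝ} {B : ℝ} (hg : ∀ y, |g y| ≤ B) (m : ℕ) :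
    ∀ y, |(trans lam)^[m] g y| ≤ B := by
  induction m with
  | zero => exact hg
  | succ m ih => intro y; rw [Function.iterate_succ_apply']; exact abs_trans_le ih y

lemma Contractive.iterate_trans_lip (h : Contractive lam α) {g : NHist → ℝ} {B : ℝ}
    (hg : ∀ y, |g y| ≤ B) {w : ℕ → ℝ≥0} (hw : ∀ y y', edist (g y) (g y') ≤ wd w y y') (m : ℕ) :
    ∀ y y', edist ((trans lam)^[m] g y) ((trans lam)^[m] g y') ≤ wd ((shiftW α)^[m] w) y y' := by
  induction m with
  | zero => exact hw
  | succ m ih =>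
    intro y y'
    rw [Function.iterate_succ_apply', Function.iterate_succ_apply']
    exact h.trans_lip (abs_iterate_trans_le hg m) ih y y'

lemma wd_le_mul {w b : ℕ → ℝ≥0} {C : ℝ≥0} (h : ∀ k, w k ≤ C * b k) (y y' : NHist) :
    wd w y y' ≤ C * wd b y y' := by
  rw [wd, wd, ← ENNReal.tsum_mul_left]
  refine ENNReal.tsum_le_tsum fun k => ?_
  rw [← mul_assoc]
  gcongr
  exact_mod_cast h k

lemma wd_zero_of_moments {π : Measure NHist} {w : ℕ → ℝ≥0} {C : ℝ≥0}
    (hC : ∀ k, ∫⁻ x, (x k : ℝ≥0∞) ∂π ≤ C) (hw : Summable w) :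
    ∫⁻ x, wd w x 0 ∂π ≤ (∑' k, w k : ℝ≥0) * C := by
  have hm : ∀ k, Measurable fun x : NHist => (x k : ℝ≥0∞) := fun k =>
    (measurable_from_nat (f := fun n : ℕ => (n : ℝ≥0∞))).comp (measurable_pi_apply k)
  simp_rw [wd_zero]
  rw [lintegral_tsum fun k => ((hm k).const_mul _).aemeasurable, ENNReal.coe_tsum hw,
    ← ENNReal.tsum_mul_right]
  refine ENNReal.tsum_le_tsum fun k => ?_
  rw [lintegral_const_mul _ (hm k)]
  gcongr
  exact hC k

lemma wd_triangle_zero (w : ℕ → ℝ≥0) (y y' : NHist) : wd w y y' ≤ wd w y 0 + wd w y' 0 := by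
  rw [wd, wd, wd, ← ENNReal.tsum_add]
  refine ENNReal.tsum_le_tsum fun k => ?_
  rw [← mul_add]
  gcongr
  refine (edist_triangle _ ((0 : NHist) k) _).trans (add_le_add le_rfl ?_)
  rw [edist_comm]

lemma integral_iterate_trans {π : Measure NHist} (hlam : Measurable lam) (hπ : IsInvariant lam π)
    {g : NHist → ℝ} {B : ℝ} (hgm : Measurable g) (hg : ∀ y, |g y| ≤ B) (m : ℕ) :
    ∫ y, (trans lam)^[m] g y ∂π = ∫ y, g y ∂π := by
  induction m with
  | zero => rfl
  | succ m ih =>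
    rw [Function.iterate_succ_apply', hπ _ B (measurable_iterate_trans hlam hgm m)
      (abs_iterate_trans_le hg m), ih]

/-- After `m` transitions, the expectation of `g` is close to its invariant expectation. -/
lemma Contractive.edist_iterate_trans_le (h : Contractive lam α) (hlam : Measurable lam)
    {π : Measure NHist}
    [IsProbabilityMeasure π] (hπ : IsInvariant lam π) {C : ℝ≥0}
    (hC : ∀ k, ∫⁻ x, (x k : ℝ≥0∞) ∂π ≤ C) {g : NHist → ℝ} {B : ℝ}
    (hgm : Measurable g) (hg : ∀ y, |g y| ≤ B) {w : ℕ → ℝ≥0}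
    (hw : ∀ y y', edist (g y) (g y') ≤ wd w y y') (hws : Summable w) (m : ℕ) (y : NHist) :
    edist ((trans lam)^[m] g y) (∫ x, g x ∂π) ≤
      wd ((shiftW α)^[m] w) y 0 + (∑' k, (shiftW α)^[m] w k : ℝ≥0) * C := by
  rw [← integral_iterate_trans hlam hπ hgm hg m]
  have hint : Integrable ((trans lam)^[m] g) π :=
    Integrable.of_bound (measurable_iterate_trans hlam hgm m).aestronglyMeasurable B
      (.of_forall (abs_iterate_trans_le hg m))
  have e : (trans lam)^[m] g y = ∫ _x, (trans lam)^[m] g y ∂π := by simp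
  rw [edist_eq_enorm_sub]
  conv_lhs => rw [e]
  rw [← integral_sub (integrable_const _) hint]
  refine (enorm_integral_le_lintegral_enorm _).trans ?_
  calc _ ≤ ∫⁻ x, (wd ((shiftW α)^[m] w) y 0 + wd ((shiftW α)^[m] w) x 0) ∂π := by
        refine lintegral_mono fun x => ?_
        rw [← edist_eq_enorm_sub]
        exact (h.iterate_trans_lip hg hw m y x).trans (wd_triangle_zero _ _ _)
    _ ≤ _ := by
        rw [lintegral_add_left measurable_const]
        simp only [lintegral_const, measure_univ, mul_one]
        gcongr
        exact wd_zero_of_moments hC (summable_iterate_shiftW h.summable hws m)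

lemma sum_wd_posPart_le {w : ℕ → ℝ≥0} (hw : Summable w) (ω : Ω) (n : ℕ) :
    ∑ t ∈ Finset.range n, wd w (hist (posPart Y) ((t : ℤ) + 1) ω) 0 ≤
      (∑' k, w k : ℝ≥0) * ∑ t ∈ Finset.range n, (Y ((t : ℤ) + 1) ω : ℝ≥0∞) := by
  simp_rw [wd_zero]
  rw [← Summable.tsum_finsetSum fun _ _ => ENNReal.summable, ENNReal.coe_tsum hw,
    ← ENNReal.tsum_mul_right]
  refine ENNReal.tsum_le_tsum fun k => ?_
  rw [← Finset.mul_sum]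
  refine mul_le_mul' le_rfl ?_
  have := sum_shift_le (g := fun s => (posPart Y s ω : ℝ≥0∞))
    (fun s hs => by simp [posPart, show ¬ (1 ≤ s) by omega]) k n
  refine this.trans (le_of_eq ?_)
  exact Finset.sum_congr rfl fun t _ => by simp [posPart]

lemma abs_sub_le_of_edist_le {x y : ℝ} {c : ℝ≥0∞} (hc : c ≠ ∞) (h : edist x y ≤ c) :
    |x - y| ≤ c.toReal := by
  rw [edist_dist, Real.dist_eq] at h
  exact (ENNReal.ofReal_le_iff_le_toReal hc).1 h

/-- Law of large numbers for bounded Lipschitz functions of the truncated history: telescoping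
reduces the average of `g` to the average of its `m`-step predictions, which for large `m` are
nearly constant. -/
lemma ae_tendsto_average_lipschitz (hY : ∀ t, Measurable (Y t)) (h : Contractive lam α)
    (hlaw : ∀ t : ℕ, CondLaw μ Y lam hlam t)
    (hmom : ∀ r : ℕ, ∃ C : ℝ≥0, ∀ t : ℤ, ∫⁻ ω, (Y t ω : ℝ≥0∞) ^ r ∂μ ≤ C)
    (hb : IsWeight b) (hα : ∃ C : ℝ≥0, ∀ k, α k ≤ C * b k)
    {π : Measure NHist} [IsProbabilityMeasure π] (hπ : IsInvariant lam π) {C : ℝ≥0}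
    (hC : ∀ k, ∫⁻ x, (x k : ℝ≥0∞) ∂π ≤ C) {g : NHist → ℝ} {B : ℝ}
    (hgm : Measurable g) (hg : ∀ y, |g y| ≤ B) {w : ℕ → ℝ≥0}
    (hw : ∀ y y', edist (g y) (g y') ≤ wd w y y') (hwb : ∃ C : ℝ≥0, ∀ k, w k ≤ C * b k) :
    ∀ᵐ ω ∂μ, Tendsto (fun n : ℕ => (n : ℝ)⁻¹ *
      ∑ t ∈ Finset.range n, g (hist (posPart Y) ((t : ℤ) + 1) ω)) atTop (𝓝 (∫ x, g x ∂π)) := by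
  have hws : Summable w := by
    obtain ⟨C, hC⟩ := hwb
    exact NNReal.summable_of_le hC (hb.summable.mul_left C)
  set T : ℕ → NHist → ℝ := fun m => (trans lam)^[m] g with hT
  have hstep : ∀ᵐ ω ∂μ, ∀ m : ℕ, Tendsto (fun n : ℕ => (n : ℝ)⁻¹ * ∑ t ∈ Finset.range n,
      (T m (hist Y ((t : ℤ) + 1) ω) - T (m + 1) (hist Y t ω))) atTop (𝓝 0) := by
    refine ae_all_iff.2 fun m => ?_
    have := ae_tendsto_average_sub_trans (μ := μ) hY hlaw (measurable_iterate_trans hlam hgm m)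
      (C := B.toNNReal) fun t => ?_
    · simpa only [hT, Function.iterate_succ_apply'] using this
    · refine (eLpNorm_le_of_ae_bound (C := B) (.of_forall fun ω =>
        abs_iterate_trans_le hg m _)).trans ?_
      simp [ENNReal.ofReal]
  filter_upwards [hstep, ae_tendsto_sum_wd hY hmom hb,
    ae_exists_average_pow_le hY h hlaw hmom hb hα 1] with ω h1 h2 h3
  obtain ⟨h2f, h2⟩ := h2
  have h2 := tendsto_inv_mul_sum_of_sqrt (fun t => ENNReal.toReal_nonneg) h2
  obtain ⟨A, hA⟩ := h3
  simp only [pow_one] at hA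
  set δ : ℕ → ℝ := fun t =>
    (wd b (hist Y ((t : ℤ) + 1) ω) (hist (posPart Y) ((t : ℤ) + 1) ω)).toReal with hδ
  have hδ0 : ∀ t, 0 ≤ δ t := fun t => ENNReal.toReal_nonneg
  -- the `m`-step predictions have the same asymptotic average as `g`
  have htel : ∀ m : ℕ, Tendsto (fun n : ℕ => (n : ℝ)⁻¹ * ∑ t ∈ Finset.range n,
      (g (hist Y ((t : ℤ) + 1) ω) - T m (hist Y ((t : ℤ) + 1) ω))) atTop (𝓝 0) := by
    intro m
    induction m with
    | zero => simp [hT]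
    | succ m ih =>
      have h4 : Tendsto (fun n : ℕ => (n : ℝ)⁻¹ *
          (T (m + 1) (hist Y n ω) - T (m + 1) (hist Y 0 ω))) atTop (𝓝 0) := by
        refine squeeze_zero_norm (a := fun n : ℕ => (n : ℝ)⁻¹ * (2 * B)) (fun n => ?_) ?_
        · rw [norm_mul, Real.norm_of_nonneg (show (0 : ℝ) ≤ (n : ℝ)⁻¹ by positivity)]
          gcongr
          refine (norm_sub_le _ _).trans ?_
          have e1 := abs_iterate_trans_le (lam := lam) hg (m + 1) (hist Y n ω)
          have e2 := abs_iterate_trans_le (lam := lam) hg (m + 1) (hist Y 0 ω)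
          simp only [Real.norm_eq_abs, hT]
          linarith
        · simpa using (tendsto_inv_atTop_nhds_zero_nat (𝕜 := ℝ)).mul_const (2 * B)
      have h5 := (ih.add (h1 m)).sub h4
      simp only [add_zero, sub_zero] at h5
      refine h5.congr fun n => ?_
      have h6 : T (m + 1) (hist Y n ω) - T (m + 1) (hist Y 0 ω) = ∑ t ∈ Finset.range n,
          (T (m + 1) (hist Y ((t : ℤ) + 1) ω) - T (m + 1) (hist Y t ω)) := by
        have := Finset.sum_range_sub (fun t : ℕ => T (m + 1) (hist Y t ω)) n
        push_cast at this
        exact this.symm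
      rw [h6, ← mul_add, ← mul_sub, ← Finset.sum_add_distrib, ← Finset.sum_sub_distrib]
      congr 1
      refine Finset.sum_congr rfl fun t _ => by ring
  have hdiff : ∀ m : ℕ, Tendsto (fun n : ℕ => (n : ℝ)⁻¹ * ∑ t ∈ Finset.range n,
      (T m (hist Y ((t : ℤ) + 1) ω) - T m (hist (posPart Y) ((t : ℤ) + 1) ω))) atTop (𝓝 0) := by
    intro m
    obtain ⟨Cm, hCm⟩ := iterate_shiftW_le hb hα hwb m
    have hbd : ∀ t : ℕ, |T m (hist Y ((t : ℤ) + 1) ω) - T m (hist (posPart Y) ((t : ℤ) + 1) ω)| ≤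
        Cm * δ t := fun t => by
      have e1 := (h.iterate_trans_lip hg hw m (hist Y ((t : ℤ) + 1) ω)
        (hist (posPart Y) ((t : ℤ) + 1) ω)).trans (wd_le_mul hCm _ _)
      have := abs_sub_le_of_edist_le (ENNReal.mul_ne_top ENNReal.coe_ne_top (h2f t)) e1
      rwa [ENNReal.toReal_mul, ENNReal.coe_toReal] at this
    have h4 := h2.const_mul (Cm : ℝ)
    rw [mul_zero] at h4
    refine squeeze_zero_norm (fun n => ?_) h4
    rw [norm_mul, Real.norm_of_nonneg (show (0 : ℝ) ≤ (n : ℝ)⁻¹ by positivity), mul_left_comm,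
      Finset.mul_sum]
    gcongr
    exact (norm_sum_le _ _).trans (Finset.sum_le_sum fun t _ => hbd t)
  set S : ℕ → ℝ := fun m => ∑' k, ((shiftW α)^[m] w k : ℝ) with hS
  have hS0 : Tendsto S atTop (𝓝 0) := tendsto_tsum_iterate_shiftW h.summable h.sum_lt hws
  have hclose : ∀ m n : ℕ, 0 < n → |(n : ℝ)⁻¹ * ∑ t ∈ Finset.range n,
      T m (hist (posPart Y) ((t : ℤ) + 1) ω) - ∫ x, g x ∂π| ≤ S m * (A + C) := by
    intro m n hn
    have hn' : (0 : ℝ) < n := by exact_mod_cast hn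
    have hsm := summable_iterate_shiftW h.summable hws m
    have e0 : (n : ℝ)⁻¹ * ∑ t ∈ Finset.range n, T m (hist (posPart Y) ((t : ℤ) + 1) ω) -
        ∫ x, g x ∂π = (n : ℝ)⁻¹ * ∑ t ∈ Finset.range n,
          (T m (hist (posPart Y) ((t : ℤ) + 1) ω) - ∫ x, g x ∂π) := by
      rw [Finset.sum_sub_distrib, mul_sub]
      simp [hn'.ne']
    rw [e0, abs_mul, abs_of_pos (inv_pos.2 hn'), inv_mul_le_iff₀ hn']
    have e1 : ENNReal.ofReal |∑ t ∈ Finset.range n,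
        (T m (hist (posPart Y) ((t : ℤ) + 1) ω) - ∫ x, g x ∂π)| ≤
        ((∑' k, (shiftW α)^[m] w k : ℝ≥0) : ℝ≥0∞) * (A * n) +
          n * ((∑' k, (shiftW α)^[m] w k : ℝ≥0) * C) := by
      calc _ ≤ ENNReal.ofReal (∑ t ∈ Finset.range n,
            |T m (hist (posPart Y) ((t : ℤ) + 1) ω) - ∫ x, g x ∂π|) :=
            ENNReal.ofReal_le_ofReal (Finset.abs_sum_le_sum_abs _ _)
        _ = ∑ t ∈ Finset.range n, edist (T m (hist (posPart Y) ((t : ℤ) + 1) ω))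
              (∫ x, g x ∂π) := by
            rw [ENNReal.ofReal_sum_of_nonneg fun t _ => abs_nonneg _]
            exact Finset.sum_congr rfl fun t _ => by rw [edist_dist, Real.dist_eq]
        _ ≤ ∑ t ∈ Finset.range n, (wd ((shiftW α)^[m] w) (hist (posPart Y) ((t : ℤ) + 1) ω) 0 +
              (∑' k, (shiftW α)^[m] w k : ℝ≥0) * C) :=
            Finset.sum_le_sum fun t _ =>
              h.edist_iterate_trans_le hlam hπ hC hgm hg hw hws m _
        _ ≤ _ := by
            rw [Finset.sum_add_distrib]
            refine add_le_add ((sum_wd_posPart_le hsm ω n).trans ?_) (le_of_eq ?_)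
            · gcongr
              exact hA n
            · simp
    have e2 : ((∑' k, (shiftW α)^[m] w k : ℝ≥0) : ℝ≥0∞) * (A * n) +
          n * ((∑' k, (shiftW α)^[m] w k : ℝ≥0) * C) = ENNReal.ofReal (n * (S m * (A + C))) := by
      have : S m = ((∑' k, (shiftW α)^[m] w k : ℝ≥0) : ℝ) := by rw [hS, NNReal.coe_tsum]
      rw [this, ← ENNReal.ofReal_coe_nnreal (p := A), ← ENNReal.ofReal_coe_nnreal (p := C),
        ← ENNReal.ofReal_coe_nnreal, ← ENNReal.ofReal_natCast, ← ENNReal.ofReal_mul (by positivity),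
        ← ENNReal.ofReal_mul (by positivity), ← ENNReal.ofReal_mul (by positivity),
        ← ENNReal.ofReal_mul (by positivity), ← ENNReal.ofReal_add (by positivity) (by positivity)]
      congr 1
      ring
    rw [e2] at e1
    refine (ENNReal.ofReal_le_ofReal_iff ?_).1 e1
    have : 0 ≤ S m := tsum_nonneg fun k => NNReal.coe_nonneg _
    positivity
  rw [Metric.tendsto_atTop']
  intro ε hε
  have hSA : Tendsto (fun m => S m * (A + C)) atTop (𝓝 0) := by
    simpa using hS0.mul_const ((A : ℝ) + C)
  obtain ⟨m, hm⟩ := (hSA.eventually_lt_const (half_pos hε)).exists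
  have hz : Tendsto (fun n : ℕ => (n : ℝ)⁻¹ * ∑ t ∈ Finset.range n,
      (g (hist (posPart Y) ((t : ℤ) + 1) ω) - T m (hist (posPart Y) ((t : ℤ) + 1) ω)))
      atTop (𝓝 0) := by
    have := ((htel m).sub (hdiff 0)).add (hdiff m)
    simp only [sub_zero, add_zero] at this
    refine this.congr fun n => ?_
    rw [← mul_sub, ← mul_add, ← Finset.sum_sub_distrib, ← Finset.sum_add_distrib]
    congr 1
    refine Finset.sum_congr rfl fun t _ => ?_
    simp only [hT, Function.iterate_zero, id]
    ring
  obtain ⟨n0, hn0⟩ := Metric.tendsto_atTop.1 hz (ε / 2) (half_pos hε)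
  refine ⟨n0, fun n hn => ?_⟩
  have e1 := hn0 n hn.le
  have e2 := hclose m n (by omega)
  rw [Real.dist_eq, sub_zero, Finset.sum_sub_distrib, mul_sub] at e1
  rw [Real.dist_eq]
  rw [abs_lt] at e1 ⊢
  rw [abs_le] at e2
  constructor <;> linarith [e1.1, e1.2, e2.1, e2.2]

/-- The coefficients for which indicators of cylinders are Lipschitz. -/
def cylW (N : ℕ) : ℕ → ℝ≥0 := fun k => if k < N then 1 else 0

lemma edist_indicator_cyl_le (N : ℕ) (p : Fin N → ℕ) (y y' : NHist) :
    edist ((cyl N p).indicator (1 : NHist → ℝ) y) ((cyl N p).indicator 1 y') ≤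
      wd (cylW N) y y' := by
  by_cases heq : ∀ k < N, y k = y' k
  · have : y ∈ cyl N p ↔ y' ∈ cyl N p := by
      simp only [cyl, Set.mem_ofPred_eq]
      exact forall_congr' fun k => by rw [heq k k.2]
    by_cases hy : y ∈ cyl N p
    · simp [hy, this.1 hy]
    · have hy' : y' ∉ cyl N p := fun h => hy (this.2 h)
      simp [hy, hy']
  · push Not at heq
    obtain ⟨k, hk, hne⟩ := heq
    have h1 : edist ((cyl N p).indicator (1 : NHist → ℝ) y) ((cyl N p).indicator 1 y') ≤ 1 := by
      rw [edist_dist, Real.dist_eq, ← ENNReal.ofReal_one]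
      refine ENNReal.ofReal_le_ofReal ?_
      simp only [Set.indicator]
      split_ifs <;> simp
    have h2 : (1 : ℝ≥0∞) ≤ edist (y k) (y' k) := by
      rw [edist_dist, Nat.dist_eq, ← ENNReal.ofReal_one]
      refine ENNReal.ofReal_le_ofReal ?_
      have : (1 : ℤ) ≤ |(y k : ℤ) - y' k| := Int.one_le_abs (by omega)
      exact_mod_cast this
    refine h1.trans (h2.trans ?_)
    refine le_trans (le_of_eq ?_) (ENNReal.le_tsum k)
    simp [cylW, hk]

lemma abs_indicator_cyl_le (N : ℕ) (p : Fin N → ℕ) (y : NHist) :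
    |(cyl N p).indicator (1 : NHist → ℝ) y| ≤ 1 := by
  simp only [Set.indicator]; split_ifs <;> simp

lemma IsWeight.cylW_le (hb : IsWeight b) (N : ℕ) : ∃ C : ℝ≥0, ∀ k, cylW N k ≤ C * b k := by
  refine ⟨(b N)⁻¹, fun k => ?_⟩
  simp only [cylW]
  split_ifs with hk
  · rw [← div_eq_inv_mul, one_le_div (hb.pos N)]
    exact hb.anti hk.le
  · exact zero_le

/-- Almost surely, the empirical laws of the truncated histories have bounded moments and converge
on cylinders to the invariant law. -/
lemma ae_emp_good (hY : ∀ t, Measurable (Y t)) (h : Contractive lam α)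
    (hlaw : ∀ t : ℕ, CondLaw μ Y lam hlam t)
    (hmom : ∀ r : ℕ, ∃ C : ℝ≥0, ∀ t : ℤ, ∫⁻ ω, (Y t ω : ℝ≥0∞) ^ r ∂μ ≤ C)
    (hb : IsWeight b) (hα : ∃ C : ℝ≥0, ∀ k, α k ≤ C * b k)
    {π : Measure NHist} [IsProbabilityMeasure π] (hπ : IsInvariant lam π) {C : ℝ≥0}
    (hC : ∀ k, ∫⁻ x, (x k : ℝ≥0∞) ∂π ≤ C) :
    ∀ᵐ ω ∂μ, MomentBdd (fun n => emp Y (n + 1) ω) ∧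
      ∀ (N : ℕ) (p : Fin N → ℕ), Tendsto (fun n => (emp Y (n + 1) ω).real (cyl N p)) atTop
        (𝓝 (π.real (cyl N p))) := by
  refine Filter.Eventually.and ?_ ?_
  · refine (ae_all_iff.2 (ae_exists_average_pow_le hY h hlaw hmom hb hα)).mono fun ω hω r => ?_
    obtain ⟨A, hA⟩ := hω r
    rcases Nat.eq_zero_or_pos r with rfl | hr
    · refine ⟨1, fun n k => ?_⟩
      have := isProbabilityMeasure_emp Y n ω
      simp
    refine ⟨A, fun n k => ?_⟩
    rw [lintegral_emp, ENNReal.inv_mul_le_iff (by positivity) (ENNReal.natCast_ne_top _)]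
    have h1 := sum_shift_le (g := fun s => (posPart Y s ω : ℝ≥0∞) ^ r)
      (fun s hs => by simp [posPart, show ¬ (1 ≤ s) by omega, hr.ne']) k (n + 1)
    rw [mul_comm]
    refine h1.trans (le_trans (le_of_eq ?_) (hA (n + 1)))
    exact Finset.sum_congr rfl fun t _ => by simp [posPart]
  · refine ae_all_iff.2 fun N => ae_all_iff.2 fun p => ?_
    set g : NHist → ℝ := (cyl N p).indicator 1 with hgdef
    have hgm : Measurable g := measurable_one.indicator (measurableSet_cyl N p)
    refine (ae_tendsto_average_lipschitz hY h hlaw hmom hb hα hπ hC hgm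
      (abs_indicator_cyl_le N p) (edist_indicator_cyl_le N p) (hb.cylW_le N)).mono
      fun ω hω => ?_
    have e1 : ∫ x, g x ∂π = π.real (cyl N p) := by
      rw [hgdef, integral_indicator_one (measurableSet_cyl N p)]
    rw [e1] at hω
    refine ((tendsto_add_atTop_iff_nat 1).2 hω).congr fun n => ?_
    rw [← integral_emp, hgdef, integral_indicator_one (measurableSet_cyl N p)]

end Chain

/-! ### Functions of polynomial growth and their uniform law of large numbers -/

/-- The history `y` has a finite weighted sum. -/
def Adm (b : ℕ → ℝ≥0) (y : NHist) : Prop := Summable fun k => (b k : ℝ) * y k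

/-- The weighted sum of a history. -/
def wsum (b : ℕ → ℝ≥0) (y : NHist) : ℝ := ∑' k, (b k : ℝ) * y k

/-- The real-valued weighted distance of two histories. -/
def wdist (b : ℕ → ℝ≥0) (y y' : NHist) : ℝ := ∑' k, (b k : ℝ) * |(y k : ℝ) - y' k|

/-- A family of functions of the history which is, uniformly in the index, of polynomial growth in
the weighted sum of the history, and locally Lipschitz for the weighted distance with a constant of
polynomial growth. The class is stable under the algebraic operations needed to form the
likelihood, its score and its Hessian. -/
def Tame (b : ℕ → ℝ≥0) {I : Type*} (h : I → NHist → ℝ) : Prop :=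
  ∃ (C : ℝ) (p : ℕ), 0 ≤ C ∧ (∀ i y, Adm b y → |h i y| ≤ C * (1 + wsum b y) ^ p) ∧
    ∀ i y y', Adm b y → Adm b y' →
      |h i y - h i y'| ≤ C * ((1 + wsum b y) * (1 + wsum b y')) ^ p * wdist b y y'

variable {b : ℕ → ℝ≥0} {y y' : NHist}

lemma wsum_nonneg (b : ℕ → ℝ≥0) (y : NHist) : 0 ≤ wsum b y := tsum_nonneg fun k => by positivity

lemma wdist_nonneg (b : ℕ → ℝ≥0) (y y' : NHist) : 0 ≤ wdist b y y' :=
  tsum_nonneg fun k => by positivity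

lemma Adm.summable_dist (h : Adm b y) (h' : Adm b y') :
    Summable fun k => (b k : ℝ) * |(y k : ℝ) - y' k| := by
  refine Summable.of_nonneg_of_le (fun k => by positivity) (fun k => ?_) (h.add h')
  rw [← mul_add]
  gcongr
  rw [abs_le]
  constructor <;> linarith [(Nat.cast_nonneg (y k) : (0 : ℝ) ≤ _), (Nat.cast_nonneg (y' k) : (0 : ℝ) ≤ _)]

lemma adm_zero : Adm b 0 := by simp [Adm]

lemma wsum_zero : wsum b 0 = 0 := by simp [wsum]

lemma wdist_zero (y : NHist) : wdist b y 0 = wsum b y :=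
  tsum_congr fun k => by simp

lemma adm_iff : Adm b y ↔ wd b y 0 ≠ ∞ := by
  rw [wd_zero]
  have e : ∀ k, (b k : ℝ≥0∞) * (y k : ℝ≥0∞) = ((b k * y k : ℝ≥0) : ℝ≥0∞) := fun k => by
    push_cast; rfl
  simp_rw [e]
  rw [ENNReal.tsum_coe_ne_top_iff_summable, ← NNReal.summable_coe]
  simp [Adm]

lemma Adm.ofReal_wdist (h : Adm b y) (h' : Adm b y') :
    ENNReal.ofReal (wdist b y y') = wd b y y' := by
  rw [wdist, ENNReal.ofReal_tsum_of_nonneg (fun k => by positivity) (h.summable_dist h'), wd]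
  refine tsum_congr fun k => ?_
  rw [ENNReal.ofReal_mul (by positivity), edist_dist, Nat.dist_eq, ENNReal.ofReal_coe_nnreal]

lemma Adm.ofReal_wsum (h : Adm b y) : ENNReal.ofReal (wsum b y) = wd b y 0 := by
  rw [← wdist_zero, h.ofReal_wdist adm_zero]

lemma measurable_wd_zero (b : ℕ → ℝ≥0) : Measurable fun y : NHist => wd b y 0 := by
  simp_rw [wd_zero]
  exact Measurable.tsum fun k => ((measurable_from_nat (f := fun n : ℕ => (n : ℝ≥0∞))).comp
    (measurable_pi_apply k)).const_mul _

lemma measurableSet_adm (b : ℕ → ℝ≥0) : MeasurableSet {y | Adm b y} := by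
  simp_rw [adm_iff]
  exact (measurable_wd_zero b (measurableSet_singleton ∞)).compl

namespace Tame

variable {I J : Type*} {h g : I → NHist → ℝ}

lemma reindex (hh : Tame b h) (e : J → I) : Tame b fun j => h (e j) := by
  obtain ⟨C, p, hC, h1, h2⟩ := hh
  exact ⟨C, p, hC, fun j => h1 (e j), fun j => h2 (e j)⟩

lemma of_modulus {C : ℝ} (h0 : ∀ i, |h i 0| ≤ C)
    (hC : ∀ i y y', Adm b y → Adm b y' → |h i y - h i y'| ≤ C * wdist b y y') (hC0 : 0 ≤ C) :
    Tame b h := by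
  refine ⟨C, 1, hC0, fun i y hy => ?_, fun i y y' hy hy' => ?_⟩
  · have h1 := hC i y 0 hy adm_zero
    rw [wdist_zero] at h1
    have h2 := h0 i
    have h3 : |h i y| ≤ |h i 0| + |h i y - h i 0| := by
      have := abs_add_le (h i 0) (h i y - h i 0)
      simpa using this
    rw [pow_one]
    linarith
  · refine (hC i y y' hy hy').trans ?_
    have h1 := wsum_nonneg b y
    have h2 := wsum_nonneg b y'
    refine mul_le_mul_of_nonneg_right ?_ (wdist_nonneg _ _ _)
    rw [pow_one]
    refine le_mul_of_one_le_right hC0 ?_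
    nlinarith

lemma of_edist_le {C : ℝ≥0} (h0 : ∀ i, |h i 0| ≤ C)
    (hC : ∀ i y y', edist (h i y) (h i y') ≤ C * wd b y y') : Tame b h := by
  refine of_modulus h0 (fun i y y' hy hy' => ?_) C.coe_nonneg
  have h1 := hC i y y'
  rw [← hy.ofReal_wdist hy', ← ENNReal.ofReal_coe_nnreal, ← ENNReal.ofReal_mul C.coe_nonneg,
    edist_dist, Real.dist_eq] at h1
  exact (ENNReal.ofReal_le_ofReal_iff (mul_nonneg C.coe_nonneg (wdist_nonneg _ _ _))).1 h1

lemma const {c : I → ℝ} {C : ℝ} (hc : ∀ i, |c i| ≤ C) : Tame b fun i _ => c i := by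
  refine of_modulus (C := |C|) (fun i => (hc i).trans (le_abs_self _)) (fun i y y' _ _ => ?_)
    (abs_nonneg _)
  simp only [sub_self, abs_zero]
  exact mul_nonneg (abs_nonneg _) (wdist_nonneg _ _ _)

/-- The growth exponents can be taken equal for two families. -/
lemma common (hh : Tame b h) (hg : Tame b g) : ∃ (C : ℝ) (p : ℕ), 0 ≤ C ∧
    (∀ i y, Adm b y → |h i y| ≤ C * (1 + wsum b y) ^ p ∧ |g i y| ≤ C * (1 + wsum b y) ^ p) ∧
    ∀ i y y', Adm b y → Adm b y' →
      |h i y - h i y'| ≤ C * ((1 + wsum b y) * (1 + wsum b y')) ^ p * wdist b y y' ∧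
      |g i y - g i y'| ≤ C * ((1 + wsum b y) * (1 + wsum b y')) ^ p * wdist b y y' := by
  obtain ⟨C, p, hC, h1, h2⟩ := hh
  obtain ⟨C', p', hC', g1, g2⟩ := hg
  have key : ∀ {x : ℝ}, 1 ≤ x → C * x ^ p ≤ max C C' * x ^ max p p' ∧
      C' * x ^ p' ≤ max C C' * x ^ max p p' := fun {x} hx => by
    constructor
    · exact mul_le_mul (le_max_left _ _) (pow_le_pow_right₀ hx (le_max_left _ _)) (by positivity)
        (hC.trans (le_max_left _ _))
    · exact mul_le_mul (le_max_right _ _) (pow_le_pow_right₀ hx (le_max_right _ _)) (by positivity)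
        (hC.trans (le_max_left _ _))
  refine ⟨max C C', max p p', hC.trans (le_max_left _ _), fun i y hy => ?_,
    fun i y y' hy hy' => ?_⟩
  · have := key (x := 1 + wsum b y) (by linarith [wsum_nonneg b y])
    exact ⟨(h1 i y hy).trans this.1, (g1 i y hy).trans this.2⟩
  · have e1 := wsum_nonneg b y
    have e2 := wsum_nonneg b y'
    have := key (x := (1 + wsum b y) * (1 + wsum b y')) (by nlinarith)
    exact ⟨(h2 i y y' hy hy').trans (mul_le_mul_of_nonneg_right this.1 (wdist_nonneg _ _ _)),
      (g2 i y y' hy hy').trans (mul_le_mul_of_nonneg_right this.2 (wdist_nonneg _ _ _))⟩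

lemma add (hh : Tame b h) (hg : Tame b g) : Tame b fun i y => h i y + g i y := by
  obtain ⟨C, p, hC, h1, h2⟩ := hh.common hg
  refine ⟨2 * C, p, by positivity, fun i y hy => ?_, fun i y y' hy hy' => ?_⟩
  · have := h1 i y hy
    refine (abs_add_le _ _).trans ?_
    linarith [this.1, this.2]
  · have := h2 i y y' hy hy'
    have e : h i y + g i y - (h i y' + g i y') = (h i y - h i y') + (g i y - g i y') := by ring
    rw [e]
    refine (abs_add_le _ _).trans ?_
    linarith [this.1, this.2]

lemma mul (hh : Tame b h) (hg : Tame b g) : Tame b fun i y => h i y * g i y := by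
  obtain ⟨C, p, hC, h1, h2⟩ := hh.common hg
  refine ⟨2 * C ^ 2, 2 * p, by positivity, fun i y hy => ?_, fun i y y' hy hy' => ?_⟩
  · have := h1 i y hy
    have hw := wsum_nonneg b y
    rw [abs_mul]
    calc |h i y| * |g i y| ≤ (C * (1 + wsum b y) ^ p) * (C * (1 + wsum b y) ^ p) :=
          mul_le_mul this.1 this.2 (abs_nonneg _) (by positivity)
      _ = C ^ 2 * (1 + wsum b y) ^ (2 * p) := by ring
      _ ≤ _ := by gcongr; nlinarith [sq_nonneg C]
  · have e2 := h2 i y y' hy hy'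
    have ey := h1 i y hy
    have ey' := h1 i y' hy'
    have hw := wsum_nonneg b y
    have hw' := wsum_nonneg b y'
    have hd := wdist_nonneg b y y'
    have e : h i y * g i y - h i y' * g i y' =
        h i y * (g i y - g i y') + g i y' * (h i y - h i y') := by ring
    rw [e]
    refine (abs_add_le _ _).trans ?_
    rw [abs_mul, abs_mul]
    set A := 1 + wsum b y with hA
    set A' := 1 + wsum b y' with hA'
    have hA1 : 1 ≤ A := by linarith
    have hA1' : 1 ≤ A' := by linarith
    have hAA : A ^ p ≤ (A * A') ^ p := pow_le_pow_left₀ (by positivity) (by nlinarith) p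
    have hAA' : A' ^ p ≤ (A * A') ^ p := pow_le_pow_left₀ (by positivity) (by nlinarith) p
    have f1 : |h i y| * |g i y - g i y'| ≤
        (C * (A * A') ^ p) * (C * (A * A') ^ p * wdist b y y') :=
      mul_le_mul (ey.1.trans (mul_le_mul_of_nonneg_left hAA hC)) e2.2 (abs_nonneg _)
        (by positivity)
    have f2 : |g i y'| * |h i y - h i y'| ≤
        (C * (A * A') ^ p) * (C * (A * A') ^ p * wdist b y y') :=
      mul_le_mul (ey'.2.trans (mul_le_mul_of_nonneg_left hAA' hC)) e2.1 (abs_nonneg _)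
        (by positivity)
    calc _ ≤ _ := add_le_add f1 f2
      _ = _ := by ring

lemma neg (hh : Tame b h) : Tame b fun i y => - h i y := by
  obtain ⟨C, p, hC, h1, h2⟩ := hh
  refine ⟨C, p, hC, fun i y hy => by rw [abs_neg]; exact h1 i y hy, fun i y y' hy hy' => ?_⟩
  rw [neg_sub_neg, abs_sub_comm]
  exact h2 i y y' hy hy'

lemma sub (hh : Tame b h) (hg : Tame b g) : Tame b fun i y => h i y - g i y := by
  simpa only [sub_eq_add_neg] using hh.add hg.neg

lemma abs (hh : Tame b h) : Tame b fun i y => |h i y| := by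
  obtain ⟨C, p, hC, h1, h2⟩ := hh
  exact ⟨C, p, hC, fun i y hy => by rw [abs_abs]; exact h1 i y hy, fun i y y' hy hy' =>
    (abs_abs_sub_abs_le _ _).trans (h2 i y y' hy hy')⟩

lemma const_mul (c : ℝ) (hh : Tame b h) : Tame b fun i y => c * h i y :=
  (const (c := fun _ => c) (C := |c|) fun _ => le_rfl).mul hh

lemma pow (hh : Tame b h) (n : ℕ) : Tame b fun i y => h i y ^ n := by
  induction n with
  | zero => simpa using const (b := b) (c := fun _ : I => (1 : ℝ)) (C := 1) fun _ => by simp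
  | succ n ih => simpa only [pow_succ] using ih.mul hh

lemma sum {κ : Type*} (s : Finset κ) {H : κ → I → NHist → ℝ} (hH : ∀ k, Tame b (H k)) :
    Tame b fun i y => ∑ k ∈ s, H k i y := by
  classical
  induction s using Finset.induction_on with
  | empty => simpa using const (b := b) (c := fun _ : I => (0 : ℝ)) (C := 0) fun _ => by simp
  | insert k s hk ih => simpa only [Finset.sum_insert hk] using (hH k).add ih

/-- Composition with a function which is Lipschitz on the range of the family. -/
lemma comp_lipschitz (hh : Tame b h) {φ : ℝ → ℝ} {L c : ℝ} (hL : 0 ≤ L)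
    (hc : ∀ i y, Adm b y → c ≤ h i y)
    (hφ : ∀ u v, c ≤ u → c ≤ v → |φ u - φ v| ≤ L * |u - v|) :
    Tame b fun i y => φ (h i y) := by
  obtain ⟨C, p, hC, h1, h2⟩ := hh
  refine ⟨|φ c| + L * |c| + L * C, p, by positivity, fun i y hy => ?_, fun i y y' hy hy' => ?_⟩
  · have e1 := hφ (h i y) c (hc i y hy) le_rfl
    have e2 := abs_add_le (φ c) (φ (h i y) - φ c)
    rw [add_sub_cancel] at e2
    have e3 := abs_sub (h i y) c
    have e4 := h1 i y hy
    have hw := wsum_nonneg b y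
    have e5 : 1 ≤ (1 + wsum b y) ^ p := one_le_pow₀ (by linarith)
    calc |φ (h i y)| ≤ |φ c| + L * (|h i y| + |c|) := by
          refine e2.trans (add_le_add le_rfl (e1.trans (mul_le_mul_of_nonneg_left e3 hL)))
      _ ≤ (|φ c| + L * |c|) * 1 + L * (C * (1 + wsum b y) ^ p) := by
          nlinarith [mul_le_mul_of_nonneg_left e4 hL]
      _ ≤ (|φ c| + L * |c|) * (1 + wsum b y) ^ p + L * (C * (1 + wsum b y) ^ p) := by
          gcongr
      _ = _ := by ring
  · refine (hφ _ _ (hc i y hy) (hc i y' hy')).trans ?_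
    have hw := wsum_nonneg b y
    have hw' := wsum_nonneg b y'
    have hd := wdist_nonneg b y y'
    calc L * |h i y - h i y'|
        ≤ L * (C * ((1 + wsum b y) * (1 + wsum b y')) ^ p * wdist b y y') :=
          mul_le_mul_of_nonneg_left (h2 i y y' hy hy') hL
      _ = (L * C) * (((1 + wsum b y) * (1 + wsum b y')) ^ p * wdist b y y') := by ring
      _ ≤ (|φ c| + L * |c| + L * C) * (((1 + wsum b y) * (1 + wsum b y')) ^ p * wdist b y y') := by
          gcongr
          have : 0 ≤ |φ c| + L * |c| := by positivity
          linarith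
      _ = _ := by ring

lemma inv (hh : Tame b h) {c : ℝ} (hc : 0 < c) (hch : ∀ i y, Adm b y → c ≤ h i y) :
    Tame b fun i y => (h i y)⁻¹ := by
  refine hh.comp_lipschitz (φ := fun x => x⁻¹) (L := c⁻¹ * c⁻¹) (by positivity) hch
    fun u v hu hv => ?_
  have hu0 : 0 < u := hc.trans_le hu
  have hv0 : 0 < v := hc.trans_le hv
  have e : u⁻¹ - v⁻¹ = u⁻¹ * v⁻¹ * (v - u) := by field_simp
  rw [e, abs_mul, abs_sub_comm, abs_of_pos (by positivity)]
  gcongr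

lemma log (hh : Tame b h) {c : ℝ} (hc : 0 < c) (hch : ∀ i y, Adm b y → c ≤ h i y) :
    Tame b fun i y => Real.log (h i y) := by
  refine hh.comp_lipschitz (φ := Real.log) (L := c⁻¹) (by positivity) hch fun u v hu hv => ?_
  have key : ∀ u v : ℝ, c ≤ u → c ≤ v → Real.log u - Real.log v ≤ c⁻¹ * |u - v| := by
    intro u v hu hv
    have hu0 : 0 < u := hc.trans_le hu
    have hv0 : 0 < v := hc.trans_le hv
    rw [← Real.log_div hu0.ne' hv0.ne']
    refine (Real.log_le_sub_one_of_pos (by positivity)).trans ?_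
    have e : u / v - 1 = v⁻¹ * (u - v) := by field_simp
    rw [e]
    calc v⁻¹ * (u - v) ≤ v⁻¹ * |u - v| := by gcongr; exact le_abs_self _
      _ ≤ c⁻¹ * |u - v| := by gcongr
  rw [abs_le]
  constructor
  · have := key v u hv hu
    rw [abs_sub_comm] at this
    linarith
  · exact key u v hu hv

end Tame

section Shift

variable (hb : IsWeight b)
include hb

lemma IsWeight.exists_tl : ∃ R : ℝ, 1 ≤ R ∧ (∀ y, Adm b y → Adm b (tl y) ∧
    wsum b (tl y) ≤ R * wsum b y) ∧
    ∀ y y', Adm b y → Adm b y' → wdist b (tl y) (tl y') ≤ R * wdist b y y' := by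
  obtain ⟨R, hR⟩ := hb.shift
  have hR' : ∀ k, (b k : ℝ) ≤ R * b (k + 1) := fun k => by exact_mod_cast hR k
  have hR1 : (R : ℝ) ≤ max 1 (R : ℝ) := le_max_right _ _
  have main : ∀ z : ℕ → ℝ, (∀ k, 0 ≤ z k) → Summable (fun k => (b k : ℝ) * z k) →
      Summable (fun k => (b k : ℝ) * z (k + 1)) ∧
      ∑' k, (b k : ℝ) * z (k + 1) ≤ max 1 (R : ℝ) * ∑' k, (b k : ℝ) * z k := by
    intro z hz hs
    have hs1 := (summable_nat_add_iff 1).2 hs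
    have hle : ∀ k, (b k : ℝ) * z (k + 1) ≤ max 1 (R : ℝ) * ((b (k + 1) : ℝ) * z (k + 1)) :=
      fun k => by
        rw [← mul_assoc]
        exact mul_le_mul_of_nonneg_right ((hR' k).trans
          (mul_le_mul_of_nonneg_right hR1 (NNReal.coe_nonneg _))) (hz _)
    have hs2 : Summable (fun k => (b k : ℝ) * z (k + 1)) :=
      Summable.of_nonneg_of_le (fun k => mul_nonneg (NNReal.coe_nonneg _) (hz _)) hle
        (hs1.mul_left _)
    refine ⟨hs2, (hs2.tsum_le_tsum hle (hs1.mul_left _)).trans ?_⟩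
    rw [tsum_mul_left]
    refine mul_le_mul_of_nonneg_left ?_ (by positivity)
    rw [hs.tsum_eq_zero_add]
    have := mul_nonneg (b 0).coe_nonneg (hz 0)
    linarith
  refine ⟨max 1 R, le_max_left _ _, fun y hy => main (fun k => (y k : ℝ)) (fun k => by positivity)
    hy, fun y y' hy hy' => ?_⟩
  exact (main (fun k => |(y k : ℝ) - y' k|) (fun k => abs_nonneg _) (hy.summable_dist hy')).2

lemma Adm.tl (hy : Adm b y) : Adm b (tl y) := by
  obtain ⟨R, _, h, _⟩ := hb.exists_tl
  exact (h y hy).1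

lemma Tame.comp_tl {I : Type*} {h : I → NHist → ℝ} (hh : Tame b h) :
    Tame b fun i y => h i (PoissonAR.tl y) := by
  obtain ⟨C, p, hC, h1, h2⟩ := hh
  obtain ⟨R, hR, ht1, ht2⟩ := hb.exists_tl
  have hle : ∀ y, Adm b y → 1 + wsum b (PoissonAR.tl y) ≤ R * (1 + wsum b y) := fun y hy => by
    have := (ht1 y hy).2
    linarith
  refine ⟨C * R ^ (2 * p + 1), p, by positivity, fun i y hy => ?_, fun i y y' hy hy' => ?_⟩
  · have hw := wsum_nonneg b (PoissonAR.tl y)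
    have hw2 := wsum_nonneg b y
    calc |h i (PoissonAR.tl y)| ≤ C * (1 + wsum b (PoissonAR.tl y)) ^ p := h1 i _ (ht1 y hy).1
      _ ≤ C * (R * (1 + wsum b y)) ^ p := by gcongr; exact hle y hy
      _ = C * R ^ p * (1 + wsum b y) ^ p := by rw [mul_pow]; ring
      _ ≤ _ := by
        gcongr
        omega
  · have hw := wsum_nonneg b (PoissonAR.tl y)
    have hw2 := wsum_nonneg b y
    have hw' := wsum_nonneg b (PoissonAR.tl y')
    have hw2' := wsum_nonneg b y'
    have hd := wdist_nonneg b (PoissonAR.tl y) (PoissonAR.tl y')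
    calc _ ≤ _ := h2 i _ _ (ht1 y hy).1 (ht1 y' hy').1
      _ ≤ C * ((R * (1 + wsum b y)) * (R * (1 + wsum b y'))) ^ p * (R * wdist b y y') := by
        gcongr
        · exact hle y hy
        · exact hle y' hy'
        · exact ht2 y y' hy hy'
      _ = _ := by
        have e : R * (1 + wsum b y) * (R * (1 + wsum b y')) =
            R ^ 2 * ((1 + wsum b y) * (1 + wsum b y')) := by ring
        rw [e, mul_pow, ← pow_mul]
        ring

lemma Tame.eval_zero {I : Type*} : Tame b fun (_ : I) y => (y 0 : ℝ) := by
  refine Tame.of_modulus (C := 1) (fun i => by simp) (fun i y y' hy hy' => ?_) zero_le_one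
  rw [one_mul, wdist]
  have := (hy.summable_dist hy').le_tsum 0 fun k _ => by positivity
  simpa [hb.zero] using this

end Shift

/-! ### Truncation of histories -/

/-- The history with the given first values, and zeros behind. -/
def extend (N : ℕ) (p : Fin N → ℕ) : NHist := fun k => if h : k < N then p ⟨k, h⟩ else 0

/-- The history truncated to `N` values, each capped at `N`. -/
def trunc (N : ℕ) (y : NHist) : NHist := extend N fun k => min (y k) N

lemma trunc_apply (N : ℕ) (y : NHist) (k : ℕ) : trunc N y k = if k < N then min (y k) N else 0 := by
  simp only [trunc, extend]
  split_ifs <;> rfl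

lemma trunc_le (N : ℕ) (y : NHist) (k : ℕ) : trunc N y k ≤ y k := by
  rw [trunc_apply]; split_ifs <;> simp

lemma measurable_comp_trunc {E : Type*} [MeasurableSpace E] (g : NHist → E) (N : ℕ) :
    Measurable fun y => g (trunc N y) := by
  have h1 : Measurable fun y : NHist => fun k : Fin N => min (y k) N :=
    measurable_pi_lambda _ fun k => (Measurable.of_discrete (f := fun n : ℕ => min n N)).comp
      (measurable_pi_apply (k : ℕ))
  exact (Measurable.of_discrete (f := fun p : Fin N → ℕ => g (extend N p))).comp h1

lemma adm_extend (N : ℕ) (p : Fin N → ℕ) : Adm b (extend N p) := by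
  refine summable_of_ne_finset_zero (s := Finset.range N) fun k hk => ?_
  simp only [Finset.mem_range] at hk
  simp [extend, hk]

lemma adm_trunc (N : ℕ) (y : NHist) : Adm b (trunc N y) := adm_extend _ _

lemma wsum_trunc_le (N : ℕ) (hy : Adm b y) : wsum b (trunc N y) ≤ wsum b y :=
  (adm_trunc N y).tsum_le_tsum (fun k => by gcongr; exact trunc_le N y k) hy

/-- Coefficients bounding the distance of a history to its truncation by squared values. -/
def truncW (b : ℕ → ℝ≥0) (N k : ℕ) : ℝ≥0 := b k * if k < N then (N : ℝ≥0)⁻¹ else 1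

lemma truncW_le (b : ℕ → ℝ≥0) (N k : ℕ) (hN : 1 ≤ N) : truncW b N k ≤ b k := by
  unfold truncW
  refine mul_le_of_le_one_right zero_le ?_
  split_ifs
  · exact inv_le_one_of_one_le₀ (by exact_mod_cast hN)
  · exact le_rfl

lemma wd_trunc_le (N : ℕ) (hN : 1 ≤ N) (y : NHist) :
    wd b y (trunc N y) ≤ ∑' k, (truncW b N k : ℝ≥0∞) * (y k : ℝ≥0∞) ^ 2 := by
  refine ENNReal.tsum_le_tsum fun k => ?_
  have h1 : edist (y k) (trunc N y k) = ((y k - trunc N y k : ℕ) : ℝ≥0∞) := by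
    rw [edist_dist, Nat.dist_eq, ← Nat.cast_sub (trunc_le N y k), Nat.abs_cast,
      ENNReal.ofReal_natCast]
  rw [h1]
  have h2 : ((y k - trunc N y k : ℕ) : ℝ≥0) ≤ (if k < N then (N : ℝ≥0)⁻¹ else 1) * (y k) ^ 2 := by
    rw [trunc_apply]
    split_ifs with hk
    · rw [← div_eq_inv_mul, le_div_iff₀ (by positivity)]
      rcases le_total (y k) N with h | h
      · simp [min_eq_left h]
      · rw [min_eq_right h]
        calc ((y k - N : ℕ) : ℝ≥0) * N ≤ (y k : ℝ≥0) * y k := by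
              gcongr
              exact Nat.sub_le _ _
          _ = _ := by ring
    · rw [one_mul, Nat.sub_zero]
      exact_mod_cast Nat.le_self_pow two_ne_zero (y k)
  unfold truncW
  rw [ENNReal.coe_mul, mul_assoc]
  gcongr
  exact_mod_cast h2

lemma tendsto_tsum_truncW (hb : Summable b) :
    Tendsto (fun N => ((∑' k, truncW b N k : ℝ≥0) : ℝ≥0∞)) atTop (𝓝 0) := by
  have h1 : Tendsto (fun N => ∑' k, ((truncW b N k : ℝ≥0) : ℝ)) atTop (𝓝 (∑' _k : ℕ, (0 : ℝ))) := by
    refine tendsto_tsum_of_dominated_convergence (NNReal.summable_coe.2 hb) (fun k => ?_) ?_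
    · have : Tendsto (fun N : ℕ => (b k : ℝ) * (N : ℝ)⁻¹) atTop (𝓝 ((b k : ℝ) * 0)) :=
        (tendsto_inv_atTop_nhds_zero_nat (𝕜 := ℝ)).const_mul _
      rw [mul_zero] at this
      refine this.congr' ?_
      filter_upwards [eventually_gt_atTop k] with N hN
      simp [truncW, hN]
    · filter_upwards [eventually_ge_atTop 1] with N hN k
      rw [Real.norm_of_nonneg (NNReal.coe_nonneg _)]
      exact_mod_cast truncW_le b N k hN
  rw [tsum_zero] at h1
  have h2 : Tendsto (fun N => ∑' k, truncW b N k) atTop (𝓝 (0 : ℝ≥0)) := by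
    rw [← NNReal.tendsto_coe]
    simpa only [NNReal.coe_tsum, NNReal.coe_zero] using h1
  simpa using ENNReal.tendsto_coe.2 h2

section Moments

variable {ι : Type*} {ν : ι → Measure NHist}

lemma measurable_coord_pow (k r : ℕ) : Measurable fun y : NHist => (y k : ℝ≥0∞) ^ r :=
  (measurable_from_nat (f := fun n : ℕ => (n : ℝ≥0∞) ^ r)).comp (measurable_pi_apply k)

lemma MomentBdd.exists_wd_pow (hν : MomentBdd ν) (hb : Summable b) (r : ℕ) :
    ∃ C : ℝ≥0, ∀ i, ∫⁻ y, (1 + wd b y 0) ^ r ∂(ν i) ≤ C := by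
  obtain ⟨C0, hC0⟩ := hν 0
  cases r with
  | zero => exact ⟨C0, fun i => by simpa using hC0 i 0⟩
  | succ r =>
    obtain ⟨C, hC⟩ := hν (r + 1)
    refine ⟨(1 + ∑' k, b k) ^ r * (C0 + (∑' k, b k) * C), fun i => ?_⟩
    have hpt : ∀ y : NHist, (1 + wd b y 0) ^ (r + 1) ≤
        ((1 + ∑' k, b k : ℝ≥0) : ℝ≥0∞) ^ r * (1 + ∑' k, (b k : ℝ≥0∞) * (y k : ℝ≥0∞) ^ (r + 1)) := by
      intro y
      have h0 : ∀ g : ℕ → ℝ≥0∞, ∑' k, g k = g 0 + ∑' k, g (k + 1) := fun g =>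
        tsum_eq_zero_add' ENNReal.summable
      let w : ℕ → ℝ≥0∞ := fun k => Nat.casesOn k (1 : ℝ≥0∞) fun k => (b k : ℝ≥0∞)
      let z : ℕ → ℝ≥0∞ := fun k => Nat.casesOn k (1 : ℝ≥0∞) fun k => (y k : ℝ≥0∞)
      have h1 := ennreal_tsum_mul_pow_le w z r
      rw [h0 (fun k => w k * z k), h0 w, h0 (fun k => w k * z k ^ (r + 1))] at h1
      change ((1 : ℝ≥0∞) * 1 + ∑' k, (b k : ℝ≥0∞) * y k) ^ (r + 1) ≤
        ((1 : ℝ≥0∞) + ∑' k, (b k : ℝ≥0∞)) ^ r * ((1 : ℝ≥0∞) * 1 ^ (r + 1) +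
          ∑' k, (b k : ℝ≥0∞) * (y k : ℝ≥0∞) ^ (r + 1)) at h1
      rw [wd_zero]
      simpa [ENNReal.coe_tsum hb] using h1
    have hm : Measurable fun y : NHist => ∑' k, (b k : ℝ≥0∞) * (y k : ℝ≥0∞) ^ (r + 1) :=
      Measurable.tsum fun k => (measurable_coord_pow k _).const_mul _
    refine (lintegral_mono hpt).trans ?_
    rw [lintegral_const_mul _ (hm.const_add 1), lintegral_add_left measurable_const,
      lintegral_tsum fun k => ((measurable_coord_pow k _).const_mul _).aemeasurable]
    push_cast
    rw [ENNReal.coe_tsum hb, ← ENNReal.tsum_mul_right]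
    gcongr with k
    · simpa using hC0 i 0
    · rw [lintegral_const_mul _ (measurable_coord_pow k _)]
      gcongr
      exact hC i k

lemma MomentBdd.ae_adm (hν : MomentBdd ν) (hb : Summable b) (i : ι) : ∀ᵐ y ∂(ν i), Adm b y := by
  obtain ⟨C, hC⟩ := hν.exists_wd_pow hb 1
  have h1 : ∫⁻ y, (1 + wd b y 0) ^ 1 ∂(ν i) ≠ ∞ := ((hC i).trans_lt ENNReal.coe_lt_top).ne
  have hm : Measurable fun y : NHist => (1 + wd b y 0) ^ 1 :=
    ((measurable_wd_zero b).const_add 1).pow_const 1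
  filter_upwards [ae_lt_top hm h1] with y hy
  rw [adm_iff]
  intro h
  simp [h] at hy

lemma ennreal_mul_le_sq_add_sq (x z : ℝ≥0∞) : x * z ≤ x ^ 2 + z ^ 2 := by
  rcases le_total x z with h | h
  · calc x * z ≤ z * z := by gcongr
      _ = z ^ 2 := by ring
      _ ≤ _ := le_add_self
  · calc x * z ≤ x * x := by gcongr
      _ = x ^ 2 := by ring
      _ ≤ _ := le_self_add

lemma tendsto_trunc {I : Type*} {h : I → NHist → ℝ} (hh : Tame b h) (i : I)
    (hy : Adm b y) : Tendsto (fun N => h i (trunc N y)) atTop (𝓝 (h i y)) := by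
  obtain ⟨C, p, hC, h1, h2⟩ := hh
  have hd : Tendsto (fun N => wdist b y (trunc N y)) atTop (𝓝 (∑' _k : ℕ, (0 : ℝ))) := by
    refine tendsto_tsum_of_dominated_convergence hy (fun k => ?_) (.of_forall fun N k => ?_)
    · refine tendsto_const_nhds.congr' ?_
      filter_upwards [eventually_gt_atTop k, eventually_ge_atTop (y k)] with N hN hN'
      simp [trunc_apply, hN, hN']
    · rw [Real.norm_of_nonneg (by positivity)]
      gcongr
      have := trunc_le N y k
      have h3 : ((trunc N y k : ℕ) : ℝ) ≤ y k := by exact_mod_cast this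
      rw [abs_of_nonneg (by linarith)]
      have : (0 : ℝ) ≤ (trunc N y k : ℕ) := Nat.cast_nonneg _
      linarith
  rw [tsum_zero] at hd
  rw [tendsto_iff_dist_tendsto_zero]
  have h3 := hd.const_mul (C * ((1 + wsum b y) * (1 + wsum b y)) ^ p)
  rw [mul_zero] at h3
  refine squeeze_zero (fun N => dist_nonneg) (fun N => ?_) h3
  rw [dist_comm, Real.dist_eq]
  refine (h2 i y _ hy (adm_trunc N y)).trans ?_
  have e1 := wsum_nonneg b y
  have e2 := wsum_nonneg b (trunc N y)
  have e3 := wsum_trunc_le N hy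
  have e4 := wdist_nonneg b y (trunc N y)
  gcongr

/-- Tame functions are measurable once set to zero outside the admissible histories. -/
lemma Tame.measurable_indicator {I : Type*} {h : I → NHist → ℝ} (hh : Tame b h)
    (i : I) : Measurable ({y | Adm b y}.indicator (h i)) := by
  refine measurable_of_tendsto_metrizable
    (f := fun N => {y | Adm b y}.indicator fun y => h i (trunc N y))
    (fun N => (measurable_comp_trunc (h i) N).indicator (measurableSet_adm b)) ?_
  rw [tendsto_pi_nhds]
  intro y
  by_cases hy : Adm b y
  · simpa [Set.indicator, hy] using tendsto_trunc hh i hy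
  · simp [Set.indicator, hy]

lemma Tame.aestronglyMeasurable {I : Type*} {h : I → NHist → ℝ} (hb : Summable b) (hh : Tame b h)
    (hν : MomentBdd ν) (i : I) (n : ι) : AEStronglyMeasurable (h i) (ν n) := by
  refine ⟨_, (hh.measurable_indicator i).stronglyMeasurable, ?_⟩
  filter_upwards [hν.ae_adm hb n] with y hy
  simp [Set.indicator, hy]

lemma Adm.enorm_le {x : ℝ} {C : ℝ} {p : ℕ} (hC : 0 ≤ C) (hy : Adm b y)
    (hx : |x| ≤ C * (1 + wsum b y) ^ p) : ‖x‖ₑ ≤ ENNReal.ofReal C * (1 + wd b y 0) ^ p := by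
  rw [Real.enorm_eq_ofReal_abs]
  refine (ENNReal.ofReal_le_ofReal hx).trans (le_of_eq ?_)
  have := wsum_nonneg b y
  rw [ENNReal.ofReal_mul hC, ENNReal.ofReal_pow (by positivity),
    ENNReal.ofReal_add zero_le_one this, hy.ofReal_wsum, ENNReal.ofReal_one]

lemma Tame.exists_lintegral_le {I : Type*} {h : I → NHist → ℝ} (hb : Summable b) (hh : Tame b h)
    (hν : MomentBdd ν) : ∃ C : ℝ≥0, ∀ i n, ∫⁻ y, ‖h i y‖ₑ ∂(ν n) ≤ C := by
  obtain ⟨C, p, hC, h1, h2⟩ := hh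
  obtain ⟨M, hM⟩ := hν.exists_wd_pow hb p
  refine ⟨C.toNNReal * M, fun i n => ?_⟩
  calc ∫⁻ y, ‖h i y‖ₑ ∂(ν n) ≤ ∫⁻ y, ENNReal.ofReal C * (1 + wd b y 0) ^ p ∂(ν n) := by
        refine lintegral_mono_ae ?_
        filter_upwards [hν.ae_adm hb n] with y hy using hy.enorm_le hC (h1 i y hy)
    _ = ENNReal.ofReal C * ∫⁻ y, (1 + wd b y 0) ^ p ∂(ν n) :=
        lintegral_const_mul _ (((measurable_wd_zero b).const_add 1).pow_const p)
    _ ≤ _ := by rw [ENNReal.coe_mul]; exact mul_le_mul' le_rfl (hM n)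

lemma Tame.integrable {I : Type*} {h : I → NHist → ℝ} (hb : Summable b) (hh : Tame b h)
    (hν : MomentBdd ν) (i : I) (n : ι) : Integrable (h i) (ν n) := by
  obtain ⟨C, hC⟩ := hh.exists_lintegral_le hb hν
  exact ⟨hh.aestronglyMeasurable hb hν i n, (hC i n).trans_lt ENNReal.coe_lt_top⟩

/-- Truncating the history changes the expectations of a tame family by a uniformly small
amount. -/
lemma Tame.exists_trunc_error {I : Type*} {h : I → NHist → ℝ} (hb : Summable b) (hh : Tame b h)
    (hν : MomentBdd ν) : ∃ ε : ℕ → ℝ, Tendsto ε atTop (𝓝 0) ∧ ∀ᶠ N in atTop,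
      ∀ i n, |∫ y, h i y ∂(ν n) - ∫ y, h i (trunc N y) ∂(ν n)| ≤ ε N := by
  have hh' := hh
  obtain ⟨C, p, hC, h1, h2⟩ := hh
  obtain ⟨M, hM⟩ := hν.exists_wd_pow hb (2 * (2 * p))
  obtain ⟨M4, hM4⟩ := hν 4
  set E : ℕ → ℝ≥0∞ := fun N => ENNReal.ofReal C * (((∑' k, truncW b N k : ℝ≥0) : ℝ≥0∞) * (M + M4))
    with hE
  have hE0 : Tendsto E atTop (𝓝 0) := by
    have := ENNReal.Tendsto.const_mul (a := ENNReal.ofReal C)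
      (ENNReal.Tendsto.mul_const (b := (M + M4 : ℝ≥0∞)) (tendsto_tsum_truncW hb)
        (Or.inr (by simp))) (Or.inr ENNReal.ofReal_ne_top)
    simpa using this
  refine ⟨fun N => (E N).toReal, (ENNReal.tendsto_toReal ENNReal.zero_ne_top).comp hE0, ?_⟩
  filter_upwards [eventually_ge_atTop 1] with N hN i n
  have hts : Summable (truncW b N) := NNReal.summable_of_le (truncW_le b N · hN) hb
  have hEf : E N ≠ ∞ := by
    simp only [hE]
    exact ENNReal.mul_ne_top ENNReal.ofReal_ne_top (ENNReal.mul_ne_top ENNReal.coe_ne_top (by simp))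
  have hint := hh'.integrable hb hν i n
  have hbound : ∫⁻ y, ‖h i y - h i (trunc N y)‖ₑ ∂(ν n) ≤ E N := by
    have hA : Measurable fun y : NHist => (1 + wd b y 0) ^ (2 * p) :=
      ((measurable_wd_zero b).const_add 1).pow_const _
    calc ∫⁻ y, ‖h i y - h i (trunc N y)‖ₑ ∂(ν n)
        ≤ ∫⁻ y, ENNReal.ofReal C * ∑' k, (truncW b N k : ℝ≥0∞) *
            ((1 + wd b y 0) ^ (2 * p) * (y k : ℝ≥0∞) ^ 2) ∂(ν n) := by
          refine lintegral_mono_ae ?_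
          filter_upwards [hν.ae_adm hb n] with y hy
          have e1 := wsum_nonneg b y
          have e2 := wsum_nonneg b (trunc N y)
          have e3 := wsum_trunc_le N hy
          have e4 := wdist_nonneg b y (trunc N y)
          have h3 : |h i y - h i (trunc N y)| ≤
              C * ((1 + wsum b y) ^ (2 * p) * wdist b y (trunc N y)) := by
            refine (h2 i y _ hy (adm_trunc N y)).trans ?_
            rw [pow_mul, mul_assoc]
            gcongr ?_ * (?_ ^ _ * ?_)
            rw [sq]
            gcongr
          rw [Real.enorm_eq_ofReal_abs]
          refine (ENNReal.ofReal_le_ofReal h3).trans ?_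
          rw [ENNReal.ofReal_mul hC, ENNReal.ofReal_mul (by positivity),
            ENNReal.ofReal_pow (by positivity), ENNReal.ofReal_add zero_le_one e1,
            hy.ofReal_wsum, ENNReal.ofReal_one, hy.ofReal_wdist (adm_trunc N y)]
          gcongr
          refine (mul_le_mul' le_rfl (wd_trunc_le N hN y)).trans ?_
          rw [← ENNReal.tsum_mul_left]
          exact le_of_eq (tsum_congr fun k => by ring)
      _ = ENNReal.ofReal C * ∑' k, (truncW b N k : ℝ≥0∞) *
            ∫⁻ y, (1 + wd b y 0) ^ (2 * p) * (y k : ℝ≥0∞) ^ 2 ∂(ν n) := by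
          have hm : ∀ k, Measurable fun y : NHist =>
              (1 + wd b y 0) ^ (2 * p) * (y k : ℝ≥0∞) ^ 2 := fun k =>
            hA.mul (measurable_coord_pow k 2)
          rw [lintegral_const_mul _ (Measurable.tsum fun k => (hm k).const_mul _),
            lintegral_tsum fun k => ((hm k).const_mul _).aemeasurable]
          congr 1
          exact tsum_congr fun k => lintegral_const_mul _ (hm k)
      _ ≤ ENNReal.ofReal C * ∑' k, (truncW b N k : ℝ≥0∞) * (M + M4) := by
          gcongr with k
          refine (lintegral_mono fun y => ennreal_mul_le_sq_add_sq _ _).trans ?_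
          rw [lintegral_add_left (hA.pow_const 2)]
          gcongr
          · refine le_trans (le_of_eq (lintegral_congr fun y => ?_)) (hM n)
            rw [← pow_mul, mul_comm]
          · refine le_trans (le_of_eq (lintegral_congr fun y => ?_)) (hM4 n k)
            rw [← pow_mul]
      _ = E N := by rw [ENNReal.tsum_mul_right, ← ENNReal.coe_tsum hts]
  have hint2 : Integrable (fun y => h i y - h i (trunc N y)) (ν n) :=
    ⟨hint.1.sub (measurable_comp_trunc (h i) N).aestronglyMeasurable,
      hbound.trans_lt hEf.lt_top⟩
  have hint3 : Integrable (fun y => h i (trunc N y)) (ν n) := by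
    have := hint.sub hint2
    refine this.congr (.of_forall fun y => ?_)
    simp
  rw [← integral_sub hint hint3, ← Real.norm_eq_abs]
  refine (norm_integral_le_lintegral_norm _).trans (ENNReal.toReal_mono hEf ?_)
  refine le_trans (le_of_eq (lintegral_congr fun y => ?_)) hbound
  rw [ofReal_norm]

lemma integral_comp_trunc (ν : Measure NHist) [IsFiniteMeasure ν] (g : NHist → ℝ) (N : ℕ) :
    ∫ y, g (trunc N y) ∂ν = ∑ p : Fin N → Fin (N + 1),
      ν.real (cyl N fun k => p k) * g (extend N fun k => p k) := by
  have hpt : ∀ y, g (trunc N y) = ∑ p : Fin N → Fin (N + 1),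
      (cyl N fun k => p k).indicator (fun _ => g (extend N fun k => p k)) y := by
    intro y
    rw [Finset.sum_eq_single (fun k : Fin N => (⟨min (y k) N, by omega⟩ : Fin (N + 1)))]
    · have hy : y ∈ cyl N fun k => min (y k) N := fun k => rfl
      simp only [Set.indicator, hy, if_true]
      rfl
    · intro p _ hp
      refine Set.indicator_of_notMem (fun hy => hp ?_) _
      funext k
      exact Fin.ext (hy k).symm
    · simp
  simp_rw [hpt]
  rw [integral_finsetSum _ fun p _ => (integrable_const _).indicator (measurableSet_cyl N _)]
  refine Finset.sum_congr rfl fun p _ => ?_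
  rw [integral_indicator_const _ (measurableSet_cyl N _), smul_eq_mul]

/-- Uniform law of large numbers, in deterministic form: laws on histories with uniformly bounded
moments that converge on cylinders integrate tame families uniformly in the index. Up to a
uniformly small error, only finitely many truncated histories matter. -/
theorem Tame.eventually_abs_integral_sub_le {I : Type*} {h : I → NHist → ℝ} (hb : Summable b)
    (hh : Tame b h) [∀ n, IsProbabilityMeasure (ν n)] (hν : MomentBdd ν) {π : Measure NHist}
    [IsProbabilityMeasure π] (hπ : MomentBdd fun _ : Unit => π) {l : Filter ι}
    (hconv : ∀ (N : ℕ) (p : Fin N → ℕ), Tendsto (fun n => (ν n).real (cyl N p)) l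
      (𝓝 (π.real (cyl N p)))) {ε : ℝ} (hε : 0 < ε) :
    ∀ᶠ n in l, ∀ i, |∫ y, h i y ∂(ν n) - ∫ y, h i y ∂π| ≤ ε := by
  obtain ⟨e1, he1, he1'⟩ := hh.exists_trunc_error hb hν
  obtain ⟨e2, he2, he2'⟩ := hh.exists_trunc_error hb hπ
  obtain ⟨N, h1, h2, h3, h4⟩ := (he1'.and (he2'.and ((he1.eventually_lt_const
    (show (0 : ℝ) < ε / 3 by positivity)).and (he2.eventually_lt_const
    (show (0 : ℝ) < ε / 3 by positivity))))).exists
  obtain ⟨C, q, hC, hgr, -⟩ := hh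
  set B : (Fin N → Fin (N + 1)) → ℝ := fun p => C * (1 + wsum b (extend N fun k => p k)) ^ q with hB
  have hB0 : ∀ p, 0 ≤ B p := fun p => by
    have := wsum_nonneg b (extend N fun k => p k)
    positivity
  have hlim : Tendsto (fun n => ∑ p : Fin N → Fin (N + 1),
      |(ν n).real (cyl N fun k => p k) - π.real (cyl N fun k => p k)| * B p) l (𝓝 0) := by
    have : (0 : ℝ) = ∑ p : Fin N → Fin (N + 1), 0 * B p := by simp
    rw [this]
    refine tendsto_finsetSum _ fun p _ => Tendsto.mul_const _ ?_
    have := ((hconv N fun k => p k).sub_const (π.real (cyl N fun k => p k))).abs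
    simpa using this
  filter_upwards [hlim.eventually_lt_const (show (0 : ℝ) < ε / 3 by positivity)] with n hn i
  have f1 := h1 i n
  have f2 := h2 i ()
  have f3 : |∫ y, h i (trunc N y) ∂(ν n) - ∫ y, h i (trunc N y) ∂π| ≤ ε / 3 := by
    rw [integral_comp_trunc, integral_comp_trunc, ← Finset.sum_sub_distrib]
    refine (Finset.abs_sum_le_sum_abs _ _).trans (le_trans (Finset.sum_le_sum fun p _ => ?_) hn.le)
    rw [← sub_mul, abs_mul]
    exact mul_le_mul_of_nonneg_left (hgr i _ (adm_extend _ _)) (abs_nonneg _)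
  rw [abs_le] at f1 f2 f3 ⊢
  constructor <;> linarith [f1.1, f1.2, f2.1, f2.2, f3.1, f3.2]

lemma Tame.tendsto_integral {I : Type*} {h : I → NHist → ℝ} (hb : Summable b)
    (hh : Tame b h) [∀ n, IsProbabilityMeasure (ν n)] (hν : MomentBdd ν) {π : Measure NHist}
    [IsProbabilityMeasure π] (hπ : MomentBdd fun _ : Unit => π) {l : Filter ι}
    (hconv : ∀ (N : ℕ) (p : Fin N → ℕ), Tendsto (fun n => (ν n).real (cyl N p)) l
      (𝓝 (π.real (cyl N p)))) (i : I) :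
    Tendsto (fun n => ∫ y, h i y ∂(ν n)) l (𝓝 (∫ y, h i y ∂π)) := by
  rw [Metric.tendsto_nhds]
  intro ε hε
  filter_upwards [hh.eventually_abs_integral_sub_le hb hν hπ hconv (half_pos hε)] with n hn
  rw [Real.dist_eq]
  linarith [hn i]

end Moments

/-! ### Existence of a stationary solution -/

lemma continuous_hist_coord (t : ℤ) : Continuous (hist coord t) :=
  continuous_pi fun k => continuous_apply (t - (k : ℤ))

lemma measurable_coord (t : ℤ) : Measurable (coord t) := measurable_pi_apply t

lemma tendsto_trunc_nhds (y : NHist) : Tendsto (fun N => trunc N y) atTop (𝓝 y) := by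
  rw [tendsto_pi_nhds]
  intro k
  refine tendsto_const_nhds.congr' ?_
  filter_upwards [eventually_gt_atTop k, eventually_ge_atTop (y k)] with N hN hN'
  simp [trunc_apply, hN, hN']

/-- Laws on histories are determined by the probabilities of the cylinders. -/
lemma ext_of_cyl {ν ν' : Measure NHist} [IsFiniteMeasure ν] [IsFiniteMeasure ν']
    (h : ∀ (N : ℕ) (p : Fin N → ℕ), ν.real (cyl N p) = ν'.real (cyl N p)) : ν = ν' := by
  refine ext_of_forall_integral_eq_of_IsFiniteMeasure fun g => ?_
  have key : ∀ (ρ : Measure NHist) [IsFiniteMeasure ρ],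
      Tendsto (fun N => ∫ y, g (trunc N y) ∂ρ) atTop (𝓝 (∫ y, g y ∂ρ)) := fun ρ _ =>
    tendsto_integral_of_dominated_convergence (fun _ => ‖g‖)
      (fun N => (measurable_comp_trunc g N).aestronglyMeasurable) (integrable_const _)
      (fun N => .of_forall fun y => g.norm_coe_le_norm _)
      (.of_forall fun y => (g.continuous.tendsto y).comp (tendsto_trunc_nhds y))
  refine tendsto_nhds_unique (key ν) ((key ν').congr fun N => ?_)
  rw [integral_comp_trunc, integral_comp_trunc]
  exact Finset.sum_congr rfl fun p _ => by rw [h]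

lemma isClopen_cyl (N : ℕ) (p : Fin N → ℕ) : IsClopen (cyl N p) := by
  have : cyl N p = ⋂ k : Fin N, (fun y : NHist => y k) ⁻¹' {n | min n N = p k} := by
    ext y; simp [cyl]
  rw [this]
  exact isClopen_iInter_of_finite fun k =>
    (isClopen_discrete _).preimage (continuous_apply (k : ℕ))

/-- The shift on path space. -/
def shift (x : ℤ → ℕ) : ℤ → ℕ := fun t => x (t + 1)

lemma continuous_shift : Continuous shift := continuous_pi fun t => continuous_apply (t + 1)

lemma hist_coord_shift (t : ℤ) (x : ℤ → ℕ) : hist coord t (shift x) = hist coord (t + 1) x := by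
  funext k
  simp only [hist, coord, shift]
  congr 1
  ring

section Limit

variable {Ω : Type*} [mΩ : MeasurableSpace Ω] {μ : Measure Ω} [IsProbabilityMeasure μ]
  {Y : ℤ → Ω → ℕ} {lam : NHist → ℝ≥0} {hlam : Measurable lam} {α b : ℕ → ℝ≥0}

/-- The path of the process seen from time `s`. -/
def pathFrom (Y : ℤ → Ω → ℕ) (s : ℕ) (ω : Ω) : ℤ → ℕ := fun r => Y (r + s) ω

lemma measurable_pathFrom (hY : ∀ t, Measurable (Y t)) (s : ℕ) : Measurable (pathFrom Y s) :=
  measurable_pi_lambda _ fun r => hY (r + s)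

/-- The Cesàro average of the laws of the paths seen from the times `0, …, n`. -/
def cesaro (μ : Measure Ω) (Y : ℤ → Ω → ℕ) (n : ℕ) : Measure (ℤ → ℕ) :=
  ((n + 1 : ℕ) : ℝ≥0∞)⁻¹ • ∑ s ∈ Finset.range (n + 1), μ.map (pathFrom Y s)

lemma isProbabilityMeasure_cesaro (hY : ∀ t, Measurable (Y t)) (n : ℕ) :
    IsProbabilityMeasure (cesaro μ Y n) := by
  constructor
  have : ∀ s ∈ Finset.range (n + 1), (μ.map (pathFrom Y s)) Set.univ = 1 := fun s _ => by
    rw [Measure.map_apply (measurable_pathFrom hY s) MeasurableSet.univ]; simp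
  simp only [cesaro, Measure.smul_apply, Measure.finsetSum_apply]
  rw [Finset.sum_congr rfl this]
  simp only [Finset.sum_const, Finset.card_range, nsmul_eq_mul, mul_one, smul_eq_mul]
  exact ENNReal.inv_mul_cancel (by positivity) (ENNReal.natCast_ne_top _)

lemma integral_cesaro (hY : ∀ t, Measurable (Y t)) (n : ℕ) {F : (ℤ → ℕ) → ℝ} {B : ℝ}
    (hF : Measurable F) (hB : ∀ x, |F x| ≤ B) : ∫ x, F x ∂(cesaro μ Y n) =
      ((n + 1 : ℕ) : ℝ)⁻¹ * ∑ s ∈ Finset.range (n + 1), ∫ ω, F (pathFrom Y s ω) ∂μ := by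
  have hp : ∀ s : ℕ, IsProbabilityMeasure (μ.map (pathFrom Y s)) := fun s =>
    Measure.isProbabilityMeasure_map (measurable_pathFrom hY s).aemeasurable
  rw [cesaro, integral_smul_measure, integral_finsetSum_measure fun s _ =>
    Integrable.of_bound hF.aestronglyMeasurable B (.of_forall hB)]
  rw [ENNReal.toReal_inv, ENNReal.toReal_natCast, smul_eq_mul]
  congr 1
  exact Finset.sum_congr rfl fun s _ =>
    integral_map (measurable_pathFrom hY s).aemeasurable hF.aestronglyMeasurable

lemma lintegral_cesaro_le (hY : ∀ t, Measurable (Y t)) (n : ℕ) {F : (ℤ → ℕ) → ℝ≥0∞} {C : ℝ≥0∞}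
    (hF : Measurable F) (hC : ∀ s : ℕ, ∫⁻ ω, F (pathFrom Y s ω) ∂μ ≤ C) :
    ∫⁻ x, F x ∂(cesaro μ Y n) ≤ C := by
  rw [cesaro, lintegral_smul_measure, lintegral_finsetSum_measure, smul_eq_mul,
    ENNReal.inv_mul_le_iff (by positivity) (ENNReal.natCast_ne_top _)]
  refine (Finset.sum_le_sum fun s _ => ?_).trans (le_of_eq ?_) (b := ∑ s ∈ Finset.range (n + 1), C)
  · rw [lintegral_map hF (measurable_pathFrom hY s)]
    exact hC s
  · simp

lemma measurable_coord_pow_path (t : ℤ) (r : ℕ) : Measurable fun x : ℤ → ℕ => (x t : ℝ≥0∞) ^ r :=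
  (measurable_from_nat (f := fun n : ℕ => (n : ℝ≥0∞) ^ r)).comp (measurable_pi_apply t)

lemma isTightMeasureSet_of_moment {S : Set (Measure (ℤ → ℕ))} {C : ℝ≥0}
    (hS : ∀ ν ∈ S, ∀ t : ℤ, ∫⁻ x, (x t : ℝ≥0∞) ∂ν ≤ C) : IsTightMeasureSet S := by
  rw [isTightMeasureSet_iff_exists_isCompact_measure_compl_le]
  intro ε hε
  obtain ⟨e, he, hsum⟩ := ENNReal.exists_pos_sum_of_countable' hε.ne' ℤ
  have hM : ∀ t, ∃ M : ℕ, (C : ℝ≥0∞) ≤ M * e t := fun t => by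
    obtain ⟨M, hM⟩ := ENNReal.exists_nat_mul_gt (he t).ne' (ENNReal.coe_ne_top (r := C))
    exact ⟨M, hM.le⟩
  choose M hM using hM
  refine ⟨Set.univ.pi fun t => Set.Iic (M t), isCompact_univ_pi fun t => (Set.finite_Iic _).isCompact,
    fun ν hν => ?_⟩
  have hsub : (Set.univ.pi fun t => Set.Iic (M t))ᶜ ⊆ ⋃ t : ℤ, {x : ℤ → ℕ | M t < x t} := by
    intro x hx
    simpa only [Set.mem_compl_iff, Set.mem_pi, Set.mem_univ, forall_true_left, Set.mem_Iic, not_forall,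
      not_le, Set.mem_iUnion, Set.mem_ofPred_eq] using hx
  refine (measure_mono hsub).trans ((measure_iUnion_le _).trans (le_trans ?_ hsum.le))
  refine ENNReal.tsum_le_tsum fun t => ?_
  have hm : Measurable fun x : ℤ → ℕ => (x t : ℝ≥0∞) := by
    simpa using measurable_coord_pow_path t 1
  have h1 : ((M t + 1 : ℕ) : ℝ≥0∞) * ν {x | M t < x t} ≤ C := by
    refine le_trans (le_of_eq ?_) ((mul_meas_ge_le_lintegral hm ((M t + 1 : ℕ) : ℝ≥0∞)).trans
      (hS ν hν t))
    congr 2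
    ext x
    simp only [Set.mem_ofPred_eq, Nat.cast_le]
    omega
  have h2 : ((M t + 1 : ℕ) : ℝ≥0∞) * ν {x | M t < x t} ≤ ((M t + 1 : ℕ) : ℝ≥0∞) * e t := by
    refine h1.trans ((hM t).trans ?_)
    gcongr
    omega
  exact (ENNReal.mul_le_mul_iff_right (by positivity) (ENNReal.natCast_ne_top _)).1 h2

lemma CondLaw.of_map_eq {Q : Measure (ℤ → ℕ)} [IsProbabilityMeasure Q] {t : ℤ}
    (h : Q.map (hist coord (t + 1)) =
      ((Q.map (hist coord t)) ⊗ₘ (poissonKernel lam hlam)).map fun p => cons p.2 p.1) :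
    CondLaw Q coord lam hlam t := by
  have hi : Measurable fun y : NHist => (tl y, y 0) :=
    measurable_tl.prodMk (measurable_pi_apply 0)
  have h1 := congrArg (Measure.map fun y : NHist => (tl y, y 0)) h
  rw [Measure.map_map hi (measurable_hist measurable_coord _), Measure.map_map hi measurable_cons]
    at h1
  have e1 : ((fun y : NHist => (tl y, y 0)) ∘ hist coord (t + 1)) =
      fun x => (hist coord t x, coord (t + 1) x) := by
    funext x
    rw [Function.comp, tl_hist_succ]
    simp [hist]
  have e2 : ((fun y : NHist => (tl y, y 0)) ∘ fun p : NHist × ℕ => cons p.2 p.1) = id := by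
    funext p; simp
  rw [e1, e2, Measure.map_id] at h1
  exact h1

lemma map_hist_coord_succ {Q : Measure (ℤ → ℕ)} (hQ : Q.map shift = Q) (t : ℤ) :
    Q.map (hist coord (t + 1)) = Q.map (hist coord t) := by
  conv_rhs => rw [← hQ, Measure.map_map (measurable_hist measurable_coord t)
    continuous_shift.measurable]
  congr 1
  funext x
  exact (hist_coord_shift t x).symm

lemma condLaw_coord_succ_iff {Q : Measure (ℤ → ℕ)} (hQ : Q.map shift = Q) (t : ℤ) :
    CondLaw Q coord lam hlam (t + 1) ↔ CondLaw Q coord lam hlam t := by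
  have hs : Measurable shift := continuous_shift.measurable
  have h2 : Q.map (fun x => (hist coord (t + 1) x, coord (t + 1 + 1) x)) =
      Q.map (fun x => (hist coord t x, coord (t + 1) x)) := by
    conv_rhs => rw [← hQ, Measure.map_map ((measurable_hist measurable_coord t).prodMk
      (measurable_coord _)) hs]
    congr 1
    funext x
    simp only [Function.comp, hist_coord_shift]
    rfl
  rw [CondLaw, CondLaw, map_hist_coord_succ hQ, h2]

lemma tame_trans_indicator_cyl (h : Contractive lam α) (hb : IsWeight b)
    (hα : ∃ C : ℝ≥0, ∀ k, α k ≤ C * b k) (N : ℕ) (p : Fin N → ℕ) :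
    Tame b fun (_ : Unit) => trans lam ((cyl N p).indicator 1) := by
  obtain ⟨C, hC⟩ := iterate_shiftW_le hb hα (hb.cylW_le N) 1
  refine Tame.of_edist_le (C := max C 1) (fun _ => ?_) fun _ y y' => ?_
  · exact (abs_trans_le (abs_indicator_cyl_le N p) _).trans (by simp)
  · refine (h.trans_lip (abs_indicator_cyl_le N p) (edist_indicator_cyl_le N p) y y').trans ?_
    refine (wd_le_mul (C := max C 1) (fun k => (hC k).trans ?_) y y')
    gcongr
    exact le_max_left _ _

/-- A contractive model has a stationary solution: a limit point of the Cesàro averages of the laws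
of a given solution started at time `0`. -/
theorem exists_stationary (hY : ∀ t, Measurable (Y t)) (h : Contractive lam α)
    (hlaw : ∀ t : ℕ, CondLaw μ Y lam hlam t)
    (hmom : ∀ r : ℕ, ∃ C : ℝ≥0, ∀ t : ℤ, ∫⁻ ω, (Y t ω : ℝ≥0∞) ^ r ∂μ ≤ C)
    (hb : IsWeight b) (hα : ∃ C : ℝ≥0, ∀ k, α k ≤ C * b k) :
    ∃ Q : Measure (ℤ → ℕ), IsProbabilityMeasure Q ∧ Q.map shift = Q ∧
      (∀ r : ℕ, ∃ C : ℝ≥0, ∀ t, ∫⁻ x, (coord t x : ℝ≥0∞) ^ r ∂Q ≤ C) ∧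
      ∀ t, CondLaw Q coord lam hlam t := by
  have hP := isProbabilityMeasure_cesaro (μ := μ) hY
  let R : ℕ → ProbabilityMeasure (ℤ → ℕ) := fun n => ⟨cesaro μ Y n, hP n⟩
  have hmomR : ∀ r : ℕ, ∃ C : ℝ≥0, ∀ n t, ∫⁻ x, (x t : ℝ≥0∞) ^ r ∂(cesaro μ Y n) ≤ C := fun r => by
    obtain ⟨C, hC⟩ := hmom r
    exact ⟨C, fun n t => lintegral_cesaro_le hY n (measurable_coord_pow_path t r) fun s => hC _⟩
  obtain ⟨C1, hC1⟩ := hmomR 1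
  have htight : IsTightMeasureSet {((ν : ProbabilityMeasure (ℤ → ℕ)) : Measure (ℤ → ℕ)) |
      ν ∈ Set.range R} := by
    refine isTightMeasureSet_of_moment (C := C1) ?_
    rintro _ ⟨_, ⟨n, rfl⟩, rfl⟩ t
    have := hC1 n t
    simp only [pow_one] at this
    exact this
  have hK := isCompact_closure_of_isTightMeasureSet htight
  obtain ⟨Q, -, hQ⟩ := hK.ultrafilter_le_nhds' ((hyperfilter ℕ).map R)
    (mem_map.2 (univ_mem' fun n => subset_closure ⟨n, rfl⟩))
  set l : Filter ℕ := (hyperfilter ℕ : Filter ℕ) with hl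
  have hlim : Tendsto R l (𝓝 Q) := hQ
  have hlt : l ≤ atTop := Nat.hyperfilter_le_atTop
  have hlimI := ProbabilityMeasure.tendsto_iff_forall_integral_tendsto.1 hlim
  have hlimL := ProbabilityMeasure.tendsto_iff_forall_lintegral_tendsto.1 hlim
  -- the shift changes the Cesàro averages by boundary terms only
  have hstat : (Q : Measure (ℤ → ℕ)).map shift = Q := by
    have : IsProbabilityMeasure ((Q : Measure (ℤ → ℕ)).map shift) :=
      Measure.isProbabilityMeasure_map continuous_shift.measurable.aemeasurable
    refine ext_of_forall_integral_eq_of_IsFiniteMeasure fun F => ?_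
    rw [integral_map continuous_shift.measurable.aemeasurable
      F.continuous.measurable.aestronglyMeasurable]
    have h1 := hlimI (F.compContinuous ⟨shift, continuous_shift⟩)
    have h2 := hlimI F
    have h3 : Tendsto (fun n : ℕ => ∫ x, F (shift x) ∂(cesaro μ Y n) - ∫ x, F x ∂(cesaro μ Y n)) l
        (𝓝 0) := by
      refine Tendsto.mono_left ?_ hlt
      have hb0 : Tendsto (fun n : ℕ => ((n + 1 : ℕ) : ℝ)⁻¹ * (2 * ‖F‖)) atTop (𝓝 0) := by
        have := ((tendsto_add_atTop_iff_nat 1).2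
          (tendsto_inv_atTop_nhds_zero_nat (𝕜 := ℝ))).mul_const (2 * ‖F‖)
        simpa using this
      refine squeeze_zero_norm (fun n => ?_) hb0
      have hFb : ∀ x, |F x| ≤ ‖F‖ := fun x => F.norm_coe_le_norm x
      rw [integral_cesaro hY n (F := fun x => F (shift x))
        (F.continuous.comp continuous_shift).measurable (fun x => hFb (shift x)), integral_cesaro hY n F.continuous.measurable hFb, ← mul_sub,
        ← Finset.sum_sub_distrib, norm_mul, Real.norm_of_nonneg (by positivity)]
      refine mul_le_mul_of_nonneg_left ?_ (by positivity)
      have e : ∀ s : ℕ, ∫ ω, F (shift (pathFrom Y s ω)) ∂μ = ∫ ω, F (pathFrom Y (s + 1) ω) ∂μ := by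
        intro s
        congr 1
        funext ω
        congr 1
        funext r
        simp only [shift, pathFrom]
        congr 1
        push_cast
        ring
      simp_rw [e]
      rw [Finset.sum_range_sub fun s => ∫ ω, F (pathFrom Y s ω) ∂μ]
      have hI : ∀ s, ‖∫ ω, F (pathFrom Y s ω) ∂μ‖ ≤ ‖F‖ := fun s => by
        simpa using norm_integral_le_of_norm_le_const (μ := μ) (C := ‖F‖)
          (f := fun ω => F (pathFrom Y s ω)) (.of_forall fun ω => hFb _)
      refine (norm_sub_le _ _).trans ?_
      linarith [hI (n + 1), hI 0]
    have h4 := tendsto_nhds_unique h3 (h1.sub h2)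
    exact (sub_eq_zero.1 h4.symm)
  have hmomQ : ∀ r : ℕ, ∃ C : ℝ≥0, ∀ t, ∫⁻ x, (coord t x : ℝ≥0∞) ^ r ∂(Q : Measure (ℤ → ℕ)) ≤ C := by
    intro r
    obtain ⟨C, hC⟩ := hmomR r
    refine ⟨C, fun t => ?_⟩
    have hM : ∀ M : ℕ, ∫⁻ x, ((min ((coord t x) ^ r) M : ℕ) : ℝ≥0∞) ∂(Q : Measure (ℤ → ℕ)) ≤ C := by
      intro M
      let G : BoundedContinuousFunction (ℤ → ℕ) ℝ≥0 :=
        BoundedContinuousFunction.mkOfBound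
          ⟨fun x => ((min ((x t) ^ r) M : ℕ) : ℝ≥0),
            (continuous_of_discreteTopology (f := fun m : ℕ => ((min (m ^ r) M : ℕ) : ℝ≥0))).comp
              (continuous_apply t)⟩ M (fun x y => by
                simp only [ContinuousMap.coe_mk]
                rw [NNReal.dist_eq]
                have h1 : ((min ((x t) ^ r) M : ℕ) : ℝ) ≤ M := by exact_mod_cast min_le_right _ _
                have h2 : ((min ((y t) ^ r) M : ℕ) : ℝ) ≤ M := by exact_mod_cast min_le_right _ _
                have h3 : (0 : ℝ) ≤ ((min ((x t) ^ r) M : ℕ) : ℝ) := Nat.cast_nonneg _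
                have h4 : (0 : ℝ) ≤ ((min ((y t) ^ r) M : ℕ) : ℝ) := Nat.cast_nonneg _
                simp only [NNReal.coe_natCast]
                rw [abs_le]
                constructor <;> linarith)
      refine (le_of_eq ?_).trans (le_of_tendsto (hlimL G) (.of_forall fun n => ?_))
      · refine lintegral_congr fun x => ?_
        simp only [G, BoundedContinuousFunction.mkOfBound_coe, ContinuousMap.coe_mk,
          ENNReal.coe_natCast]
        rfl
      · refine le_trans (lintegral_mono fun x => ?_) (hC n t)
        simp only [G, BoundedContinuousFunction.mkOfBound_coe, ContinuousMap.coe_mk,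
          ENNReal.coe_natCast]
        exact_mod_cast min_le_left _ _
    have hsup : ∀ x : ℤ → ℕ, (coord t x : ℝ≥0∞) ^ r =
        ⨆ M : ℕ, ((min ((coord t x) ^ r) M : ℕ) : ℝ≥0∞) := fun x => by
      refine le_antisymm (le_iSup_of_le (coord t x ^ r) (by simp)) (iSup_le fun M => ?_)
      exact_mod_cast min_le_left _ _
    simp_rw [hsup]
    have hmeas : ∀ M : ℕ, Measurable fun x : ℤ → ℕ => ((min ((coord t x) ^ r) M : ℕ) : ℝ≥0∞) :=
      fun M => (measurable_from_nat (f := fun m : ℕ => ((min (m ^ r) M : ℕ) : ℝ≥0∞))).comp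
        (measurable_coord t)
    rw [lintegral_iSup hmeas fun M M' hMM x => by
      simp only
      exact_mod_cast min_le_min le_rfl hMM]
    exact iSup_le hM
  have hlaw0 : CondLaw (Q : Measure (ℤ → ℕ)) coord lam hlam 0 := by
    have hh0 := measurable_hist measurable_coord 0
    have hprob : ∀ n, IsProbabilityMeasure ((cesaro μ Y n).map (hist coord 0)) := fun n =>
      Measure.isProbabilityMeasure_map hh0.aemeasurable
    have hprobQ : IsProbabilityMeasure ((Q : Measure (ℤ → ℕ)).map (hist coord 0)) :=
      Measure.isProbabilityMeasure_map hh0.aemeasurable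
    have hprobQ1 : IsProbabilityMeasure ((Q : Measure (ℤ → ℕ)).map (hist coord (0 + 1))) :=
      Measure.isProbabilityMeasure_map (measurable_hist measurable_coord (0 + 1)).aemeasurable
    have hprobC : IsProbabilityMeasure (((Q : Measure (ℤ → ℕ)).map (hist coord 0) ⊗ₘ
        (poissonKernel lam hlam)).map fun p => cons p.2 p.1) :=
      Measure.isProbabilityMeasure_map measurable_cons.aemeasurable
    have hmb : ∀ (ι : Type) (ν : ι → Measure (ℤ → ℕ)), (∀ r : ℕ, ∃ C : ℝ≥0, ∀ i t,
        ∫⁻ x, (x t : ℝ≥0∞) ^ r ∂(ν i) ≤ C) → MomentBdd fun i => (ν i).map (hist coord 0) :=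
      fun ι ν hν r => by
        obtain ⟨C, hC⟩ := hν r
        refine ⟨C, fun i k => ?_⟩
        rw [lintegral_map (measurable_coord_pow k r) hh0]
        exact hC i (0 - k)
    have hconv : ∀ (t : ℤ) (N : ℕ) (p : Fin N → ℕ), Tendsto
        (fun n => ((cesaro μ Y n).map (hist coord t)).real (cyl N p)) l
        (𝓝 (((Q : Measure (ℤ → ℕ)).map (hist coord t)).real (cyl N p))) := by
      intro t N p
      have hcl := (isClopen_cyl N p).preimage (continuous_hist_coord t)
      have hm : MeasurableSet (hist coord t ⁻¹' cyl N p) := hcl.isOpen.measurableSet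
      have h1 := hlimI (BoundedContinuousFunction.indicator _ hcl)
      have e : ∀ ρ : Measure (ℤ → ℕ), (ρ.map (hist coord t)).real (cyl N p) =
          ∫ x, (BoundedContinuousFunction.indicator _ hcl) x ∂ρ := fun ρ => by
        rw [map_measureReal_apply (measurable_hist measurable_coord t) (measurableSet_cyl N p)]
        exact (integral_indicator_one hm).symm
      simp_rw [e]
      exact h1
    refine CondLaw.of_map_eq (ext_of_cyl fun N p => ?_)
    set g : NHist → ℝ := (cyl N p).indicator 1 with hg
    have hgm : Measurable g := measurable_one.indicator (measurableSet_cyl N p)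
    have hTm := measurable_trans hlam hgm
    have h1 := (tame_trans_indicator_cyl h hb hα N p).tendsto_integral hb.summable
      (hmb ℕ (fun n => cesaro μ Y n) hmomR)
      (hmb Unit (fun _ => (Q : Measure (ℤ → ℕ))) fun r => by
        obtain ⟨C, hC⟩ := hmomQ r
        exact ⟨C, fun _ t => hC t⟩) (hconv 0) ()
    have h2 := hconv (0 + 1) N p
    have e1 : ∀ n, ((cesaro μ Y n).map (hist coord (0 + 1))).real (cyl N p) =
        ∫ y, trans lam g y ∂((cesaro μ Y n).map (hist coord 0)) := by
      intro n
      rw [← integral_indicator_one (measurableSet_cyl N p), ← hg,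
        integral_map (measurable_hist measurable_coord _).aemeasurable hgm.aestronglyMeasurable,
        integral_map hh0.aemeasurable hTm.aestronglyMeasurable,
        integral_cesaro hY n (F := fun x => g (hist coord (0 + 1) x))
          (hgm.comp (measurable_hist measurable_coord _)) (fun x => abs_indicator_cyl_le N p _),
        integral_cesaro hY n (F := fun x => trans lam g (hist coord 0 x)) (hTm.comp hh0)
          (fun x => abs_trans_le (abs_indicator_cyl_le N p) _)]
      congr 1
      refine Finset.sum_congr rfl fun s _ => ?_
      have e2 : ∀ (t : ℤ) ω, hist coord t (pathFrom Y s ω) = hist Y (t + s) ω := by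
        intro t ω
        funext k
        simp only [hist, coord, pathFrom]
        congr 1
        ring
      simp_rw [e2, zero_add, add_comm (1 : ℤ)]
      exact ((hlaw s).integral hY hgm.stronglyMeasurable (Integrable.of_bound
        (hgm.comp (measurable_hist hY _)).aestronglyMeasurable 1
        (.of_forall fun ω => abs_indicator_cyl_le N p _))).2
    simp_rw [e1] at h2
    rw [tendsto_nhds_unique h2 h1, ← integral_indicator_one (measurableSet_cyl N p), ← hg,
      integral_map measurable_cons.aemeasurable hgm.aestronglyMeasurable,
      Measure.integral_compProd (f := fun q : NHist × ℕ => g (cons q.2 q.1)) (Integrable.of_bound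
        (hgm.comp measurable_cons).aestronglyMeasurable 1
        (.of_forall fun ω => abs_indicator_cyl_le N p _))]
    rfl
  refine ⟨Q, inferInstance, hstat, hmomQ, fun t => ?_⟩
  induction t using Int.induction_on with
  | zero => exact hlaw0
  | succ i ih => exact (condLaw_coord_succ_iff hstat _).2 ih
  | pred i ih =>
    refine (condLaw_coord_succ_iff hstat _).1 ?_
    rwa [sub_add_cancel]

/-- The history of a stationary solution has an invariant law. -/
lemma CondLaw.isInvariant {Q : Measure (ℤ → ℕ)} [IsProbabilityMeasure Q] (hQ : Q.map shift = Q)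
    {t : ℤ} (h : CondLaw Q coord lam hlam t) : IsInvariant lam (Q.map (hist coord t)) := by
  intro g B hg hB
  have hm := fun t => measurable_hist measurable_coord t
  conv_rhs => rw [← map_hist_coord_succ hQ t]
  rw [integral_map (hm _).aemeasurable hg.aestronglyMeasurable,
    integral_map (hm _).aemeasurable (measurable_trans hlam hg).aestronglyMeasurable]
  exact (h.integral measurable_coord hg.stronglyMeasurable (Integrable.of_bound
    (hg.comp (hm _)).aestronglyMeasurable B (.of_forall fun x => hB _))).2.symm

end Limit

/-! ### Effect of the unobserved past -/

section Past

variable {Ω : Type*} [mΩ : MeasurableSpace Ω] {μ : Measure Ω} [IsProbabilityMeasure μ]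
  {Y : ℤ → Ω → ℕ} {lam : NHist → ℝ≥0} {hlam : Measurable lam} {α b : ℕ → ℝ≥0}

lemma momentBdd_map_hist (hY : ∀ t, Measurable (Y t))
    (hmom : ∀ r : ℕ, ∃ C : ℝ≥0, ∀ t : ℤ, ∫⁻ ω, (Y t ω : ℝ≥0∞) ^ r ∂μ ≤ C) :
    MomentBdd fun t : ℤ => μ.map (hist Y t) := fun r => by
  obtain ⟨C, hC⟩ := hmom r
  refine ⟨C, fun t k => ?_⟩
  rw [lintegral_map (measurable_coord_pow k r) (measurable_hist hY t)]
  exact hC _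

lemma ae_adm_hist (hY : ∀ t, Measurable (Y t))
    (hmom : ∀ r : ℕ, ∃ C : ℝ≥0, ∀ t : ℤ, ∫⁻ ω, (Y t ω : ℝ≥0∞) ^ r ∂μ ≤ C) (hb : IsWeight b) :
    ∀ᵐ ω ∂μ, ∀ t, Adm b (hist Y t ω) :=
  ae_all_iff.2 fun t => ae_of_ae_map (measurable_hist hY t).aemeasurable
    ((momentBdd_map_hist hY hmom).ae_adm hb.summable t)

lemma posPart_le (Y : ℤ → Ω → ℕ) (t : ℤ) (ω : Ω) : posPart Y t ω ≤ Y t ω := by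
  unfold posPart; split_ifs <;> simp

lemma adm_hist_posPart (Y : ℤ → Ω → ℕ) (t : ℕ) (ω : Ω) :
    Adm b (hist (posPart Y) ((t : ℤ) + 1) ω) := by
  refine summable_of_ne_finset_zero (s := Finset.range (t + 1)) fun k hk => ?_
  simp only [Finset.mem_range] at hk
  simp [hist, posPart, show ¬ (1 ≤ (t : ℤ) + 1 - k) by omega]

/-- Replacing the unobserved values by zeros changes the sums of a tame function by `o(√n)`. -/
lemma Tame.ae_tendsto_sum_sub_posPart {I : Type*} {h : I → NHist → ℝ} (hh : Tame b h)
    (hY : ∀ t, Measurable (Y t))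
    (hmom : ∀ r : ℕ, ∃ C : ℝ≥0, ∀ t : ℤ, ∫⁻ ω, (Y t ω : ℝ≥0∞) ^ r ∂μ ≤ C) (hb : IsWeight b)
    (i : I) :
    ∀ᵐ ω ∂μ, Tendsto (fun n : ℕ => (√(n : ℝ))⁻¹ * ∑ t ∈ Finset.range n,
      |h i (hist Y ((t : ℤ) + 1) ω) - h i (hist (posPart Y) ((t : ℤ) + 1) ω)|) atTop (𝓝 0) := by
  obtain ⟨C, p, hC, -, h2⟩ := hh
  obtain ⟨M, hM⟩ := (momentBdd_map_hist hY hmom).exists_wd_pow hb.summable (2 * (2 * p))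
  obtain ⟨M2, hM2⟩ := hmom 2
  have hX : ∀ t : ℤ, Measurable fun ω => (1 + wd b (hist Y t ω) 0) ^ (2 * p) := fun t =>
    (((measurable_wd_zero b).comp (measurable_hist hY t)).const_add 1).pow_const _
  have hK : ∀ t s : ℤ, ∫⁻ ω, (1 + wd b (hist Y t ω) 0) ^ (2 * p) * Y s ω ∂μ ≤
      ((M + M2 : ℝ≥0) : ℝ≥0∞) := fun t s => by
    refine (lintegral_mono fun ω => ennreal_mul_le_sq_add_sq _ _).trans ?_
    rw [lintegral_add_left ((hX t).pow_const 2)]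
    push_cast
    refine add_le_add ?_ (hM2 s)
    have := hM t
    rw [lintegral_map (((measurable_wd_zero b).const_add 1).pow_const _)
      (measurable_hist hY t)] at this
    refine le_trans (le_of_eq (lintegral_congr fun ω => ?_)) this
    rw [← pow_mul, mul_comm]
  have hmain := hb.ae_tendsto_inv_sqrt_mul_sum (μ := μ) (K := M + M2)
    (x := fun t ω => (1 + wd b (hist Y ((t : ℤ) + 1) ω) 0) ^ (2 * p) *
      wd b (hist Y ((t : ℤ) + 1) ω) (hist (posPart Y) ((t : ℤ) + 1) ω))
    (fun t => ((hX _).mul (measurable_wd_hist hY b _)).aemeasurable)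
    (fun t => lintegral_mul_wd_le hY hb (hX _) (hK _) t)
  filter_upwards [hmain, ae_adm_hist hY hmom hb] with ω hω hadm
  have hz := hω.2.const_mul C
  rw [mul_zero] at hz
  refine squeeze_zero (fun n => mul_nonneg (by positivity)
    (Finset.sum_nonneg fun t _ => abs_nonneg _)) (fun n => ?_) hz
  rw [mul_left_comm]
  refine mul_le_mul_of_nonneg_left ?_ (inv_nonneg.2 (Real.sqrt_nonneg _))
  rw [Finset.mul_sum]
  refine Finset.sum_le_sum fun t _ => ?_
  have hy := hadm ((t : ℤ) + 1)
  have hy' := adm_hist_posPart (b := b) Y t ω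
  set y := hist Y ((t : ℤ) + 1) ω with hydef
  set y' := hist (posPart Y) ((t : ℤ) + 1) ω with hydef'
  have e1 := wsum_nonneg b y
  have e2 := wsum_nonneg b y'
  have e3 := wdist_nonneg b y y'
  have e4 : wsum b y' ≤ wsum b y := hy'.tsum_le_tsum (fun k => by
    gcongr
    exact posPart_le Y _ ω) hy
  rw [ENNReal.toReal_mul, ENNReal.toReal_pow, ENNReal.toReal_add ENNReal.one_ne_top
    (adm_iff.1 hy), ← hy.ofReal_wsum, ← hy.ofReal_wdist hy', ENNReal.toReal_ofReal e1,
    ENNReal.toReal_ofReal e3, ENNReal.toReal_one, ← mul_assoc]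
  refine (h2 i y y' hy hy').trans ?_
  gcongr ?_ * _
  gcongr ?_ * ?_
  rw [pow_mul, sq]
  gcongr

end Past

/-! ### Central limit theorem -/

section CLT

lemma norm_cexp_sub_taylor_le (u : ℝ) :
    ‖Complex.exp (u * Complex.I) - 1 - u * Complex.I + (u : ℂ) ^ 2 / 2‖ ≤ 4 * |u| ^ 3 := by
  rcases le_total |u| 1 with h | h
  · have h1 := Complex.exp_bound (x := u * Complex.I) (by simpa using h) (n := 3) (by norm_num)
    have e : ∑ m ∈ Finset.range 3, ((u : ℂ) * Complex.I) ^ m / (m.factorial : ℂ) =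
        1 + u * Complex.I - (u : ℂ) ^ 2 / 2 := by
      simp [Finset.sum_range_succ, mul_pow, Nat.factorial]
      ring
    rw [e] at h1
    have e2 : Complex.exp (u * Complex.I) - 1 - u * Complex.I + (u : ℂ) ^ 2 / 2 =
        Complex.exp (u * Complex.I) - (1 + u * Complex.I - (u : ℂ) ^ 2 / 2) := by ring
    rw [e2]
    refine h1.trans ?_
    have : ‖(u : ℂ) * Complex.I‖ = |u| := by simp
    rw [this]
    norm_num [Nat.factorial]
    nlinarith [pow_nonneg (abs_nonneg u) 3]
  · have h1 : ‖Complex.exp (u * Complex.I)‖ = 1 := Complex.norm_exp_ofReal_mul_I u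
    have h2 : ‖(u : ℂ) * Complex.I‖ = |u| := by simp
    have h3 : ‖(u : ℂ) ^ 2 / 2‖ = |u| ^ 2 / 2 := by simp
    calc _ ≤ ‖Complex.exp (u * Complex.I)‖ + ‖(1 : ℂ)‖ + ‖(u : ℂ) * Complex.I‖ +
          ‖(u : ℂ) ^ 2 / 2‖ :=
          (norm_add_le _ _).trans (add_le_add ((norm_sub_le _ _).trans (add_le_add
            (norm_sub_le _ _) le_rfl)) le_rfl)
      _ = 2 + |u| + |u| ^ 2 / 2 := by rw [h1, h2, h3, norm_one]; ring
      _ ≤ _ := by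
        have h4 : |u| ≤ |u| ^ 3 := le_self_pow₀ h (by norm_num)
        have h5 : |u| ^ 2 ≤ |u| ^ 3 := pow_le_pow_right₀ h (by norm_num)
        linarith

/-- The logarithm of the conditional characteristic function of the centred Poisson variable. -/
def cgf (lam : NHist → ℝ≥0) (y : NHist) (u : ℝ) : ℂ :=
  (lam y : ℂ) * (Complex.exp (u * Complex.I) - 1 - u * Complex.I)

/-- The exponential martingale of the sum of the centred values with predictable weights `u`. -/
def expMart (lam : NHist → ℝ≥0) (u : ℕ → NHist → ℝ) : ℕ → NHist → ℂ
  | 0, _ => 1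
  | t + 1, y => expMart lam u t (tl y) *
      Complex.exp (u t (tl y) * ((y 0 : ℝ) - (lam (tl y) : ℝ) : ℝ) * Complex.I -
        cgf lam (tl y) (u t (tl y)))

/-- The predictable quadratic variation of the sum of the centred values with weights `u`. -/
def quadVar (lam : NHist → ℝ≥0) (u : ℕ → NHist → ℝ) : ℕ → NHist → ℝ
  | 0, _ => 0
  | t + 1, y => quadVar lam u t (tl y) + lam (tl y) * u t (tl y) ^ 2

/-- The sum of `V` over the last `t + 1` histories. -/
def cumul (V : NHist → ℝ) : ℕ → NHist → ℝ
  | 0, y => V y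
  | t + 1, y => cumul V t (tl y) + V y

variable {lam : NHist → ℝ≥0} {u : ℕ → NHist → ℝ}

lemma measurable_cgf (hlam : Measurable lam) {v : NHist → ℝ} (hv : Measurable v) :
    Measurable fun y => cgf lam y (v y) := by
  unfold cgf
  fun_prop

lemma measurable_expMart (hlam : Measurable lam) (hu : ∀ t, Measurable (u t)) (t : ℕ) :
    Measurable (expMart lam u t) := by
  induction t with
  | zero => exact measurable_const
  | succ t ih =>
    have h0 : Measurable fun y : NHist => ((y 0 : ℕ) : ℝ) :=
      measurable_from_nat.comp (measurable_pi_apply 0)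
    have h1 := (hu t).comp measurable_tl
    have h2 : Measurable fun y : NHist => (lam (tl y) : ℝ) :=
      (hlam.comp measurable_tl).coe_nnreal_real
    have h3 := (measurable_cgf hlam (hu t)).comp measurable_tl
    have h4 : Measurable fun y : NHist =>
        (((u t (tl y) * ((y 0 : ℝ) - (lam (tl y) : ℝ)) : ℝ) : ℂ)) :=
      Complex.measurable_ofReal.comp (h1.mul (h0.sub h2))
    have h5 : Measurable fun y : NHist =>
        Complex.exp ((u t (tl y) : ℂ) * ((y 0 : ℝ) - (lam (tl y) : ℝ) : ℝ) * Complex.I -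
        cgf lam (tl y) (u t (tl y))) := by
      refine Complex.measurable_exp.comp (Measurable.sub ?_ h3)
      simpa using h4.mul_const Complex.I
    exact (ih.comp measurable_tl).mul h5

lemma measurable_cumul {V : NHist → ℝ} (hV : Measurable V) (t : ℕ) : Measurable (cumul V t) := by
  induction t with
  | zero => exact hV
  | succ t ih => exact (ih.comp measurable_tl).add hV

lemma norm_expMart_le (t : ℕ) : ∀ y, ‖expMart lam u t y‖ ≤ Real.exp (quadVar lam u t y / 2) := by
  induction t with
  | zero => intro y; simp [expMart, quadVar]
  | succ t ih =>
    intro y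
    have h1 : ‖Complex.exp (u t (tl y) * ((y 0 : ℝ) - (lam (tl y) : ℝ) : ℝ) * Complex.I -
        cgf lam (tl y) (u t (tl y)))‖ ≤ Real.exp (lam (tl y) * u t (tl y) ^ 2 / 2) := by
      rw [Complex.norm_exp]
      refine Real.exp_le_exp.2 ?_
      have h2 := Real.one_sub_sq_div_two_le_cos (x := u t (tl y))
      have h3 : (0 : ℝ) ≤ lam (tl y) := NNReal.coe_nonneg _
      have h4 : ((u t (tl y) : ℂ) * (((y 0 : ℝ) - (lam (tl y) : ℝ) : ℝ) : ℂ) * Complex.I -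
          cgf lam (tl y) (u t (tl y))).re = lam (tl y) * (1 - Real.cos (u t (tl y))) := by
        rw [← Complex.ofReal_mul, cgf, Complex.exp_mul_I]
        rw [← Complex.ofReal_cos, ← Complex.ofReal_sin]
        simp only [Complex.sub_re, Complex.mul_re, Complex.mul_im, Complex.add_re, Complex.ofReal_re,
          Complex.ofReal_im, Complex.I_re, Complex.I_im, Complex.one_re, Complex.sub_im]
        simp
        ring
      rw [h4]
      nlinarith
    rw [expMart, norm_mul, quadVar, add_div, Real.exp_add]
    exact mul_le_mul (ih _) h1 (norm_nonneg _) (Real.exp_nonneg _)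

variable {Ω : Type*} [mΩ : MeasurableSpace Ω] {μ : Measure Ω} [IsProbabilityMeasure μ]
  {Y : ℤ → Ω → ℕ} {hlam : Measurable lam}

lemma integral_expMart (hY : ∀ t, Measurable (Y t)) (hlaw : ∀ t : ℕ, CondLaw μ Y lam hlam t)
    (hu : ∀ t, Measurable (u t)) {K : ℝ} (hK : ∀ t y, quadVar lam u t y ≤ K) (t : ℕ) :
    ∫ ω, expMart lam u t (hist Y t ω) ∂μ = 1 := by
  have hm := measurable_expMart hlam hu
  have hint : ∀ t : ℕ, Integrable (fun ω => expMart lam u t (hist Y t ω)) μ := fun t =>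
    Integrable.of_bound ((hm t).comp (measurable_hist hY t)).aestronglyMeasurable
      (Real.exp (K / 2)) (.of_forall fun ω => (norm_expMart_le t _).trans
        (Real.exp_le_exp.2 (by linarith [hK t (hist Y t ω)])))
  induction t with
  | zero => simp [expMart]
  | succ t ih =>
    have h1 := hint (t + 1)
    push_cast at h1 ⊢
    rw [((hlaw t).integral hY (hm (t + 1)).stronglyMeasurable h1).2, ← ih]
    refine integral_congr_ae (.of_forall fun ω => ?_)
    simp only [expMart, tl_cons, cons_zero]
    generalize hist Y t ω = y
    rw [integral_const_mul]
    have e : ∀ k : ℕ, Complex.exp (u t y * ((k : ℝ) - (lam y : ℝ) : ℝ) * Complex.I -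
        cgf lam y (u t y)) = Complex.exp (u t y * k * Complex.I) *
          Complex.exp (-(lam y * (Complex.exp (u t y * Complex.I) - 1))) := fun k => by
      rw [← Complex.exp_add, cgf]
      congr 1
      push_cast
      ring
    simp_rw [e]
    rw [integral_mul_const, integral_cexp_poisson, ← Complex.exp_add]
    simp

variable {ξ : NHist → ℝ}

/-- The weights `ξ / √n`, set to zero once the quadratic variation exceeds `K`. -/
def stopped (lam : NHist → ℝ≥0) (ξ : NHist → ℝ) (K : ℝ) (n t : ℕ) (y : NHist) : ℝ :=
  if cumul (fun y => lam y * ξ y ^ 2) t y ≤ n * K then (√(n : ℝ))⁻¹ * ξ y else 0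

lemma measurable_stopped (hlam : Measurable lam) (hξ : Measurable ξ) (K : ℝ) (n t : ℕ) :
    Measurable (stopped lam ξ K n t) := by
  have hV : Measurable fun y => (lam y : ℝ) * ξ y ^ 2 := hlam.coe_nnreal_real.mul (hξ.pow_const 2)
  exact Measurable.ite (measurableSet_le (measurable_cumul hV t) measurable_const)
    (hξ.const_mul _) measurable_const

lemma quadVar_stopped_le {K : ℝ} (hK : 0 ≤ K) (n t : ℕ) :
    ∀ y, quadVar lam (stopped lam ξ K n) t y ≤ K := by
  set V : NHist → ℝ := fun y => lam y * ξ y ^ 2 with hV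
  have hV0 : ∀ y, 0 ≤ V y := fun y => by positivity
  -- as long as the weights do not vanish, the quadratic variation is at most `cumul V / n`
  have key : ∀ t y, quadVar lam (stopped lam ξ K n) (t + 1) y ≤ K ∧
      quadVar lam (stopped lam ξ K n) (t + 1) y ≤ (n : ℝ)⁻¹ * cumul V t (tl y) := by
    have hstep : ∀ t y q, q ≤ K → q + V y * (n : ℝ)⁻¹ ≤ (n : ℝ)⁻¹ * cumul V t y →
        q ≤ (n : ℝ)⁻¹ * cumul V t y →
        q + lam y * stopped lam ξ K n t y ^ 2 ≤ K ∧
        q + lam y * stopped lam ξ K n t y ^ 2 ≤ (n : ℝ)⁻¹ * cumul V t y := by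
      intro t y q h1 h2 h3
      unfold stopped
      split_ifs with hc
      · have e : (lam y : ℝ) * ((√(n : ℝ))⁻¹ * ξ y) ^ 2 = V y * (n : ℝ)⁻¹ := by
          rw [mul_pow, inv_pow, Real.sq_sqrt (Nat.cast_nonneg n), hV]
          ring
        rw [e]
        refine ⟨h2.trans ?_, h2⟩
        rcases Nat.eq_zero_or_pos n with rfl | hn
        · simpa using hK
        · rw [inv_mul_le_iff₀ (by positivity)]
          exact hc
      · simpa using ⟨h1, h3⟩
    intro t
    induction t with
    | zero =>
      intro y
      refine hstep 0 (tl y) _ hK ?_ ?_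
      · simp only [quadVar, cumul]; linarith
      · simp only [quadVar, cumul]
        have := hV0 (tl y)
        positivity
    | succ t ih =>
      intro y
      have h1 := ih (tl y)
      have h2 : (0 : ℝ) ≤ (n : ℝ)⁻¹ := by positivity
      have h3 := hV0 (tl y)
      refine hstep (t + 1) (tl y) _ h1.1 ?_ ?_
      · simp only [cumul, mul_add]
        linarith [h1.2]
      · simp only [cumul, mul_add]
        nlinarith [h1.2, mul_nonneg h2 h3]
  cases t with
  | zero => intro y; exact hK
  | succ t => exact fun y => (key t y).1

lemma cumul_hist (V : NHist → ℝ) (t : ℕ) (ω : Ω) :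
    cumul V t (hist Y t ω) = ∑ s ∈ Finset.range (t + 1), V (hist Y s ω) := by
  induction t with
  | zero => simp [cumul]
  | succ t ih =>
    rw [Finset.sum_range_succ, ← ih, cumul]
    push_cast
    rw [tl_hist_succ]

lemma expMart_hist (u : ℕ → NHist → ℝ) (n : ℕ) (ω : Ω) : expMart lam u n (hist Y n ω) =
    Complex.exp (∑ t ∈ Finset.range n, (u t (hist Y t ω) *
      ((Y ((t : ℤ) + 1) ω : ℝ) - (lam (hist Y t ω) : ℝ) : ℝ) * Complex.I -
        cgf lam (hist Y t ω) (u t (hist Y t ω)))) := by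
  induction n with
  | zero => simp [expMart]
  | succ n ih =>
    rw [Finset.sum_range_succ, Complex.exp_add, ← ih, expMart]
    push_cast
    rw [tl_hist_succ, hist_succ, cons_zero]

/-- Central limit theorem for the score, in terms of characteristic functions: the exponential
martingale stopped before its quadratic variation becomes large is bounded with expectation one,
and asymptotically it is the exponential of the normalized sum times a constant. -/
theorem tendsto_charFun_sum (hY : ∀ t, Measurable (Y t)) (hlaw : ∀ t : ℕ, CondLaw μ Y lam hlam t)
    (hξ : Measurable ξ) {σ2 L : ℝ}
    (hV : ∀ᵐ ω ∂μ, Tendsto (fun n : ℕ => (n : ℝ)⁻¹ * ∑ t ∈ Finset.range n,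
      (lam (hist Y t ω) : ℝ) * ξ (hist Y t ω) ^ 2) atTop (𝓝 σ2))
    (hL : ∀ᵐ ω ∂μ, Tendsto (fun n : ℕ => (n : ℝ)⁻¹ * ∑ t ∈ Finset.range n,
      (lam (hist Y t ω) : ℝ) * |ξ (hist Y t ω)| ^ 3) atTop (𝓝 L)) :
    Tendsto (fun n : ℕ => ∫ ω, Complex.exp (((√(n : ℝ))⁻¹ * ∑ t ∈ Finset.range n,
      ξ (hist Y t ω) * ((Y ((t : ℤ) + 1) ω : ℝ) - lam (hist Y t ω)) : ℝ) * Complex.I) ∂μ) atTop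
      (𝓝 (Complex.exp (-(σ2 / 2 : ℝ)))) := by
  have hσ : 0 ≤ σ2 := by
    obtain ⟨ω, hω⟩ := hV.exists
    refine ge_of_tendsto hω (.of_forall fun n => mul_nonneg (by positivity)
      (Finset.sum_nonneg fun t _ => by positivity))
  set K : ℝ := σ2 + 1 with hK
  have hK0 : 0 ≤ K := by positivity
  set u := fun n : ℕ => stopped lam ξ K n with hu
  have hum : ∀ n t, Measurable (u n t) := fun n t => measurable_stopped hlam hξ K n t
  have hq : ∀ n t y, quadVar lam (u n) t y ≤ K := fun n t => quadVar_stopped_le hK0 n t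
  set S : ℕ → Ω → ℝ := fun n ω => (√(n : ℝ))⁻¹ * ∑ t ∈ Finset.range n,
      ξ (hist Y t ω) * ((Y ((t : ℤ) + 1) ω : ℝ) - lam (hist Y t ω)) with hS
  have hSm : ∀ n, Measurable (S n) := fun n => by
    refine (Finset.measurable_sum _ fun t _ => ?_).const_mul _
    exact (hξ.comp (measurable_hist hY _)).mul ((measurable_from_nat.comp (hY _)).sub
      (hlam.comp (measurable_hist hY _)).coe_nnreal_real)
  set Z : ℕ → Ω → ℂ := fun n ω => expMart lam (u n) n (hist Y n ω) with hZ
  have hZm : ∀ n, Measurable (Z n) := fun n =>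
    (measurable_expMart hlam (hum n) n).comp (measurable_hist hY n)
  have hZb : ∀ n ω, ‖Z n ω‖ ≤ Real.exp (K / 2) := fun n ω =>
    (norm_expMart_le n _).trans (Real.exp_le_exp.2 (by linarith [hq n n (hist Y n ω)]))
  have hZI : ∀ n, Integrable (Z n) μ := fun n =>
    Integrable.of_bound (hZm n).aestronglyMeasurable _ (.of_forall (hZb n))
  have hEm : ∀ n, Measurable fun ω => Complex.exp ((S n ω : ℂ) * Complex.I) := fun n =>
    Complex.measurable_exp.comp ((Complex.measurable_ofReal.comp (hSm n)).mul_const _)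
  have hEI : ∀ n, Integrable (fun ω => Complex.exp ((S n ω : ℂ) * Complex.I)) μ := fun n =>
    Integrable.of_bound (hEm n).aestronglyMeasurable 1
      (.of_forall fun ω => (Complex.norm_exp_ofReal_mul_I _).le)
  set c : ℂ := Complex.exp (-(σ2 / 2 : ℝ)) with hc
  have hdiff : Tendsto (fun n => ∫ ω, (Complex.exp ((S n ω : ℂ) * Complex.I) - c * Z n ω) ∂μ)
      atTop (𝓝 (∫ _, (0 : ℂ) ∂μ)) := by
    refine tendsto_integral_of_dominated_convergence (fun _ => 1 + ‖c‖ * Real.exp (K / 2))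
      (fun n => ((hEm n).sub ((hZm n).const_mul c)).aestronglyMeasurable) (integrable_const _)
      (fun n => .of_forall fun ω => ?_) ?_
    · refine (norm_sub_le _ _).trans (add_le_add (Complex.norm_exp_ofReal_mul_I _).le ?_)
      rw [norm_mul]
      exact mul_le_mul_of_nonneg_left (hZb n ω) (norm_nonneg _)
    · filter_upwards [hV, hL] with ω hVω hLω
      set ψ : ℕ → ℂ := fun n => ∑ t ∈ Finset.range n,
        cgf lam (hist Y t ω) ((√(n : ℝ))⁻¹ * ξ (hist Y t ω)) with hψ
      -- eventually the weights have not been stopped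
      have hev : ∀ᶠ n : ℕ in atTop, Z n ω = Complex.exp ((S n ω : ℂ) * Complex.I - ψ n) := by
        filter_upwards [hVω.eventually_lt_const (show σ2 < K by linarith), eventually_gt_atTop 0]
          with n hn hn0
        have hn' : ∑ t ∈ Finset.range n, (lam (hist Y t ω) : ℝ) * ξ (hist Y t ω) ^ 2 ≤ n * K := by
          rw [inv_mul_lt_iff₀ (by positivity)] at hn
          exact hn.le
        have hun : ∀ t ∈ Finset.range n, u n t (hist Y t ω) = (√(n : ℝ))⁻¹ * ξ (hist Y t ω) := by
          intro t ht
          simp only [hu, stopped]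
          rw [if_pos]
          rw [cumul_hist]
          refine (Finset.sum_le_sum_of_subset_of_nonneg ?_ fun _ _ _ => by positivity).trans hn'
          exact Finset.range_subset_range.2 (Finset.mem_range.1 ht)
        simp only [hZ]
        rw [expMart_hist, Finset.sum_sub_distrib]
        congr 2
        · simp only [hS]
          push_cast
          rw [Finset.mul_sum, Finset.sum_mul]
          refine Finset.sum_congr rfl fun t ht => ?_
          rw [hun t ht]
          push_cast
          ring
        · exact Finset.sum_congr rfl fun t ht => by rw [hun t ht]
      have hψlim : Tendsto ψ atTop (𝓝 (-(σ2 / 2 : ℝ))) := by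
        set q : ℕ → ℝ := fun n => (n : ℝ)⁻¹ * ∑ t ∈ Finset.range n,
          (lam (hist Y t ω) : ℝ) * ξ (hist Y t ω) ^ 2 with hqd
        have h1 : Tendsto (fun n => (-((q n / 2 : ℝ) : ℂ))) atTop (𝓝 (-(σ2 / 2 : ℝ))) :=
          ((Complex.continuous_ofReal.tendsto _).comp (hVω.div_const 2)).neg
        have h2 : Tendsto (fun n => ψ n - (-((q n / 2 : ℝ) : ℂ))) atTop (𝓝 0) := by
          have hz : Tendsto (fun n : ℕ => 4 * ((√(n : ℝ))⁻¹ * ((n : ℝ)⁻¹ * ∑ t ∈ Finset.range n,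
              (lam (hist Y t ω) : ℝ) * |ξ (hist Y t ω)| ^ 3))) atTop (𝓝 (4 * (0 * L))) := by
            refine Tendsto.const_mul _ (Tendsto.mul ?_ hLω)
            exact (Real.tendsto_sqrt_atTop.comp tendsto_natCast_atTop_atTop).inv_tendsto_atTop
          rw [zero_mul, mul_zero] at hz
          refine squeeze_zero_norm (fun n => ?_) hz
          have e : ψ n - (-((q n / 2 : ℝ) : ℂ)) = ∑ t ∈ Finset.range n, (lam (hist Y t ω) : ℂ) *
              (Complex.exp (((√(n : ℝ))⁻¹ * ξ (hist Y t ω) : ℝ) * Complex.I) - 1 -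
                ((√(n : ℝ))⁻¹ * ξ (hist Y t ω) : ℝ) * Complex.I +
                (((√(n : ℝ))⁻¹ * ξ (hist Y t ω) : ℝ) : ℂ) ^ 2 / 2) := by
            have hsq : ∀ x : ℝ, ((√(n : ℝ))⁻¹ * x) ^ 2 = (n : ℝ)⁻¹ * x ^ 2 := fun x => by
              rw [mul_pow, inv_pow, Real.sq_sqrt (Nat.cast_nonneg n)]
            simp only [mul_add, Finset.sum_add_distrib, sub_neg_eq_add]
            congr 1
            rw [hqd]
            simp_rw [← Complex.ofReal_pow, hsq]
            push_cast
            rw [Finset.mul_sum, Finset.sum_div]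
            refine Finset.sum_congr rfl fun t _ => ?_
            ring
          rw [e, Finset.mul_sum, Finset.mul_sum, Finset.mul_sum]
          refine (norm_sum_le _ _).trans (Finset.sum_le_sum fun t _ => ?_)
          rw [norm_mul]
          have h3 : ‖((lam (hist Y t ω) : ℝ) : ℂ)‖ = (lam (hist Y t ω) : ℝ) := by
            rw [Complex.norm_real, Real.norm_of_nonneg (NNReal.coe_nonneg _)]
          rw [h3]
          refine (mul_le_mul_of_nonneg_left (norm_cexp_sub_taylor_le _) (by positivity)).trans
            (le_of_eq ?_)
          rw [abs_mul, abs_of_nonneg (by positivity : 0 ≤ (√(n : ℝ))⁻¹), mul_pow]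
          have h4 : (√(n : ℝ))⁻¹ ^ 3 = (√(n : ℝ))⁻¹ * (n : ℝ)⁻¹ := by
            rw [pow_succ', inv_pow, Real.sq_sqrt (Nat.cast_nonneg n)]
          rw [h4]
          ring
        have := h2.add h1
        simpa using this
      have h5 : Tendsto (fun n => ‖Complex.exp (ψ n) - c‖ * Real.exp (K / 2)) atTop (𝓝 0) := by
        have := (((Complex.continuous_exp.tendsto _).comp hψlim).sub_const c).norm.mul_const
          (Real.exp (K / 2))
        simpa [hc] using this
      refine squeeze_zero_norm' ?_ h5
      filter_upwards [hev] with n hn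
      have e : Complex.exp ((S n ω : ℂ) * Complex.I) = Complex.exp (ψ n) * Z n ω := by
        rw [hn, ← Complex.exp_add]
        congr 1
        ring
      rw [e, ← sub_mul, norm_mul]
      exact mul_le_mul_of_nonneg_left (hZb n ω) (norm_nonneg _)
  have hfin : ∀ n, ∫ ω, (Complex.exp ((S n ω : ℂ) * Complex.I) - c * Z n ω) ∂μ =
      ∫ ω, Complex.exp ((S n ω : ℂ) * Complex.I) ∂μ - c := fun n => by
    rw [integral_sub (hEI n) ((hZI n).const_mul c), integral_const_mul,
      integral_expMart hY hlaw (hum n) (hq n), mul_one]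
  simp_rw [hfin, integral_zero] at hdiff
  have hres := hdiff.add_const c
  simp only [sub_add_cancel, zero_add] at hres
  exact hres

end CLT

/-! ### The support of an invariant law -/

section Support

variable {lam : NHist → ℝ≥0} {b : ℕ → ℝ≥0} {π : Measure NHist} [IsProbabilityMeasure π]

/-- A property that holds almost surely for an invariant law is almost surely preserved when any
value is put in front of the history, since Poisson laws charge every integer. -/
lemma IsInvariant.ae_cons (hπ : IsInvariant lam π) (hlam : Measurable lam) (hpos : ∀ y, 0 < lam y)
    {P : NHist → Prop} (hP : ∀ᵐ z ∂π, P z) (k : ℕ) : ∀ᵐ z ∂π, P (cons k z) := by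
  set A := toMeasurable π {z | ¬ P z} with hA
  have hAm : MeasurableSet A := measurableSet_toMeasurable _ _
  have hA0 : π A = 0 := by rw [hA, measure_toMeasurable]; exact hP
  set g : NHist → ℝ := A.indicator 1 with hg
  have hgm : Measurable g := measurable_one.indicator hAm
  have hgb : ∀ y, |g y| ≤ 1 := fun y => by
    simp only [hg, Set.indicator]; split_ifs <;> simp
  have hg0 : ∀ y, 0 ≤ g y := fun y => Set.indicator_nonneg (fun _ _ => zero_le_one) y
  have h1 := hπ g 1 hgm hgb
  have hT0 : 0 ≤ trans lam g := fun y => integral_nonneg fun k => hg0 _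
  rw [hg, integral_indicator_one hAm, measureReal_def, hA0, ENNReal.toReal_zero, ← hg,
    integral_eq_zero_iff_of_nonneg hT0
      (Integrable.of_bound (measurable_trans hlam hgm).aestronglyMeasurable 1
        (.of_forall fun y => abs_trans_le hgb y))] at h1
  filter_upwards [h1] with z hz
  simp only [trans, Pi.zero_apply] at hz
  rw [integral_eq_zero_iff_of_nonneg (fun k => hg0 _)
    (Integrable.of_bound .of_discrete 1 (.of_forall fun k => hgb _))] at hz
  have h2 : cons k z ∉ A := fun hmem => by
    have h3 : poissonMeasure (lam z) {k} = 0 := by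
      refine measure_mono_null ?_ hz
      rintro _ rfl
      simp [hg, hmem]
    rw [poissonMeasure_singleton] at h3
    have h4 : (0 : ℝ) < Real.exp (-lam z) * lam z ^ k / k.factorial := by
      have : (0 : ℝ) < lam z := hpos z
      positivity
    exact h4.not_ge (ENNReal.ofReal_eq_zero.1 h3)
  by_contra hc
  exact h2 (subset_toMeasurable _ _ hc)

/-- The history with the first `N` values of `y`, continued by `z`. -/
def graft (N : ℕ) (y z : NHist) : NHist := fun k => if k < N then y k else z (k - N)

lemma graft_succ (N : ℕ) (y z : NHist) : graft (N + 1) y z = graft N y (cons (y N) z) := by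
  funext k
  unfold graft
  rcases lt_trichotomy k N with h | h | h
  · rw [if_pos (by omega), if_pos h]
  · subst h; simp
  · rw [if_neg (by omega), if_neg (by omega)]
    obtain ⟨m, rfl⟩ : ∃ m, k = N + m + 1 := ⟨k - N - 1, by omega⟩
    rw [show N + m + 1 - N = m + 1 by omega, cons_succ]
    congr 1
    omega

lemma tendsto_wdist_graft (hb : IsWeight b) {y z : NHist} (hy : Adm b y) (hz : Adm b z) :
    (∀ N, Adm b (graft N y z) ∧ wsum b (graft N y z) ≤ wsum b y + wsum b z) ∧
      Tendsto (fun N => wdist b y (graft N y z)) atTop (𝓝 0) := by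
  have hbz : ∀ N k, (b (k + N) : ℝ) * z k ≤ b k * z k := fun N k => by
    gcongr
    exact_mod_cast hb.anti (Nat.le_add_right k N)
  have hzN : ∀ N, Summable fun k => (b (k + N) : ℝ) * z k := fun N =>
    Summable.of_nonneg_of_le (fun k => by positivity) (hbz N) hz
  -- the two parts of the grafted history
  have hpt : ∀ N k, (b k : ℝ) * graft N y z k ≤ b k * y k +
      (if k < N then 0 else (b k : ℝ) * z (k - N)) := fun N k => by
    unfold graft
    split_ifs
    · simp
    · have : (0 : ℝ) ≤ b k * y k := by positivity
      linarith
  have hshift : ∀ N, HasSum (fun k => if k < N then 0 else (b k : ℝ) * z (k - N))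
      (∑' k, (b (k + N) : ℝ) * z k) := fun N => by
    rw [← hasSum_nat_add_iff' N]
    rw [Finset.sum_eq_zero fun k hk => if_pos (Finset.mem_range.1 hk), sub_zero]
    have e : (fun k => if k + N < N then 0 else (b (k + N) : ℝ) * z (k + N - N)) =
        fun k => (b (k + N) : ℝ) * z k := by
      funext k
      rw [if_neg (by omega), Nat.add_sub_cancel]
    rw [e]
    exact (hzN N).hasSum
  have hadm : ∀ N, Adm b (graft N y z) := fun N =>
    Summable.of_nonneg_of_le (fun k => by positivity) (hpt N) (hy.add (hshift N).summable)
  refine ⟨fun N => ⟨hadm N, ?_⟩, ?_⟩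
  · refine ((hadm N).tsum_le_tsum (hpt N) (hy.add (hshift N).summable)).trans ?_
    rw [hy.tsum_add (hshift N).summable, (hshift N).tsum_eq]
    exact add_le_add le_rfl ((hzN N).tsum_le_tsum (hbz N) hz)
  · have h1 : Tendsto (fun N => ∑' k, (b (k + N) : ℝ) * z k) atTop (𝓝 (∑' _k : ℕ, (0 : ℝ))) := by
      refine tendsto_tsum_of_dominated_convergence hz (fun k => ?_) (.of_forall fun N k => ?_)
      · have h2 : Tendsto (fun N => (b (k + N) : ℝ)) atTop (𝓝 0) :=
          (NNReal.summable_coe.2 hb.summable).tendsto_atTop_zero.comp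
            (tendsto_atTop_mono (fun N => Nat.le_add_left N k) tendsto_id)
        simpa using h2.mul_const (z k : ℝ)
      · rw [Real.norm_of_nonneg (by positivity)]
        exact hbz N k
    have h2 : Tendsto (fun N => ∑' k, if k < N then 0 else (b k : ℝ) * y k) atTop
        (𝓝 (∑' _k : ℕ, (0 : ℝ))) := by
      refine tendsto_tsum_of_dominated_convergence hy (fun k => ?_) (.of_forall fun N k => ?_)
      · refine tendsto_const_nhds.congr' ?_
        filter_upwards [eventually_gt_atTop k] with N hN
        rw [if_pos hN]
      · split_ifs
        · rw [norm_zero]; positivity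
        · rw [Real.norm_of_nonneg (by positivity)]
    rw [tsum_zero] at h1 h2
    have h3 := h2.add h1
    rw [add_zero] at h3
    refine squeeze_zero (fun N => wdist_nonneg _ _ _) (fun N => ?_) h3
    have hs : Summable fun k => if k < N then 0 else (b k : ℝ) * y k :=
      Summable.of_nonneg_of_le (fun k => by split_ifs <;> positivity)
        (fun k => by
          split_ifs
          · positivity
          · exact le_rfl) hy
    rw [← (hshift N).tsum_eq, ← hs.tsum_add (hshift N).summable]
    refine (hy.summable_dist (hadm N)).tsum_le_tsum (fun k => ?_) (hs.add (hshift N).summable)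
    unfold graft
    split_ifs
    · simp
    · rw [← mul_add]
      gcongr
      rw [abs_le]
      constructor <;> linarith [(Nat.cast_nonneg (y k) : (0 : ℝ) ≤ _),
        (Nat.cast_nonneg (z (k - N)) : (0 : ℝ) ≤ _)]

/-- A tame function that vanishes almost surely for an invariant law vanishes on all admissible
histories: every finite pattern may precede a typical history, and remote values hardly matter. -/
lemma Tame.eq_zero_of_ae {I : Type*} {h : I → NHist → ℝ} (hh : Tame b h) (hb : IsWeight b)
    (hπ : IsInvariant lam π) (hlam : Measurable lam) (hpos : ∀ y, 0 < lam y)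
    (hmom : MomentBdd fun _ : Unit => π) (i : I) (h0 : ∀ᵐ z ∂π, h i z = 0) {y : NHist}
    (hy : Adm b y) : h i y = 0 := by
  have hg : ∀ N, ∀ᵐ z ∂π, h i (graft N y z) = 0 := fun N => by
    induction N with
    | zero =>
      filter_upwards [h0] with z hz
      exact hz
    | succ N ih =>
      filter_upwards [hπ.ae_cons hlam hpos ih (y N)] with z hz
      rwa [graft_succ]
  obtain ⟨z, hz, hzadm⟩ := ((ae_all_iff.2 hg).and (hmom.ae_adm hb.summable ())).exists
  obtain ⟨C, p, hC, -, h2⟩ := hh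
  obtain ⟨hadm, hlim⟩ := tendsto_wdist_graft hb hy hzadm
  have h3 := hlim.const_mul (C * ((1 + wsum b y) * (1 + (wsum b y + wsum b z))) ^ p)
  rw [mul_zero] at h3
  have h4 : |h i y| ≤ 0 := by
    refine ge_of_tendsto h3 (.of_forall fun N => ?_)
    have h5 := h2 i y _ hy (hadm N).1
    rw [hz N, sub_zero] at h5
    refine h5.trans ?_
    have e1 := wsum_nonneg b y
    have e2 := wsum_nonneg b (graft N y z)
    have e3 := wdist_nonneg b y (graft N y z)
    gcongr
    exact (hadm N).2
  exact abs_nonpos_iff.1 h4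

end Support

/-! ### Regular models -/

/-- The weights `(k + 1)^{-γ}`. -/
def powWeight (γ : ℝ) (k : ℕ) : ℝ≥0 := ((k : ℝ≥0) + 1) ^ (-γ)

lemma coe_powWeight (γ : ℝ) (k : ℕ) : (powWeight γ k : ℝ) = ((k : ℝ) + 1) ^ (-γ) := by
  simp [powWeight]

lemma isWeight_powWeight {γ : ℝ} (hγ : 3 / 2 < γ) : IsWeight (powWeight γ) where
  pos k := NNReal.rpow_pos (by positivity)
  zero := by simp [powWeight]
  anti := fun k l hkl => by
    rw [← NNReal.coe_le_coe, coe_powWeight, coe_powWeight]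
    exact Real.rpow_le_rpow_of_nonpos (by positivity) (by gcongr) (by linarith)
  shift := by
    refine ⟨2 ^ γ, fun k => ?_⟩
    rw [powWeight, powWeight, NNReal.rpow_neg, NNReal.rpow_neg, ← div_eq_mul_inv,
      le_div_iff₀ (NNReal.rpow_pos (by positivity)), ← div_eq_inv_mul, ← NNReal.div_rpow]
    refine NNReal.rpow_le_rpow ?_ (by linarith)
    rw [div_le_iff₀ (by positivity)]
    push_cast
    have : (0 : ℝ≥0) ≤ k := zero_le
    calc (k : ℝ≥0) + 1 + 1 ≤ k + 1 + 1 + k := le_self_add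
      _ = _ := by ring
  summable := by
    rw [← NNReal.summable_coe]
    simp_rw [coe_powWeight]
    have := (summable_nat_add_iff 1).2 (Real.summable_nat_rpow (p := -γ).2 (by linarith))
    exact_mod_cast this
  summable_sqrt := by
    have h1 := (summable_nat_add_iff 1).2
      (Real.summable_nat_rpow (p := -γ + 1 / 2).2 (by linarith))
    refine h1.congr fun k => ?_
    rw [coe_powWeight, Real.sqrt_eq_rpow, ← Real.rpow_add (by positivity)]
    push_cast
    rfl

lemma HasDecay.exists_le {α : ℕ → ℝ} {γ : ℝ} (h : HasDecay α γ) :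
    ∃ C : ℝ≥0, ∀ k, α k ≤ C * powWeight γ k := by
  have h1 : ∀ k : ℕ, (0 : ℝ) < ((k : ℝ) + 1) ^ (-γ) := fun k => by positivity
  obtain ⟨C, hC⟩ := (Asymptotics.isBigO_nat_atTop_iff fun k hk => absurd hk (h1 k).ne').1 h.2
  refine ⟨C.toNNReal, fun k => ?_⟩
  have h2 := hC k
  rw [Real.norm_of_nonneg (h.1 k), Real.norm_of_nonneg (h1 k).le] at h2
  rw [coe_powWeight]
  refine h2.trans ?_
  gcongr
  exact Real.le_coe_toNNReal C

lemma LipBound.le_wdist {α : ℕ → ℝ} {N : Hist → Hist → ℝ} {b : ℕ → ℝ≥0} {C : ℝ≥0}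
    (h : LipBound α N) (hα0 : ∀ k, 0 ≤ α k) (hC : ∀ k, α k ≤ C * b k) {y y' : NHist}
    (hy : Adm b y) (hy' : Adm b y') : N (toHist y) (toHist y') ≤ C * wdist b y y' := by
  have hle : ∀ k, α k * |(y k : ℝ) - y' k| ≤ C * (b k * |(y k : ℝ) - y' k|) := fun k => by
    rw [← mul_assoc]
    exact mul_le_mul_of_nonneg_right (hC k) (abs_nonneg _)
  have hs := (hy.summable_dist hy').mul_left (C : ℝ)
  have hs' : Summable fun k => α k * |(y k : ℝ) - y' k| :=
    Summable.of_nonneg_of_le (fun k => mul_nonneg (hα0 k) (abs_nonneg _)) hle hs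
  refine (h (toHist y) (toHist y') (by simpa [toHist] using hs')).trans ?_
  rw [wdist, ← tsum_mul_left]
  refine le_trans (le_of_eq ?_) (hs'.tsum_le_tsum hle hs)
  simp [toHist]

lemma toHist_zero : toHist 0 = 0 := by
  funext k; simp [toHist]

variable {d : ℕ}

/-- The hypotheses on the parametric family, in the form used below: the conditional means and
their first two derivatives are tame families of functions of the history. -/
structure IsRegular (f : MeanFamily d) (Θ : Set (Param d)) (b : ℕ → ℝ≥0) (c : ℝ) : Prop where
  compact : IsCompact Θ
  measurable : ∀ θ ∈ Θ, Measurable (f θ)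
  contDiffOn : ∀ y, ContDiffOn ℝ 2 (fun θ => f θ y) Θ
  weight : IsWeight b
  pos : 0 < c
  lower : ∀ θ ∈ Θ, ∀ y, c ≤ f θ y
  tame : Tame b fun (θ : Θ) y => f θ (toHist y)
  tame₁ : ∀ i, Tame b fun (θ : interior Θ) y => partialDeriv f Θ i θ (toHist y)
  tame₂ : ∀ i j, Tame b fun (θ : interior Θ) y => partialDeriv₂ f Θ i j θ (toHist y)

lemma tame_of_condA0 {f : MeanFamily d} {Θ : Set (Param d)} {α : ℕ → ℝ} {γ : ℝ}
    (h : CondA0 f Θ α) (hα : HasDecay α γ) :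
    Tame (powWeight γ) fun (θ : Θ) y => f θ (toHist y) := by
  obtain ⟨⟨M, hM⟩, h0, -, -, hL⟩ := h
  obtain ⟨C, hC⟩ := hα.exists_le
  refine Tame.of_modulus (C := max M C) (fun θ => ?_) (fun θ y y' hy hy' => ?_)
    (C.coe_nonneg.trans (le_max_right _ _))
  · rw [toHist_zero]
    exact (hM θ θ.2).trans (le_max_left _ _)
  · exact ((hL θ θ.2).le_wdist h0 hC hy hy').trans
      (mul_le_mul_of_nonneg_right (le_max_right _ _) (wdist_nonneg _ _ _))

lemma tame_of_condA1 {f : MeanFamily d} {Θ : Set (Param d)} {α : ℕ → ℝ} {γ : ℝ}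
    (h : CondA1 f Θ α) (hα : HasDecay α γ) (i : Fin d) :
    Tame (powWeight γ) fun (θ : interior Θ) y => partialDeriv f Θ i θ (toHist y) := by
  obtain ⟨⟨M, hM⟩, h0, -, hL⟩ := h
  obtain ⟨C, hC⟩ := hα.exists_le
  refine Tame.of_modulus (C := max M C) (fun θ => ?_) (fun θ y y' hy hy' => ?_)
    (C.coe_nonneg.trans (le_max_right _ _))
  · rw [toHist_zero]
    refine le_trans ?_ ((hM θ θ.2).trans (le_max_left _ _))
    exact Finset.single_le_sum (f := fun i => |partialDeriv f Θ i θ 0|) (fun i _ => abs_nonneg _)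
      (Finset.mem_univ i)
  · refine le_trans ?_ (((hL θ θ.2).le_wdist h0 hC hy hy').trans
      (mul_le_mul_of_nonneg_right (le_max_right _ _) (wdist_nonneg _ _ _)))
    exact Finset.single_le_sum (f := fun i => |partialDeriv f Θ i θ (toHist y) -
      partialDeriv f Θ i θ (toHist y')|) (fun i _ => abs_nonneg _) (Finset.mem_univ i)

lemma tame_of_condA2 {f : MeanFamily d} {Θ : Set (Param d)} {α : ℕ → ℝ} {γ : ℝ}
    (h : CondA2 f Θ α) (hα : HasDecay α γ) (i j : Fin d) :
    Tame (powWeight γ) fun (θ : interior Θ) y => partialDeriv₂ f Θ i j θ (toHist y) := by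
  obtain ⟨⟨M, hM⟩, h0, -, hL⟩ := h
  obtain ⟨C, hC⟩ := hα.exists_le
  have hsingle : ∀ g : Fin d → Fin d → ℝ, |g i j| ≤ ∑ i, ∑ j, |g i j| := fun g =>
    (Finset.single_le_sum (f := fun j => |g i j|) (fun j _ => abs_nonneg _)
      (Finset.mem_univ j)).trans (Finset.single_le_sum (f := fun i => ∑ j, |g i j|)
        (fun i _ => Finset.sum_nonneg fun j _ => abs_nonneg _) (Finset.mem_univ i))
  refine Tame.of_modulus (C := max M C) (fun θ => ?_) (fun θ y y' hy hy' => ?_)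
    (C.coe_nonneg.trans (le_max_right _ _))
  · rw [toHist_zero]
    exact (hsingle fun i j => partialDeriv₂ f Θ i j θ 0).trans
      ((hM θ θ.2).trans (le_max_left _ _))
  · exact (hsingle fun i j => partialDeriv₂ f Θ i j θ (toHist y) -
      partialDeriv₂ f Θ i j θ (toHist y')).trans (((hL θ θ.2).le_wdist h0 hC hy hy').trans
      (mul_le_mul_of_nonneg_right (le_max_right _ _) (wdist_nonneg _ _ _)))

/-- The conditional mean as a function of the integer-valued history. -/
def meanOf (f : MeanFamily d) (θ : Param d) (y : NHist) : ℝ≥0 := (f θ (toHist y)).toNNReal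

lemma contractive_meanOf {f : MeanFamily d} {Θ : Set (Param d)} {α : ℕ → ℝ}
    (h : CondA0 f Θ α) {θ : Param d} (hθ : θ ∈ Θ) :
    Contractive (meanOf f θ) fun k => (α k).toNNReal := by
  obtain ⟨-, h0, hs, h1, hL⟩ := h
  have hsn : Summable fun k => (α k).toNNReal := by
    rw [← NNReal.summable_coe]
    exact hs.congr fun k => (Real.coe_toNNReal _ (h0 k)).symm
  refine ⟨hsn, ?_, fun y y' => ?_⟩
  · rw [← NNReal.coe_lt_coe, NNReal.coe_tsum]
    refine lt_of_eq_of_lt (tsum_congr fun k => ?_) h1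
    exact Real.coe_toNNReal _ (h0 k)
  · have e : ∀ k, (((α k).toNNReal : ℝ≥0) : ℝ≥0∞) * edist (y k) (y' k) =
        ENNReal.ofReal (α k * |(y k : ℝ) - y' k|) := fun k => by
      rw [ENNReal.ofReal_mul (h0 k), edist_dist, Nat.dist_eq]
      rfl
    by_cases hsum : Summable fun k => α k * |(y k : ℝ) - y' k|
    · have h2 := hL θ hθ (toHist y) (toHist y') (by simpa [toHist] using hsum)
      have h3 : edist (meanOf f θ y) (meanOf f θ y') ≤
          ENNReal.ofReal |f θ (toHist y) - f θ (toHist y')| := by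
        rw [edist_dist, NNReal.dist_eq, meanOf, meanOf, Real.coe_toNNReal', Real.coe_toNNReal']
        exact ENNReal.ofReal_le_ofReal (abs_max_sub_max_le_abs _ _ _)
      refine h3.trans ((ENNReal.ofReal_le_ofReal h2).trans (le_of_eq ?_))
      rw [ENNReal.ofReal_tsum_of_nonneg (fun k => mul_nonneg (h0 k) (abs_nonneg _))
        (by simpa [toHist] using hsum), wd]
      refine tsum_congr fun k => ?_
      rw [e]
      simp [toHist]
    · have : wd (fun k => (α k).toNNReal) y y' = ∞ := by
        rw [wd]
        simp_rw [e]
        by_contra hne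
        refine hsum ?_
        have := ENNReal.summable_toReal hne
        refine this.congr fun k => ?_
        rw [ENNReal.toReal_ofReal (mul_nonneg (h0 k) (abs_nonneg _))]
      rw [this]
      exact le_top

lemma clm_eq_sum (L : Param d →L[ℝ] ℝ) :
    L = ∑ j, L (EuclideanSpace.single j 1) • (EuclideanSpace.proj j : Param d →L[ℝ] ℝ) := by
  ext v
  conv_lhs => rw [← (EuclideanSpace.basisFun (Fin d) ℝ).sum_repr v]
  simp [mul_comm]

namespace IsRegular

variable {f : MeanFamily d} {Θ : Set (Param d)} {b : ℕ → ℝ≥0} {c : ℝ} (hf : IsRegular f Θ b c)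
include hf

lemma coe_meanOf {θ : Param d} (hθ : θ ∈ Θ) (y : NHist) : (meanOf f θ y : ℝ) = f θ (toHist y) :=
  Real.coe_toNNReal _ (hf.pos.le.trans (hf.lower θ hθ _))

lemma f_pos {θ : Param d} (hθ : θ ∈ Θ) (y : Hist) : 0 < f θ y := hf.pos.trans_le (hf.lower θ hθ y)

lemma meanOf_pos {θ : Param d} (hθ : θ ∈ Θ) (y : NHist) : 0 < meanOf f θ y :=
  Real.toNNReal_pos.2 (hf.f_pos hθ _)

lemma measurable_meanOf {θ : Param d} (hθ : θ ∈ Θ) : Measurable (meanOf f θ) :=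
  ((hf.measurable θ hθ).comp measurable_toHist).real_toNNReal

/-! ### Derivatives with respect to the parameter -/

lemma contDiffAt_mean {θ : Param d} (hθ : θ ∈ interior Θ) (y : Hist) :
    ContDiffAt ℝ 2 (fun ϑ => f ϑ y) θ :=
  (hf.contDiffOn y).contDiffAt (mem_interior_iff_mem_nhds.1 hθ)

lemma contDiffAt_partialDeriv {θ : Param d} (hθ : θ ∈ interior Θ) (i : Fin d) (y : Hist) :
    ContDiffAt ℝ 1 (fun ϑ => partialDeriv f Θ i ϑ y) θ := by
  have h1 : ContDiffAt ℝ 1 (fun ϑ => fderiv ℝ (fun ϑ => f ϑ y) ϑ (EuclideanSpace.single i 1)) θ :=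
    ((hf.contDiffAt_mean hθ y).fderiv_right (m := 1) (by norm_num)).clm_apply contDiffAt_const
  refine h1.congr_of_eventuallyEq ?_
  filter_upwards [isOpen_interior.mem_nhds hθ] with ϑ hϑ
  rw [partialDeriv, fderivWithin_of_mem_nhds (mem_interior_iff_mem_nhds.1 hϑ)]

lemma hasFDerivAt_mean {θ : Param d} (hθ : θ ∈ interior Θ) (y : Hist) :
    HasFDerivAt (fun ϑ => f ϑ y)
      (∑ j, partialDeriv f Θ j θ y • (EuclideanSpace.proj j : Param d →L[ℝ] ℝ)) θ := by
  have h1 := ((hf.contDiffAt_mean hθ y).differentiableAt (by norm_num)).hasFDerivAt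
  rw [clm_eq_sum (fderiv ℝ (fun ϑ => f ϑ y) θ)] at h1
  simp only [partialDeriv]
  rwa [fderivWithin_of_mem_nhds (mem_interior_iff_mem_nhds.1 hθ)]

lemma hasFDerivAt_partialDeriv {θ : Param d} (hθ : θ ∈ interior Θ) (i : Fin d) (y : Hist) :
    HasFDerivAt (fun ϑ => partialDeriv f Θ i ϑ y)
      (∑ j, partialDeriv₂ f Θ i j θ y • (EuclideanSpace.proj j : Param d →L[ℝ] ℝ)) θ := by
  have h1 := ((hf.contDiffAt_partialDeriv hθ i y).differentiableAt (by norm_num)).hasFDerivAt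
  rw [clm_eq_sum (fderiv ℝ (fun ϑ => partialDeriv f Θ i ϑ y) θ)] at h1
  simp only [partialDeriv₂]
  rwa [fderivWithin_of_mem_nhds (mem_interior_iff_mem_nhds.1 hθ)]

lemma continuousAt_partialDeriv₂ {θ : Param d} (hθ : θ ∈ interior Θ) (i j : Fin d) (y : Hist) :
    ContinuousAt (fun ϑ => partialDeriv₂ f Θ i j ϑ y) θ := by
  have h1 : ContDiffAt ℝ 0 (fun ϑ => fderiv ℝ (fun ϑ => partialDeriv f Θ i ϑ y) ϑ
      (EuclideanSpace.single j 1)) θ :=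
    ((hf.contDiffAt_partialDeriv hθ i y).fderiv_right (m := 0) (by norm_num)).clm_apply
      contDiffAt_const
  refine h1.continuousAt.congr ?_
  filter_upwards [isOpen_interior.mem_nhds hθ] with ϑ hϑ
  rw [partialDeriv₂, fderivWithin_of_mem_nhds (mem_interior_iff_mem_nhds.1 hϑ)]

/-- At interior parameters the derivative is a limit of difference quotients along a sequence. -/
lemma measurable_partialDeriv {θ : Param d} (hθ : θ ∈ interior Θ) (i : Fin d) :
    Measurable (partialDeriv f Θ i θ) := by
  set e : Param d := EuclideanSpace.single i 1 with he
  have hline : Tendsto (fun n : ℕ => ((n : ℝ) + 1)⁻¹) atTop (𝓝[≠] 0) := by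
    refine tendsto_nhdsWithin_iff.2 ⟨?_, .of_forall fun n => ?_⟩
    · simpa using (tendsto_add_atTop_iff_nat 1).2 (tendsto_inv_atTop_nhds_zero_nat (𝕜 := ℝ))
    · simp only [Set.mem_compl_iff, Set.mem_singleton_iff]
      positivity
  have hmem : ∀ᶠ n : ℕ in atTop, θ + ((n : ℝ) + 1)⁻¹ • e ∈ Θ := by
    have h1 : Tendsto (fun n : ℕ => θ + ((n : ℝ) + 1)⁻¹ • e) atTop (𝓝 (θ + (0 : ℝ) • e)) :=
      ((hline.mono_right nhdsWithin_le_nhds).smul_const e).const_add θ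
    rw [zero_smul, add_zero] at h1
    exact h1.eventually (mem_interior_iff_mem_nhds.1 hθ)
  obtain ⟨N, hN⟩ := eventually_atTop.1 hmem
  refine measurable_of_tendsto_metrizable (f := fun n y => (((n + N : ℕ) : ℝ) + 1) *
    (f (θ + (((n + N : ℕ) : ℝ) + 1)⁻¹ • e) y - f θ y)) (fun n => ?_) ?_
  · exact ((hf.measurable _ (hN _ (Nat.le_add_left N n))).sub
      (hf.measurable θ (interior_subset hθ))).const_mul _
  · rw [tendsto_pi_nhds]
    intro y
    have h1 := ((hf.hasFDerivAt_mean hθ y).hasLineDerivAt e).tendsto_slope_zero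
    have h2 := (h1.comp hline).comp (tendsto_add_atTop_nat N)
    have h3 : (∑ j, partialDeriv f Θ j θ y • (EuclideanSpace.proj j : Param d →L[ℝ] ℝ)) e =
        partialDeriv f Θ i θ y := by
      simp [he]
    rw [h3] at h2
    refine h2.congr fun n => ?_
    simp

end IsRegular

/-! ### Parametric limits -/

section Parametric

variable {d : ℕ} {b : ℕ → ℝ≥0} {ι : Type*} {ν : ι → Measure NHist} {π : Measure NHist}
  [IsProbabilityMeasure π]

lemma Tame.tendsto_integral_param {S : Set (Param d)} {h : Param d → NHist → ℝ}
    (hh : Tame b fun (θ : S) => h θ) (hb : Summable b) (hπ : MomentBdd fun _ : Unit => π)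
    {θ₀ : Param d} (hcont : ∀ y, ContinuousWithinAt (fun θ => h θ y) S θ₀) :
    Tendsto (fun θ => ∫ y, h θ y ∂π) (𝓝[S] θ₀) (𝓝 (∫ y, h θ₀ y ∂π)) := by
  have hh' := hh
  obtain ⟨C, p, hC, h1, -⟩ := hh
  obtain ⟨M, hM⟩ := hπ.exists_wd_pow hb p
  have hmem : ∀ᶠ θ in 𝓝[S] θ₀, θ ∈ S := eventually_mem_nhdsWithin
  have hbound : Tame b fun (_ : Unit) y => C * (1 + wsum b y) ^ p := by
    refine ((Tame.add (Tame.const (c := fun _ => 1) (C := 1) fun _ => by simp)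
      (Tame.of_modulus (h := fun _ => wsum b) (C := 1) (fun _ => by simp [wsum_zero])
        (fun _ y y' hy hy' => ?_) zero_le_one)).pow p).const_mul C
    have e : wsum b y - wsum b y' = ∑' k, (b k : ℝ) * ((y k : ℝ) - y' k) := by
      rw [wsum, wsum, ← hy.tsum_sub hy']
      exact tsum_congr fun k => by ring
    rw [e, one_mul, ← Real.norm_eq_abs]
    refine (norm_tsum_le_tsum_norm ?_).trans (le_of_eq ?_)
    · simpa [abs_mul] using hy.summable_dist hy'
    · simp [wdist]
  refine tendsto_integral_filter_of_dominated_convergence (fun y => C * (1 + wsum b y) ^ p) ?_ ?_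
    (hbound.integrable hb hπ () ()) (.of_forall hcont)
  · filter_upwards [hmem] with θ hθ using hh'.aestronglyMeasurable hb hπ ⟨θ, hθ⟩ ()
  · filter_upwards [hmem] with θ hθ
    filter_upwards [hπ.ae_adm hb ()] with y hy using h1 ⟨θ, hθ⟩ y hy

/-- Joint limit of the integrals of a parametric family in the measure and in the parameter. -/
lemma Tame.tendsto_integral_prod {S : Set (Param d)} {h : Param d → NHist → ℝ}
    (hh : Tame b fun (θ : S) => h θ) (hb : Summable b) [∀ n, IsProbabilityMeasure (ν n)]
    (hν : MomentBdd ν) (hπ : MomentBdd fun _ : Unit => π) {l : Filter ι}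
    (hconv : ∀ (N : ℕ) (p : Fin N → ℕ), Tendsto (fun n => (ν n).real (cyl N p)) l
      (𝓝 (π.real (cyl N p)))) {θ₀ : Param d}
    (hcont : ∀ y, ContinuousWithinAt (fun θ => h θ y) S θ₀) :
    Tendsto (fun q : ι × Param d => ∫ y, h q.2 y ∂(ν q.1)) (l ×ˢ 𝓝[S] θ₀)
      (𝓝 (∫ y, h θ₀ y ∂π)) := by
  rw [Metric.tendsto_nhds]
  intro ε hε
  have h1 := hh.eventually_abs_integral_sub_le hb hν hπ hconv (half_pos hε)
  have h2 := Metric.tendsto_nhds.1 (hh.tendsto_integral_param hb hπ hcont) (ε / 2) (half_pos hε)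
  filter_upwards [h1.prod_mk (h2.and eventually_mem_nhdsWithin)] with q hq
  have e1 := hq.1 ⟨q.2, hq.2.2⟩
  have e2 := hq.2.1
  rw [← Real.dist_eq] at e1
  linarith [dist_triangle (∫ y, h q.2 y ∂(ν q.1)) (∫ y, h q.2 y ∂π) (∫ y, h θ₀ y ∂π)]

/-- Maximizers of functions converging uniformly on a compact set converge to the unique maximizer
of the limit. -/
lemma tendsto_of_isMaxOn {X : Type*} [TopologicalSpace X] {K : Set X} (hK : IsCompact K)
    {L : X → ℝ} {Ln : ι → X → ℝ} {l : Filter ι} (hL : ContinuousOn L K) {x₀ : X} (hx₀ : x₀ ∈ K)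
    (huniq : ∀ x ∈ K, L x₀ ≤ L x → x = x₀)
    (hunif : ∀ ε > 0, ∀ᶠ n in l, ∀ x ∈ K, |Ln n x - L x| ≤ ε) {x : ι → X}
    (hx : ∀ᶠ n in l, x n ∈ K ∧ IsMaxOn (Ln n) K (x n)) : Tendsto x l (𝓝 x₀) := by
  rw [tendsto_nhds]
  intro U hU hxU
  have hKU : IsCompact (K \ U) := hK.diff hU
  rcases (K \ U).eq_empty_or_nonempty with he | hne
  · filter_upwards [hx] with n hn
    by_contra hc
    have : x n ∈ K \ U := ⟨hn.1, hc⟩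
    rw [he] at this
    exact this
  · obtain ⟨x₁, hx₁, hmax⟩ := hKU.exists_isMaxOn hne (hL.mono Set.sdiff_subset)
    have hlt : L x₁ < L x₀ := by
      by_contra hc
      have := huniq x₁ hx₁.1 (not_lt.1 hc)
      exact hx₁.2 (this ▸ hxU)
    filter_upwards [hx, hunif ((L x₀ - L x₁) / 3) (by linarith)] with n hn hu
    by_contra hc
    have e1 : L (x n) ≤ L x₁ := hmax ⟨hn.1, hc⟩
    have e2 : Ln n x₀ ≤ Ln n (x n) := hn.2 hx₀
    have e3 := abs_le.1 (hu x₀ hx₀)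
    have e4 := abs_le.1 (hu (x n) hn.1)
    linarith [e3.1, e4.2]

end Parametric

/-! ### Log-likelihood, score and Hessian of one observation -/

section Likelihood

variable {d : ℕ}

/-- The conditional log-likelihood of the first value of a history given the others. -/
def logDensity (f : MeanFamily d) (θ : Param d) (z : NHist) : ℝ :=
  (z 0 : ℝ) * Real.log (f θ (toHist (tl z))) - f θ (toHist (tl z))

/-- The components of the gradient of `logDensity`. -/
def score (f : MeanFamily d) (Θ : Set (Param d)) (i : Fin d) (θ : Param d) (z : NHist) : ℝ :=
  ((z 0 : ℝ) * (f θ (toHist (tl z)))⁻¹ - 1) * partialDeriv f Θ i θ (toHist (tl z))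

/-- The entries of the Hessian of `logDensity`. -/
def hessian (f : MeanFamily d) (Θ : Set (Param d)) (i j : Fin d) (θ : Param d) (z : NHist) : ℝ :=
  ((z 0 : ℝ) * (f θ (toHist (tl z)))⁻¹ - 1) * partialDeriv₂ f Θ i j θ (toHist (tl z)) -
    (z 0 : ℝ) * ((f θ (toHist (tl z)))⁻¹ ^ 2 *
      (partialDeriv f Θ i θ (toHist (tl z)) * partialDeriv f Θ j θ (toHist (tl z))))

/-- The entries of the conditional Fisher information of the next value of a history. -/
def info (f : MeanFamily d) (Θ : Set (Param d)) (i j : Fin d) (θ : Param d) (y : NHist) : ℝ :=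
  (f θ (toHist y))⁻¹ * partialDeriv f Θ i θ (toHist y) * partialDeriv f Θ j θ (toHist y)

variable {f : MeanFamily d} {Θ : Set (Param d)} {b : ℕ → ℝ≥0} {c : ℝ}

namespace IsRegular

variable (hf : IsRegular f Θ b c)
include hf

lemma tame_interior : Tame b fun (θ : interior Θ) y => f θ (toHist y) :=
  hf.tame.reindex fun θ : interior Θ => (⟨θ, interior_subset θ.2⟩ : Θ)

lemma tame_logDensity : Tame b fun (θ : Θ) => logDensity f θ :=
  ((Tame.eval_zero hf.weight).mul ((hf.tame.log hf.pos fun θ _ _ => hf.lower θ θ.2 _).comp_tl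
    hf.weight)).sub (hf.tame.comp_tl hf.weight)

lemma tame_inv : Tame b fun (θ : interior Θ) y => (f θ (toHist y))⁻¹ :=
  hf.tame_interior.inv hf.pos fun θ _ _ => hf.lower θ (interior_subset θ.2) _

lemma tame_factor : Tame b fun (θ : interior Θ) (z : NHist) =>
    (z 0 : ℝ) * (f θ (toHist (tl z)))⁻¹ - 1 :=
  ((Tame.eval_zero hf.weight).mul (hf.tame_inv.comp_tl hf.weight)).sub
    (Tame.const (c := fun _ => 1) (C := 1) fun _ => by simp)

lemma tame_score (i : Fin d) : Tame b fun (θ : interior Θ) => score f Θ i θ :=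
  hf.tame_factor.mul ((hf.tame₁ i).comp_tl hf.weight)

lemma tame_info (i j : Fin d) : Tame b fun (θ : interior Θ) => info f Θ i j θ :=
  (hf.tame_inv.mul (hf.tame₁ i)).mul (hf.tame₁ j)

lemma tame_hessian (i j : Fin d) : Tame b fun (θ : interior Θ) => hessian f Θ i j θ :=
  (hf.tame_factor.mul ((hf.tame₂ i j).comp_tl hf.weight)).sub ((Tame.eval_zero hf.weight).mul
    (((hf.tame_inv.pow 2).mul ((hf.tame₁ i).mul (hf.tame₁ j))).comp_tl hf.weight))

lemma hasFDerivAt_logDensity {θ : Param d} (hθ : θ ∈ interior Θ) (z : NHist) :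
    HasFDerivAt (fun ϑ => logDensity f ϑ z)
      (∑ j, score f Θ j θ z • (EuclideanSpace.proj j : Param d →L[ℝ] ℝ)) θ := by
  have h1 := hf.hasFDerivAt_mean hθ (toHist (tl z))
  have h2 := ((h1.log (hf.f_pos (interior_subset hθ) _).ne').const_mul (z 0 : ℝ)).sub h1
  refine h2.congr_fderiv ?_
  rw [Finset.smul_sum, Finset.smul_sum, ← Finset.sum_sub_distrib]
  refine Finset.sum_congr rfl fun j _ => ?_
  rw [smul_smul, smul_smul, ← sub_smul, score]
  congr 1
  ring

lemma hasFDerivAt_score {θ : Param d} (hθ : θ ∈ interior Θ) (i : Fin d) (z : NHist) :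
    HasFDerivAt (fun ϑ => score f Θ i ϑ z)
      (∑ j, hessian f Θ i j θ z • (EuclideanSpace.proj j : Param d →L[ℝ] ℝ)) θ := by
  have h0 := hf.f_pos (interior_subset hθ) (toHist (tl z))
  have h1 := hf.hasFDerivAt_mean hθ (toHist (tl z))
  have h2 := hf.hasFDerivAt_partialDeriv hθ i (toHist (tl z))
  have h3 := (((hasDerivAt_inv h0.ne').comp_hasFDerivAt θ h1).const_mul (z 0 : ℝ)).sub_const 1
  refine (h3.mul h2).congr_fderiv ?_
  simp only [Finset.smul_sum]
  rw [← Finset.sum_add_distrib]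
  refine Finset.sum_congr rfl fun j _ => ?_
  simp only [smul_smul]
  rw [← add_smul, hessian]
  congr 1
  simp only [Function.comp]
  field_simp
  ring

lemma continuousAt_hessian {θ : Param d} (hθ : θ ∈ interior Θ) (i j : Fin d) (z : NHist) :
    ContinuousAt (fun ϑ => hessian f Θ i j ϑ z) θ := by
  have h0 := hf.f_pos (interior_subset hθ) (toHist (tl z))
  have h1 := ((hf.hasFDerivAt_mean hθ (toHist (tl z))).continuousAt).inv₀ h0.ne'
  have h2 := fun i => (hf.hasFDerivAt_partialDeriv hθ i (toHist (tl z))).continuousAt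
  have h3 := hf.continuousAt_partialDeriv₂ hθ i j (toHist (tl z))
  exact (((h1.const_mul _).sub_const 1).mul h3).sub
    (((h1.pow 2).mul ((h2 i).mul (h2 j))).const_mul _)

lemma continuousAt_info {θ : Param d} (hθ : θ ∈ interior Θ) (i j : Fin d) (y : NHist) :
    ContinuousAt (fun ϑ => info f Θ i j ϑ y) θ := by
  have h0 := hf.f_pos (interior_subset hθ) (toHist y)
  have h1 := ((hf.hasFDerivAt_mean hθ (toHist y)).continuousAt).inv₀ h0.ne'
  have h2 := fun i => (hf.hasFDerivAt_partialDeriv hθ i (toHist y)).continuousAt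
  exact (h1.mul (h2 i)).mul (h2 j)

lemma continuousOn_logDensity (z : NHist) : ContinuousOn (fun ϑ => logDensity f ϑ z) Θ := by
  have h1 := (hf.contDiffOn (toHist (tl z))).continuousOn
  exact ((h1.log fun θ hθ => (hf.f_pos hθ _).ne').const_mul _).sub h1

end IsRegular

end Likelihood

/-! ### Stationary laws of the history -/

section Stationary

variable {d : ℕ} {b : ℕ → ℝ≥0}

/-- The law `π` of the history of a stationary solution. -/
structure IsStationaryHist (lam : NHist → ℝ≥0) (b : ℕ → ℝ≥0) (π : Measure NHist) : Prop where
  prob : IsProbabilityMeasure π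
  moments : MomentBdd fun _ : Unit => π
  invariant : IsInvariant lam π
  /-- The first value of the history has conditional mean `lam` given the others. -/
  centred : ∀ g : NHist → ℝ, Tame b (fun _ : Unit => g) →
    ∫ z, ((z 0 : ℝ) - lam (tl z)) * g (tl z) ∂π = 0

lemma isStationaryHist_map {lam : NHist → ℝ≥0} {hlam : Measurable lam} {Q : Measure (ℤ → ℕ)}
    [IsProbabilityMeasure Q] (hQ : Q.map shift = Q) (hb : IsWeight b)
    (hmom : ∀ r : ℕ, ∃ C : ℝ≥0, ∀ t, ∫⁻ x, (coord t x : ℝ≥0∞) ^ r ∂Q ≤ C)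
    (hlaw : ∀ t, CondLaw Q coord lam hlam t)
    (htame : Tame b fun (_ : Unit) y => (lam y : ℝ)) (t : ℤ) :
    IsStationaryHist lam b (Q.map (hist coord t)) where
  prob := Measure.isProbabilityMeasure_map (measurable_hist measurable_coord t).aemeasurable
  moments r := by
    obtain ⟨C, hC⟩ := momentBdd_map_hist measurable_coord hmom r
    exact ⟨C, fun _ k => hC t k⟩
  invariant := (hlaw t).isInvariant hQ
  centred g hg := by
    have hm := fun t => measurable_hist measurable_coord t
    have hmb := momentBdd_map_hist (μ := Q) measurable_coord hmom
    rw [← map_hist_coord_succ hQ t]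
    -- a measurable modification of `g`
    set g' := {y | Adm b y}.indicator g with hg'
    have hg'm : Measurable g' := hg.measurable_indicator ()
    have hΦt : Tame b fun (_ : Unit) (z : NHist) => ((z 0 : ℝ) - lam (tl z)) * g (tl z) :=
      ((Tame.eval_zero hb).sub (htame.comp_tl hb)).mul (hg.comp_tl hb)
    have hΦm : Measurable fun z : NHist => ((z 0 : ℝ) - lam (tl z)) * g' (tl z) :=
      ((measurable_from_nat.comp (measurable_pi_apply 0)).sub
        (hlam.comp measurable_tl).coe_nnreal_real).mul (hg'm.comp measurable_tl)
    have hae : (fun z : NHist => ((z 0 : ℝ) - lam (tl z)) * g' (tl z)) =ᵐ[Q.map (hist coord (t + 1))]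
        fun z => ((z 0 : ℝ) - lam (tl z)) * g (tl z) := by
      filter_upwards [hmb.ae_adm hb.summable (t + 1)] with z hz
      have : Adm b (tl z) := hz.tl hb
      simp [hg', this]
    rw [← integral_congr_ae hae, integral_map (hm _).aemeasurable hΦm.aestronglyMeasurable]
    have hint : Integrable (fun z : NHist => ((z 0 : ℝ) - lam (tl z)) * g' (tl z))
        (Q.map (hist coord (t + 1))) :=
      (hΦt.integrable hb.summable hmb () (t + 1)).congr hae.symm
    rw [integrable_map_measure hΦm.aestronglyMeasurable (hm _).aemeasurable] at hint
    rw [((hlaw t).integral measurable_coord hΦm.stronglyMeasurable hint).2]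
    refine integral_eq_zero_of_ae (.of_forall fun x => ?_)
    simp only [cons_zero, tl_cons, Pi.zero_apply]
    rw [integral_mul_const, integral_sub (integrable_poisson_id _) (integrable_const _),
      integral_poisson_id]
    simp

variable {f : MeanFamily d} {Θ : Set (Param d)} {c : ℝ} {θ₀ : Param d} {π : Measure NHist}

lemma adm_cons (hb : IsWeight b) {y : NHist} (hy : Adm b y) (m : ℕ) : Adm b (cons m y) := by
  refine (summable_nat_add_iff 1).1 (Summable.of_nonneg_of_le (fun k => by positivity)
    (fun k => ?_) hy)
  rw [cons_succ]
  gcongr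
  exact_mod_cast hb.anti (Nat.le_succ k)

namespace IsRegular

variable (hf : IsRegular f Θ b c)
include hf

lemma tame_meanOf {θ : Param d} (hθ : θ ∈ Θ) : Tame b fun (_ : Unit) y => (meanOf f θ y : ℝ) := by
  simp_rw [hf.coe_meanOf hθ]
  exact hf.tame.reindex fun _ : Unit => (⟨θ, hθ⟩ : Θ)

lemma integral_hessian (hθ : θ₀ ∈ interior Θ) (hπ : IsStationaryHist (meanOf f θ₀) b π)
    (i j : Fin d) :
    ∫ z, hessian f Θ i j θ₀ z ∂π = - ∫ z, info f Θ i j θ₀ (tl z) ∂π := by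
  have hθ' := interior_subset hθ
  have := hπ.prob
  set g : NHist → ℝ := fun y => (f θ₀ (toHist y))⁻¹ * partialDeriv₂ f Θ i j θ₀ (toHist y) -
    (f θ₀ (toHist y))⁻¹ ^ 2 * (partialDeriv f Θ i θ₀ (toHist y) *
      partialDeriv f Θ j θ₀ (toHist y)) with hg
  have hgt : Tame b fun _ : Unit => g :=
    ((hf.tame_inv.mul (hf.tame₂ i j)).sub ((hf.tame_inv.pow 2).mul
      ((hf.tame₁ i).mul (hf.tame₁ j)))).reindex fun _ : Unit => (⟨θ₀, hθ⟩ : interior Θ)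
  have e : ∀ z, hessian f Θ i j θ₀ z = ((z 0 : ℝ) - meanOf f θ₀ (tl z)) * g (tl z) -
      info f Θ i j θ₀ (tl z) := fun z => by
    have := (hf.f_pos hθ' (toHist (tl z))).ne'
    rw [hf.coe_meanOf hθ']
    simp only [hessian, info, hg]
    field_simp
    ring
  have hi1 : Integrable (fun z : NHist => ((z 0 : ℝ) - meanOf f θ₀ (tl z)) * g (tl z)) π :=
    Tame.integrable (I := Unit) (ν := fun _ : Unit => π) hf.weight.summable
      (((Tame.eval_zero hf.weight).sub ((hf.tame_meanOf hθ').comp_tl hf.weight)).mul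
        (hgt.comp_tl hf.weight)) hπ.moments () ()
  have hi2 : Integrable (fun z => info f Θ i j θ₀ (tl z)) π :=
    Tame.integrable (ν := fun _ : Unit => π) hf.weight.summable
      ((hf.tame_info i j).comp_tl hf.weight) hπ.moments ⟨θ₀, hθ⟩ ()
  simp_rw [e]
  rw [integral_sub hi1 hi2, hπ.centred g hgt, zero_sub]

/-- The limiting log-likelihood has a unique maximum at the true parameter. -/
lemma eq_of_integral_logDensity_le (hθ₀ : θ₀ ∈ Θ) (hπ : IsStationaryHist (meanOf f θ₀) b π)
    (hid : ∀ θ ∈ Θ, (∀ y, Adm b y → f θ (toHist y) = f θ₀ (toHist y)) → θ = θ₀)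
    {θ : Param d} (hθ : θ ∈ Θ)
    (hle : ∫ z, logDensity f θ₀ z ∂π ≤ ∫ z, logDensity f θ z ∂π) : θ = θ₀ := by
  have := hπ.prob
  have hb := hf.weight
  set u : NHist → ℝ := fun y => f θ₀ (toHist y) with hu
  set v : NHist → ℝ := fun y => f θ (toHist y) with hv
  have hu0 : ∀ y, 0 < u y := fun y => hf.f_pos hθ₀ _
  have hv0 : ∀ y, 0 < v y := fun y => hf.f_pos hθ _
  have hut : Tame b fun _ : Unit => u := hf.tame.reindex fun _ : Unit => (⟨θ₀, hθ₀⟩ : Θ)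
  have hvt : Tame b fun _ : Unit => v := hf.tame.reindex fun _ : Unit => (⟨θ, hθ⟩ : Θ)
  have hult : Tame b fun (_ : Unit) y => Real.log (u y) :=
    hut.log hf.pos fun _ y _ => hf.lower θ₀ hθ₀ _
  have hvlt : Tame b fun (_ : Unit) y => Real.log (v y) :=
    hvt.log hf.pos fun _ y _ => hf.lower θ hθ _
  set g : NHist → ℝ := fun y => Real.log (u y) - Real.log (v y) with hg
  have hgt : Tame b fun _ : Unit => g := hult.sub hvlt
  -- the conditional Kullback–Leibler divergence
  set k : NHist → ℝ := fun y => u y * g y - u y + v y with hk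
  have hkt : Tame b fun _ : Unit => k := ((hut.mul hgt).sub hut).add hvt
  have hk0 : ∀ y, 0 ≤ k y ∧ (k y = 0 → v y = u y) := fun y => by
    have e : k y = u y * (v y / u y - 1 - Real.log (v y / u y)) := by
      rw [Real.log_div (hv0 y).ne' (hu0 y).ne']
      have := (hu0 y).ne'
      simp only [hk, hg]
      field_simp
      ring
    have hpos : 0 < v y / u y := div_pos (hv0 y) (hu0 y)
    constructor
    · rw [e]
      refine mul_nonneg (hu0 y).le ?_
      linarith [Real.log_le_sub_one_of_pos hpos]
    · intro h0
      by_contra hne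
      have h1 : v y / u y ≠ 1 := fun h => hne ((div_eq_one_iff_eq (hu0 y).ne').1 h)
      have h2 := Real.log_lt_sub_one_of_pos hpos h1
      have h3 : 0 < k y := by
        rw [e]
        exact mul_pos (hu0 y) (by linarith)
      exact h3.ne' h0
  have hInt : ∀ {h : NHist → ℝ}, Tame b (fun _ : Unit => h) → Integrable h π := fun hh =>
    hh.integrable (ν := fun _ : Unit => π) hb.summable hπ.moments () ()
  have hct : Tame b fun (_ : Unit) (z : NHist) => ((z 0 : ℝ) - meanOf f θ₀ (tl z)) * g (tl z) :=
    ((Tame.eval_zero hb).sub ((hf.tame_meanOf hθ₀).comp_tl hb)).mul (hgt.comp_tl hb)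
  have hl : ∀ θ ∈ Θ, Tame b fun _ : Unit => logDensity f θ := fun θ hθ =>
    hf.tame_logDensity.reindex fun _ : Unit => (⟨θ, hθ⟩ : Θ)
  have e : ∫ z, k (tl z) ∂π = ∫ z, logDensity f θ₀ z ∂π - ∫ z, logDensity f θ z ∂π := by
    rw [← integral_sub (hInt (hl θ₀ hθ₀)) (hInt (hl θ hθ)), ← sub_zero (∫ z, k (tl z) ∂π),
      ← neg_zero, ← hπ.centred g hgt, sub_neg_eq_add,
      ← integral_add (hInt (hkt.comp_tl hb)) (hInt hct)]
    refine integral_congr_ae (.of_forall fun z => ?_)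
    simp only [logDensity, hk, hg, hf.coe_meanOf hθ₀]
    ring
  have hz : ∫ z, k (tl z) ∂π = 0 :=
    le_antisymm (by rw [e]; linarith) (integral_nonneg fun z => (hk0 _).1)
  rw [integral_eq_zero_iff_of_nonneg (fun z => (hk0 (tl z)).1) (hInt (hkt.comp_tl hb))] at hz
  refine hid θ hθ fun y hy => ?_
  have h4 := ((hvt.sub hut).comp_tl hb).eq_zero_of_ae hb hπ.invariant (hf.measurable_meanOf hθ₀)
    (hf.meanOf_pos hθ₀) hπ.moments () (hz.mono fun z hz => sub_eq_zero.2 ((hk0 _).2 hz))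
    (adm_cons hb hy 0)
  exact sub_eq_zero.1 h4

/-- Consistency of maximum likelihood along a sequence of empirical laws. -/
theorem tendsto_argmax {ν : ℕ → Measure NHist} [∀ n, IsProbabilityMeasure (ν n)]
    (hν : MomentBdd ν) (hθ₀ : θ₀ ∈ Θ) (hπ : IsStationaryHist (meanOf f θ₀) b π)
    (hconv : ∀ (N : ℕ) (p : Fin N → ℕ), Tendsto (fun n => (ν n).real (cyl N p)) atTop
      (𝓝 (π.real (cyl N p))))
    (hid : ∀ θ ∈ Θ, (∀ y, Adm b y → f θ (toHist y) = f θ₀ (toHist y)) → θ = θ₀)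
    {θ : ℕ → Param d} (hθ : ∀ n, θ n ∈ Θ ∧ IsMaxOn (fun θ => ∫ z, logDensity f θ z ∂(ν n)) Θ (θ n)) :
    Tendsto θ atTop (𝓝 θ₀) := by
  have := hπ.prob
  refine tendsto_of_isMaxOn (L := fun θ => ∫ z, logDensity f θ z ∂π)
    (Ln := fun n θ => ∫ z, logDensity f θ z ∂(ν n)) hf.compact
    (fun θ hθ => hf.tame_logDensity.tendsto_integral_param hf.weight.summable hπ.moments
      fun y => hf.continuousOn_logDensity y θ hθ) hθ₀
    (fun θ hθ hle => hf.eq_of_integral_logDensity_le hθ₀ hπ hid hθ hle) (fun ε hε => ?_)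
    (.of_forall hθ)
  filter_upwards [hf.tame_logDensity.eventually_abs_integral_sub_le hf.weight.summable hν
    hπ.moments hconv hε] with n hn θ hθ using hn ⟨θ, hθ⟩

end IsRegular

end Stationary

/-! ### Fisher information -/

section Info

variable {d : ℕ} {b : ℕ → ℝ≥0} {f : MeanFamily d} {Θ : Set (Param d)} {c : ℝ} {θ₀ : Param d}
  {π : Measure NHist}

/-- The Fisher information of the stationary regime, in terms of the law of the history. -/
def infoMatrix (f : MeanFamily d) (Θ : Set (Param d)) (θ : Param d) (π : Measure NHist) :
    Matrix (Fin d) (Fin d) ℝ :=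
  Matrix.of fun i j => ∫ z, info f Θ i j θ (tl z) ∂π

/-- The directional derivative of the logarithm of the conditional mean. -/
def logGrad (f : MeanFamily d) (Θ : Set (Param d)) (θ u : Param d) (y : NHist) : ℝ :=
  (f θ (toHist y))⁻¹ * ∑ i, u i * partialDeriv f Θ i θ (toHist y)

namespace IsRegular

variable (hf : IsRegular f Θ b c)
include hf

lemma tame_logGrad (hθ : θ₀ ∈ interior Θ) (u : Param d) :
    Tame b fun _ : Unit => logGrad f Θ θ₀ u := by
  refine (hf.tame_inv.reindex fun _ : Unit => (⟨θ₀, hθ⟩ : interior Θ)).mul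
    (Tame.sum _ fun i => Tame.const_mul _ ?_)
  exact (hf.tame₁ i).reindex fun _ : Unit => (⟨θ₀, hθ⟩ : interior Θ)

lemma measurable_logGrad (hθ : θ₀ ∈ interior Θ) (u : Param d) :
    Measurable (logGrad f Θ θ₀ u) := by
  refine ((hf.measurable θ₀ (interior_subset hθ)).comp measurable_toHist).inv.mul ?_
  exact Finset.measurable_sum _ fun i _ =>
    ((hf.measurable_partialDeriv hθ i).comp measurable_toHist).const_mul _

lemma mean_mul_logGrad_sq (hθ : θ₀ ∈ Θ) (u : Param d) (y : NHist) :
    (meanOf f θ₀ y : ℝ) * logGrad f Θ θ₀ u y ^ 2 = ∑ i, ∑ j, u i * u j * info f Θ i j θ₀ y := by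
  have h0 := (hf.f_pos hθ (toHist y)).ne'
  rw [hf.coe_meanOf hθ, logGrad, mul_pow, sq (∑ i, _), Finset.sum_mul_sum]
  simp_rw [Finset.mul_sum]
  refine Finset.sum_congr rfl fun i _ => Finset.sum_congr rfl fun j _ => ?_
  rw [info]
  field_simp

lemma sum_mul_score (hθ : θ₀ ∈ Θ) (u : Param d) (z : NHist) :
    ∑ i, u i * score f Θ i θ₀ z =
      logGrad f Θ θ₀ u (tl z) * ((z 0 : ℝ) - meanOf f θ₀ (tl z)) := by
  have h0 := (hf.f_pos hθ (toHist (tl z))).ne'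
  rw [hf.coe_meanOf hθ, logGrad, Finset.mul_sum, Finset.sum_mul]
  refine Finset.sum_congr rfl fun i _ => ?_
  rw [score]
  field_simp

variable (hθ : θ₀ ∈ interior Θ) (hπ : IsStationaryHist (meanOf f θ₀) b π)
include hθ hπ

lemma integrable_info (i j : Fin d) : Integrable (fun z => info f Θ i j θ₀ (tl z)) π :=
  Tame.integrable (ν := fun _ : Unit => π) hf.weight.summable
    ((hf.tame_info i j).comp_tl hf.weight) hπ.moments ⟨θ₀, hθ⟩ ()

lemma dotProduct_infoMatrix (u : Param d) : u ⬝ᵥ (infoMatrix f Θ θ₀ π).mulVec u =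
    ∫ z, (meanOf f θ₀ (tl z) : ℝ) * logGrad f Θ θ₀ u (tl z) ^ 2 ∂π := by
  have hi := hf.integrable_info hθ hπ
  simp_rw [hf.mean_mul_logGrad_sq (interior_subset hθ)]
  rw [integral_finsetSum _ fun i _ => integrable_finsetSum _ fun j _ => (hi i j).const_mul _]
  rw [dotProduct]
  refine Finset.sum_congr rfl fun i _ => ?_
  rw [integral_finsetSum _ fun j _ => (hi i j).const_mul _, Matrix.mulVec, dotProduct,
    Finset.mul_sum]
  refine Finset.sum_congr rfl fun j _ => ?_
  rw [integral_const_mul, infoMatrix, Matrix.of_apply]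
  ring

/-- The Fisher information is non-degenerate if no combination of the partial derivatives of the
conditional mean vanishes on all admissible histories. -/
lemma posDef_infoMatrix (hvar : ∀ u : Param d, (∀ y, Adm b y →
      ∑ i, u i * partialDeriv f Θ i θ₀ (toHist y) = 0) → u = 0) :
    (infoMatrix f Θ θ₀ π).PosDef := by
  have hb := hf.weight
  have := hπ.prob
  have hθ' := interior_subset hθ
  refine Matrix.PosDef.of_dotProduct_mulVec_pos ?_ fun x hx => ?_
  · ext i j
    simp only [infoMatrix, Matrix.conjTranspose_apply, Matrix.of_apply, star_trivial, info]
    refine integral_congr_ae (.of_forall fun z => ?_)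
    simp only
    ring
  · set u : Param d := WithLp.toLp 2 x with hu
    have e : star x ⬝ᵥ (infoMatrix f Θ θ₀ π).mulVec x = u ⬝ᵥ (infoMatrix f Θ θ₀ π).mulVec u := by
      simp [hu]
    rw [e, hf.dotProduct_infoMatrix hθ hπ]
    have h0 : ∀ z : NHist, 0 ≤ (meanOf f θ₀ (tl z) : ℝ) * logGrad f Θ θ₀ u (tl z) ^ 2 :=
      fun z => by positivity
    have ht : Tame b fun (_ : Unit) z => (meanOf f θ₀ (tl z) : ℝ) * logGrad f Θ θ₀ u (tl z) ^ 2 :=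
      ((hf.tame_meanOf hθ').mul ((hf.tame_logGrad hθ u).pow 2)).comp_tl hb
    refine lt_of_le_of_ne (integral_nonneg h0) fun hz => hx ?_
    have hz' := (integral_eq_zero_iff_of_nonneg h0
      (ht.integrable (ν := fun _ : Unit => π) hb.summable hπ.moments () ())).1 hz.symm
    have h1 : u = 0 := hvar u fun y hy => by
      have h2 := ht.eq_zero_of_ae hb hπ.invariant (hf.measurable_meanOf hθ') (hf.meanOf_pos hθ')
        hπ.moments () hz' (adm_cons hb hy 0)
      simp only [tl_cons] at h2
      have h3 : (meanOf f θ₀ y : ℝ) ≠ 0 := (NNReal.coe_pos.2 (hf.meanOf_pos hθ' y)).ne'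
      have h4 : logGrad f Θ θ₀ u y = 0 := by simpa [h3] using h2
      have h5 := (hf.f_pos hθ' (toHist y)).ne'
      simpa [logGrad, h5] using h4
    funext i
    have := congrArg (fun v : Param d => v i) h1
    simpa [hu] using this

end IsRegular

end Info

/-! ### Linearization of the likelihood equation -/

section Linearization

variable {d : ℕ}

lemma hasFDerivAt_integral_emp {Ω : Type*} (Y : ℤ → Ω → ℕ) (n : ℕ) (ω : Ω)
    {h : Param d → NHist → ℝ} {h' : Fin d → NHist → ℝ} {θ : Param d}
    (hd : ∀ z, HasFDerivAt (fun ϑ => h ϑ z)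
      (∑ j, h' j z • (EuclideanSpace.proj j : Param d →L[ℝ] ℝ)) θ) :
    HasFDerivAt (fun ϑ => ∫ z, h ϑ z ∂(emp Y n ω))
      (∑ j, (∫ z, h' j z ∂(emp Y n ω)) • (EuclideanSpace.proj j : Param d →L[ℝ] ℝ)) θ := by
  simp_rw [integral_emp]
  refine ((HasFDerivAt.fun_sum fun t _ => hd _).const_mul _).congr_fderiv ?_
  rw [Finset.sum_comm, Finset.smul_sum]
  refine Finset.sum_congr rfl fun j _ => ?_
  rw [Finset.smul_sum, ← smul_smul, Finset.sum_smul, Finset.smul_sum]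

lemma norm_le_sum_abs (v : Param d) : ‖v‖ ≤ ∑ i, |v i| := by
  conv_lhs => rw [← (EuclideanSpace.basisFun (Fin d) ℝ).sum_repr v]
  refine (norm_sum_le _ _).trans (Finset.sum_le_sum fun i _ => ?_)
  rw [norm_smul, (EuclideanSpace.basisFun (Fin d) ℝ).norm_eq_one, mul_one]
  simp

variable {b : ℕ → ℝ≥0} {f : MeanFamily d} {Θ : Set (Param d)} {c : ℝ} {θ₀ : Param d}
  {π : Measure NHist}

/-- The likelihood equation, linearized at the true parameter: the error of the maximum likelihood
estimate, multiplied by the Fisher information, is the average score, up to a relative error that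
tends to zero. -/
theorem IsRegular.eventually_norm_info_sub_score_le (hf : IsRegular f Θ b c)
    (hθ₀ : θ₀ ∈ interior Θ) (hπ : IsStationaryHist (meanOf f θ₀) b π)
    {Ω : Type*} {Y : ℤ → Ω → ℕ} {ω : Ω}
    (hν : MomentBdd fun n => emp Y (n + 1) ω)
    (hconv : ∀ (N : ℕ) (p : Fin N → ℕ), Tendsto (fun n => (emp Y (n + 1) ω).real (cyl N p)) atTop
      (𝓝 (π.real (cyl N p))))
    {θ : ℕ → Param d} (hlim : Tendsto θ atTop (𝓝 θ₀))
    (hθ : ∀ n, IsMaxOn (fun θ => ∫ z, logDensity f θ z ∂(emp Y (n + 1) ω)) Θ (θ n))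
    {ε : ℝ} (hε : 0 < ε) :
    ∀ᶠ n in atTop, ‖Matrix.toEuclideanCLM (𝕜 := ℝ) (infoMatrix f Θ θ₀ π) (θ n - θ₀) -
      WithLp.toLp 2 fun i => ∫ z, score f Θ i θ₀ z ∂(emp Y (n + 1) ω)‖ ≤ ε * ‖θ n - θ₀‖ := by
  have := hπ.prob
  have hp : ∀ n, IsProbabilityMeasure (emp Y (n + 1) ω) := fun n => isProbabilityMeasure_emp Y n ω
  set M := infoMatrix f Θ θ₀ π with hM
  set η : ℝ := ε / ((d : ℝ) * d + 1) with hη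
  have hη0 : 0 < η := by positivity
  -- the averaged Hessian is uniformly close to `-M` near the true parameter
  have hH : ∀ i j, ∀ᶠ q : ℕ × Param d in atTop ×ˢ 𝓝 θ₀,
      |∫ z, hessian f Θ i j q.2 z ∂(emp Y (q.1 + 1) ω) + M i j| ≤ η := by
    intro i j
    have h1 := (hf.tame_hessian i j).tendsto_integral_prod hf.weight.summable hν hπ.moments hconv
      (fun y => (hf.continuousAt_hessian hθ₀ i j y).continuousWithinAt)
    rw [isOpen_interior.nhdsWithin_eq hθ₀, hf.integral_hessian hθ₀ hπ] at h1
    filter_upwards [Metric.tendsto_nhds.1 h1 η hη0] with q hq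
    rw [Real.dist_eq, sub_neg_eq_add] at hq
    exact hq.le
  have hH' : ∀ᶠ q : ℕ × Param d in atTop ×ˢ 𝓝 θ₀, ∀ i j,
      |∫ z, hessian f Θ i j q.2 z ∂(emp Y (q.1 + 1) ω) + M i j| ≤ η :=
    eventually_all.2 fun i => eventually_all.2 fun j => hH i j
  obtain ⟨pa, hpa, pb, hpb, hab⟩ := eventually_prod_iff.1 hH'
  obtain ⟨r, hr, hball⟩ := Metric.mem_nhds_iff.1 (inter_mem hpb (isOpen_interior.mem_nhds hθ₀))
  filter_upwards [hpa, hlim.eventually (Metric.ball_mem_nhds θ₀ hr)] with n hn hθn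
  have hθint : θ n ∈ interior Θ := (hball hθn).2
  -- the likelihood equation at the maximizer
  have hscore0 : ∀ i, ∫ z, score f Θ i (θ n) z ∂(emp Y (n + 1) ω) = 0 := by
    intro i
    have h1 := hasFDerivAt_integral_emp Y (n + 1) ω (hf.hasFDerivAt_logDensity hθint)
    have h2 := ((hθ n).isLocalMax (mem_interior_iff_mem_nhds.1 hθint)).hasFDerivAt_eq_zero h1
    have h3 := congrArg (fun L : Param d →L[ℝ] ℝ => L (EuclideanSpace.single i 1)) h2
    simpa using h3
  have hcomp : ∀ i, |(Matrix.toEuclideanCLM (𝕜 := ℝ) M (θ n - θ₀) -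
      WithLp.toLp 2 fun i => ∫ z, score f Θ i θ₀ z ∂(emp Y (n + 1) ω)) i| ≤
        d * η * ‖θ n - θ₀‖ := by
    intro i
    set φ : Param d →L[ℝ] ℝ := ∑ j, (-M i j) • (EuclideanSpace.proj j : Param d →L[ℝ] ℝ) with hφ
    have h1 := (convex_ball θ₀ r).norm_image_sub_le_of_norm_hasFDerivWithin_le' (𝕜 := ℝ)
      (f := fun ϑ => ∫ z, score f Θ i ϑ z ∂(emp Y (n + 1) ω))
      (f' := fun ϑ => ∑ j, (∫ z, hessian f Θ i j ϑ z ∂(emp Y (n + 1) ω)) •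
        (EuclideanSpace.proj j : Param d →L[ℝ] ℝ)) (φ := φ) (C := d * η)
      (fun ϑ hϑ => (hasFDerivAt_integral_emp Y (n + 1) ω
        (hf.hasFDerivAt_score (hball hϑ).2 i)).hasFDerivWithinAt)
      (fun ϑ hϑ => ?_) (Metric.mem_ball_self hr) hθn
    · rw [hscore0, zero_sub] at h1
      refine le_trans (le_of_eq ?_) h1
      rw [Real.norm_eq_abs]
      congr 1
      rw [PiLp.sub_apply, Matrix.ofLp_toEuclideanCLM]
      simp only [hφ, Matrix.mulVec, dotProduct, _root_.sum_apply,
        _root_.smul_apply, PiLp.proj_apply, smul_eq_mul, neg_mul,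
        Finset.sum_neg_distrib]
      ring
    · rw [hφ, ← Finset.sum_sub_distrib]
      refine (norm_sum_le _ _).trans ?_
      have : (d : ℝ) * η = ∑ _j : Fin d, η := by simp
      rw [this]
      refine Finset.sum_le_sum fun j _ => ?_
      rw [← sub_smul, norm_smul, sub_neg_eq_add, Real.norm_eq_abs]
      have h2 : ‖(EuclideanSpace.proj j : Param d →L[ℝ] ℝ)‖ ≤ 1 :=
        ContinuousLinearMap.opNorm_le_bound _ zero_le_one fun v => by
          rw [one_mul]
          exact PiLp.norm_apply_le v j
      exact (mul_le_mul (hab hn (hball hϑ).1 i j) h2 (norm_nonneg _) hη0.le).trans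
        (mul_one η).le
  refine (norm_le_sum_abs _).trans ((Finset.sum_le_sum fun i _ => hcomp i).trans ?_)
  rw [Finset.sum_const, Finset.card_univ, Fintype.card_fin, nsmul_eq_mul, ← mul_assoc]
  refine mul_le_mul_of_nonneg_right ?_ (norm_nonneg _)
  rw [hη, ← mul_assoc, mul_div_assoc', div_le_iff₀ (by positivity)]
  nlinarith

end Linearization

/-! ### Asymptotic normality of the score -/

section ScoreCLT

variable {d : ℕ} {b : ℕ → ℝ≥0} {f : MeanFamily d} {Θ : Set (Param d)} {c : ℝ} {θ₀ : Param d}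
  {π : Measure NHist} {Ω : Type*} [mΩ : MeasurableSpace Ω] {μ : Measure Ω} [IsProbabilityMeasure μ]
  {Y : ℤ → Ω → ℕ} {α : ℕ → ℝ≥0}

/-- Ergodic theorem for tame functions of the full history. -/
lemma Tame.ae_tendsto_average {I : Type*} {h : I → NHist → ℝ} (hh : Tame b h)
    (hY : ∀ t, Measurable (Y t))
    (hmom : ∀ r : ℕ, ∃ C : ℝ≥0, ∀ t : ℤ, ∫⁻ ω, (Y t ω : ℝ≥0∞) ^ r ∂μ ≤ C) (hb : IsWeight b)
    [IsProbabilityMeasure π] (hπ : MomentBdd fun _ : Unit => π)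
    (hgood : ∀ᵐ ω ∂μ, MomentBdd (fun n => emp Y (n + 1) ω) ∧
      ∀ (N : ℕ) (p : Fin N → ℕ), Tendsto (fun n => (emp Y (n + 1) ω).real (cyl N p)) atTop
        (𝓝 (π.real (cyl N p)))) (i : I) :
    ∀ᵐ ω ∂μ, Tendsto (fun n : ℕ => (n : ℝ)⁻¹ * ∑ t ∈ Finset.range n,
      h i (hist Y ((t : ℤ) + 1) ω)) atTop (𝓝 (∫ y, h i y ∂π)) := by
  filter_upwards [hgood, hh.ae_tendsto_sum_sub_posPart hY hmom hb i] with ω hω hdiff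
  have hp : ∀ n, IsProbabilityMeasure (emp Y (n + 1) ω) := fun n => isProbabilityMeasure_emp Y n ω
  have h1 := hh.tendsto_integral hb.summable hω.1 hπ hω.2 i
  simp_rw [integral_emp] at h1
  have h2 := (tendsto_add_atTop_iff_nat (f := fun n : ℕ => (n : ℝ)⁻¹ * ∑ t ∈ Finset.range n,
    h i (hist (posPart Y) ((t : ℤ) + 1) ω)) 1).1 h1
  have h3 := tendsto_inv_mul_sum_of_sqrt (fun t => abs_nonneg _) hdiff
  have h4 : Tendsto (fun n : ℕ => (n : ℝ)⁻¹ * ∑ t ∈ Finset.range n,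
      (h i (hist Y ((t : ℤ) + 1) ω) - h i (hist (posPart Y) ((t : ℤ) + 1) ω))) atTop (𝓝 0) := by
    refine squeeze_zero_norm (fun n => ?_) h3
    rw [norm_mul, Real.norm_of_nonneg (by positivity)]
    exact mul_le_mul_of_nonneg_left (norm_sum_le _ _) (by positivity)
  have h5 := h2.add h4
  rw [add_zero] at h5
  refine h5.congr fun n => ?_
  rw [← mul_add, ← Finset.sum_add_distrib]
  simp

/-- The normalized score along the full history. -/
def normScore (f : MeanFamily d) (Θ : Set (Param d)) (θ : Param d) (Y : ℤ → Ω → ℕ) (n : ℕ)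
    (ω : Ω) : Param d :=
  WithLp.toLp 2 fun i => (√(n : ℝ))⁻¹ * ∑ t ∈ Finset.range n,
    score f Θ i θ (hist Y ((t : ℤ) + 1) ω)

lemma IsRegular.measurable_normScore (hf : IsRegular f Θ b c) (hθ : θ₀ ∈ interior Θ)
    (hY : ∀ t, Measurable (Y t)) (n : ℕ) : Measurable (normScore f Θ θ₀ Y n) := by
  refine (WithLp.measurable_toLp 2 _).comp (measurable_pi_lambda _ fun i => ?_)
  refine (Finset.measurable_sum _ fun t _ => ?_).const_mul _
  have h1 := measurable_toHist.comp measurable_tl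
  have h2 : Measurable (score f Θ i θ₀) :=
    (((measurable_from_nat.comp (measurable_pi_apply 0)).mul
      ((hf.measurable θ₀ (interior_subset hθ)).comp h1).inv).sub_const 1).mul
      ((hf.measurable_partialDeriv hθ i).comp h1)
  exact h2.comp (measurable_hist hY _)

theorem IsRegular.tendsto_charFun_normScore (hf : IsRegular f Θ b c) (hθ : θ₀ ∈ interior Θ)
    (hπ : IsStationaryHist (meanOf f θ₀) b π) (hY : ∀ t, Measurable (Y t))
    (hlaw : ∀ t : ℕ, CondLaw μ Y (meanOf f θ₀) (hf.measurable_meanOf (interior_subset hθ)) t)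
    (hmom : ∀ r : ℕ, ∃ C : ℝ≥0, ∀ t : ℤ, ∫⁻ ω, (Y t ω : ℝ≥0∞) ^ r ∂μ ≤ C)
    (hgood : ∀ᵐ ω ∂μ, MomentBdd (fun n => emp Y (n + 1) ω) ∧
      ∀ (N : ℕ) (p : Fin N → ℕ), Tendsto (fun n => (emp Y (n + 1) ω).real (cyl N p)) atTop
        (𝓝 (π.real (cyl N p)))) (u : Param d) :
    Tendsto (fun n : ℕ => ∫ ω, Complex.exp ((inner ℝ u (normScore f Θ θ₀ Y n ω) : ℝ) * Complex.I) ∂μ)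
      atTop (𝓝 (Complex.exp (-((u ⬝ᵥ (infoMatrix f Θ θ₀ π).mulVec u) / 2 : ℝ)))) := by
  have := hπ.prob
  have hb := hf.weight
  have hθ' := interior_subset hθ
  have ht2 : Tame b fun (_ : Unit) z => (meanOf f θ₀ (tl z) : ℝ) * logGrad f Θ θ₀ u (tl z) ^ 2 :=
    ((hf.tame_meanOf hθ').mul ((hf.tame_logGrad hθ u).pow 2)).comp_tl hb
  have ht3 : Tame b fun (_ : Unit) z =>
      (meanOf f θ₀ (tl z) : ℝ) * |logGrad f Θ θ₀ u (tl z)| ^ 3 :=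
    ((hf.tame_meanOf hθ').mul ((hf.tame_logGrad hθ u).abs.pow 3)).comp_tl hb
  have h2 := ht2.ae_tendsto_average hY hmom hb hπ.moments hgood ()
  have h3 := ht3.ae_tendsto_average hY hmom hb hπ.moments hgood ()
  simp only [tl_hist_succ] at h2 h3
  rw [hf.dotProduct_infoMatrix hθ hπ]
  refine (tendsto_charFun_sum hY hlaw (hf.measurable_logGrad hθ u) h2 h3).congr fun n => ?_
  refine integral_congr_ae (.of_forall fun ω => ?_)
  simp only
  congr 3
  have e : inner ℝ u (normScore f Θ θ₀ Y n ω) = ∑ i, u i * ((√(n : ℝ))⁻¹ *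
      ∑ t ∈ Finset.range n, score f Θ i θ₀ (hist Y ((t : ℤ) + 1) ω)) := by
    rw [PiLp.inner_apply]
    refine Finset.sum_congr rfl fun i _ => ?_
    simp [normScore, mul_comm]
  rw [e]
  simp_rw [mul_left_comm (u _), ← Finset.mul_sum, Finset.mul_sum (a := u _)]
  rw [Finset.sum_comm]
  congr 1
  refine Finset.sum_congr rfl fun t _ => ?_
  rw [hf.sum_mul_score hθ', tl_hist_succ]
  rfl

end ScoreCLT

/-! ### The likelihood and the empirical information in terms of the empirical law -/

section Empirical

variable {d : ℕ} {Ω : Type*} {f : MeanFamily d} {Θ : Set (Param d)} {Y : ℤ → Ω → ℕ}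

lemma sum_Icc_one_eq (F : ℕ → ℝ) (n : ℕ) :
    ∑ t ∈ Finset.Icc 1 n, F t = ∑ t ∈ Finset.range n, F (t + 1) := by
  induction n with
  | zero => simp
  | succ n ih => rw [Finset.sum_Icc_succ_top (by omega), Finset.sum_range_succ, ih]

lemma hist_posPart_zero (t : ℕ) (ω : Ω) : hist (posPart Y) ((t : ℤ) + 1) ω 0 = Y ((t : ℤ) + 1) ω := by
  simp only [hist, posPart, Nat.cast_zero, sub_zero]
  rw [if_pos (by omega)]

lemma logLik_succ (f : MeanFamily d) (Y : ℤ → Ω → ℕ) (n : ℕ) (ω : Ω) (θ : Param d) :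
    logLik Y f (n + 1) ω θ = ((n : ℝ) + 1) * ∫ z, logDensity f θ z ∂(emp Y (n + 1) ω) := by
  rw [logLik, sum_Icc_one_eq, integral_emp, Nat.cast_add_one, mul_inv_cancel_left₀ (by positivity)]
  refine Finset.sum_congr rfl fun t _ => ?_
  rw [Nat.cast_add_one, truncPast_eq, logDensity, tl_hist_succ, hist_posPart_zero]

lemma IsMLE.isMaxOn {n : ℕ} {ω : Ω} {θ : Param d} (h : IsMLE Y f Θ (n + 1) ω θ) :
    IsMaxOn (fun θ => ∫ z, logDensity f θ z ∂(emp Y (n + 1) ω)) Θ θ := fun ϑ hϑ => by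
  have h1 := h.2 hϑ
  simp only [Set.mem_ofPred_eq, logLik_succ] at h1 ⊢
  exact le_of_mul_le_mul_left h1 (by positivity)

lemma empFisher_apply (f : MeanFamily d) (Θ : Set (Param d)) (Y : ℤ → Ω → ℕ) (n : ℕ) (ω : Ω)
    (θ : Param d) (i j : Fin d) :
    empFisher Y f Θ n ω θ i j = ∫ z, info f Θ i j θ (tl z) ∂(emp Y n ω) := by
  rw [empFisher, Matrix.of_apply, sum_Icc_one_eq, integral_emp]
  congr 1
  refine Finset.sum_congr rfl fun t _ => ?_
  rw [Nat.cast_add_one, truncPast_eq, info, tl_hist_succ]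

end Empirical

/-! ### Slutsky's lemma with a relative error -/

section Slutsky

lemma eventually_of_eventually_succ {p : ℕ → Prop} (h : ∀ᶠ n in atTop, p (n + 1)) :
    ∀ᶠ n in atTop, p n := by
  rw [← map_add_atTop_eq_nat 1]
  exact h

/-- A perturbation that is small relative to the size of the sequence does not change the limit in
distribution. -/
lemma tendstoInDistribution_of_norm_sub_le {E Ω Ω' : Type*} [NormedAddCommGroup E]
    [NormedSpace ℝ E] [FiniteDimensional ℝ E] [MeasurableSpace E] [BorelSpace E]
    [MeasurableSpace Ω] [MeasurableSpace Ω'] {μ : Measure Ω} [IsProbabilityMeasure μ]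
    {μ' : Measure Ω'} [IsProbabilityMeasure μ'] {X W : ℕ → Ω → E} {Z : Ω' → E}
    (hX : TendstoInDistribution X atTop Z (fun _ => μ) μ') (hW : ∀ n, AEMeasurable (W n) μ)
    (h : ∀ᵐ ω ∂μ, ∀ ε : ℝ, 0 < ε → ∀ᶠ n in atTop, ‖W n ω - X n ω‖ ≤ ε * (1 + ‖X n ω‖)) :
    TendstoInDistribution W atTop Z (fun _ => μ) μ' := by
  have := FiniteDimensional.proper_real E
  have : SecondCountableTopology E := secondCountable_of_proper
  set R : ℕ → Ω → E := fun n ω => (1 + ‖X n ω‖)⁻¹ • (W n ω - X n ω) with hR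
  have hpos : ∀ n ω, 0 < 1 + ‖X n ω‖ := fun n ω => by positivity
  have hRm : ∀ n, AEMeasurable (R n) μ := fun n =>
    ((hX.forall_aemeasurable n).norm.const_add 1).inv.smul
      ((hW n).sub (hX.forall_aemeasurable n))
  have hR0 : TendstoInMeasure μ R atTop fun _ => 0 := by
    refine tendstoInMeasure_of_tendsto_ae (fun n => (hRm n).aestronglyMeasurable) ?_
    filter_upwards [h] with ω hω
    rw [Metric.tendsto_atTop']
    intro ε hε
    obtain ⟨N, hN⟩ := eventually_atTop.1 (hω (ε / 2) (half_pos hε))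
    refine ⟨N, fun n hn => ?_⟩
    rw [dist_zero_right, hR, norm_smul, norm_inv, Real.norm_of_nonneg (hpos n ω).le,
      inv_mul_lt_iff₀ (hpos n ω)]
    exact (hN n hn.le).trans_lt (by nlinarith [hpos n ω])
  have h1 := hX.continuous_comp_prodMk_of_tendstoInMeasure_const
    (g := fun x : E × E => x.1 + (1 + ‖x.1‖) • x.2) (by fun_prop) hR0 hRm
  simp only [smul_zero, add_zero] at h1
  have e : (fun n ω => X n ω + (1 + ‖X n ω‖) • R n ω) = W := by
    funext n ω
    rw [hR, smul_inv_smul₀ (hpos n ω).ne', add_sub_cancel]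
  rwa [e] at h1

/-- If `w` solves the linear equation `S w = s` up to a small relative error and `s` is close to
`g`, then `w` is close to `A g`, where `A` is a left inverse of `S`. -/
lemma eventually_norm_sub_le_of_linearized {E : Type*} [NormedAddCommGroup E] [NormedSpace ℝ E]
    {S A : E →L[ℝ] E} (hAS : ∀ v, A (S v) = v) {w s g : ℕ → E}
    (hw : ∀ ε : ℝ, 0 < ε → ∀ᶠ n in atTop, ‖S (w n) - s n‖ ≤ ε * ‖w n‖)
    (hs : Tendsto (fun n => s n - g n) atTop (𝓝 0)) {ε : ℝ} (hε : 0 < ε) :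
    ∀ᶠ n in atTop, ‖w n - A (g n)‖ ≤ ε * (1 + ‖A (g n)‖) := by
  -- a relative error `τ / K` in the equation costs `τ * ‖w n‖`, absorbed since `τ ≤ 1 / 2`
  set K := ‖A‖ + 1 with hK
  have hK0 : 0 < K := by positivity
  set τ := min (1 / 2) (ε / 2) with hτ
  have hτ0 : 0 < τ := lt_min (by norm_num) (half_pos hε)
  have h2 := (tendsto_zero_iff_norm_tendsto_zero.1 hs).eventually
    (ge_mem_nhds (show 0 < ε / 2 / K by positivity))
  filter_upwards [hw (τ / K) (by positivity), h2] with n h1 h2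
  have e : w n - A (g n) = A (S (w n) - s n) + A (s n - g n) := by
    rw [map_sub, map_sub, hAS]
    abel
  have hA : ∀ v, ‖A v‖ ≤ K * ‖v‖ := fun v => (A.le_opNorm v).trans (by gcongr; linarith)
  have h3 : ‖w n - A (g n)‖ ≤ τ * ‖w n‖ + ε / 2 := by
    rw [e]
    refine (norm_add_le _ _).trans (add_le_add ((hA _).trans ?_) ((hA _).trans ?_))
    · calc K * ‖S (w n) - s n‖ ≤ K * (τ / K * ‖w n‖) := by gcongr
        _ = τ * ‖w n‖ := by field_simp
    · calc K * ‖s n - g n‖ ≤ K * (ε / 2 / K) := by gcongr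
        _ = ε / 2 := by field_simp
  have h4 : ‖w n‖ ≤ ‖w n - A (g n)‖ + ‖A (g n)‖ := by
    simpa using norm_add_le (w n - A (g n)) (A (g n))
  have h5 : τ ≤ 1 / 2 := min_le_left _ _
  have h6 : τ ≤ ε / 2 := min_le_right _ _
  have h7 : τ * ‖w n‖ ≤ τ * (‖w n - A (g n)‖ + ‖A (g n)‖) := by gcongr
  have h8 : τ * ‖w n - A (g n)‖ ≤ 1 / 2 * ‖w n - A (g n)‖ := by gcongr
  have h9 : τ * ‖A (g n)‖ ≤ ε / 2 * ‖A (g n)‖ := by gcongr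
  nlinarith

end Slutsky

/-! ### Asymptotic normality -/

section Normality

variable {d : ℕ} {b : ℕ → ℝ≥0} {f : MeanFamily d} {Θ : Set (Param d)} {c : ℝ} {θ₀ : Param d}
  {π : Measure NHist} {Ω : Type*} [MeasurableSpace Ω] {μ : Measure Ω} [IsProbabilityMeasure μ]
  {Y : ℤ → Ω → ℕ}

/-- The central limit theorem for random vectors whose characteristic functions converge to that of
a Gaussian law with covariance `M`, after multiplication by `M⁻¹`. -/
lemma tendstoInDistribution_inv_of_charFun {M : Matrix (Fin d) (Fin d) ℝ} (hM : M.PosDef)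
    {G : ℕ → Ω → Param d} (hG : ∀ n, Measurable (G n))
    (h : ∀ u : Param d, Tendsto
      (fun n : ℕ => ∫ ω, Complex.exp ((inner ℝ u (G n ω) : ℝ) * Complex.I) ∂μ)
      atTop (𝓝 (Complex.exp (-((u ⬝ᵥ M.mulVec u) / 2 : ℝ))))) :
    TendstoInDistribution (fun n ω => Matrix.toEuclideanCLM (𝕜 := ℝ) M⁻¹ (G n ω)) atTop id
      (fun _ => μ) (multivariateGaussian 0 M⁻¹) := by
  have hm : ∀ n, Measurable fun ω => Matrix.toEuclideanCLM (𝕜 := ℝ) M⁻¹ (G n ω) := fun n =>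
    (Matrix.toEuclideanCLM (𝕜 := ℝ) M⁻¹).continuous.measurable.comp (hG n)
  refine ⟨fun n => (hm n).aemeasurable, aemeasurable_id, ?_⟩
  refine ProbabilityMeasure.tendsto_of_tendsto_charFun fun v => ?_
  simp only [ProbabilityMeasure.coe_mk, Measure.map_id]
  rw [charFun_multivariateGaussian hM.inv.posSemidef]
  set u : Param d := Matrix.toEuclideanCLM (𝕜 := ℝ) M⁻¹ v with hu
  have hMu : IsUnit M.det := (Matrix.isUnit_iff_isUnit_det M).1 hM.isUnit
  have hsymm : M⁻¹.transpose = M⁻¹ := by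
    have := hM.inv.isHermitian
    rwa [Matrix.IsHermitian, Matrix.conjTranspose_eq_transpose_of_trivial] at this
  have huv : (u : Fin d → ℝ) = M⁻¹.mulVec v := Matrix.ofLp_toEuclideanCLM _ _
  have hquad : u ⬝ᵥ M.mulVec u = v ⬝ᵥ M⁻¹.mulVec v := by
    rw [huv, Matrix.mulVec_mulVec, Matrix.mul_nonsing_inv _ hMu, Matrix.one_mulVec, dotProduct_comm]
  have hinner : ∀ x : Param d, inner ℝ (Matrix.toEuclideanCLM (𝕜 := ℝ) M⁻¹ x) v = inner ℝ u x := by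
    intro x
    rw [real_inner_comm, Matrix.inner_toEuclideanCLM, Matrix.dotProduct_mulVec,
      ← Matrix.mulVec_transpose, hsymm, ← huv, EuclideanSpace.inner_eq_star_dotProduct,
      dotProduct_comm]
    simp
  have h1 := h u
  rw [hquad] at h1
  have e : (inner ℝ v (0 : Param d) : ℝ) * Complex.I - ((v ⬝ᵥ M⁻¹.mulVec v : ℝ) : ℂ) / 2 =
      ((-(v ⬝ᵥ M⁻¹.mulVec v / 2 : ℝ) : ℝ) : ℂ) := by
    rw [inner_zero_right]
    push_cast
    ring
  refine (h1.congr fun n => ?_).trans (by rw [e]; push_cast; rfl)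
  rw [charFun_apply, integral_map (hm n).aemeasurable (by fun_prop)]
  simp_rw [hinner]

end Normality

/-! ### Asymptotics of the maximum likelihood estimator -/

section Estimator

variable {d : ℕ} {b : ℕ → ℝ≥0} {f : MeanFamily d} {Θ : Set (Param d)} {c : ℝ} {θ₀ : Param d}
  {π : Measure NHist} {Ω : Type*} {Y : ℤ → Ω → ℕ} {ω : Ω} {θhat : ℕ → Param d}

lemma IsRegular.tendsto_mle (hf : IsRegular f Θ b c) (hθ₀ : θ₀ ∈ interior Θ)
    (hπ : IsStationaryHist (meanOf f θ₀) b π)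
    (hid : ∀ θ ∈ Θ, (∀ y, Adm b y → f θ (toHist y) = f θ₀ (toHist y)) → θ = θ₀)
    (hν : MomentBdd fun n => emp Y (n + 1) ω)
    (hconv : ∀ (N : ℕ) (p : Fin N → ℕ), Tendsto (fun n => (emp Y (n + 1) ω).real (cyl N p)) atTop
      (𝓝 (π.real (cyl N p))))
    (hmle : ∀ n, IsMLE Y f Θ n ω (θhat n)) : Tendsto θhat atTop (𝓝 θ₀) := by
  have hp : ∀ n, IsProbabilityMeasure (emp Y (n + 1) ω) := fun n => isProbabilityMeasure_emp Y n ω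
  exact (tendsto_add_atTop_iff_nat 1).1 (hf.tendsto_argmax hν (interior_subset hθ₀) hπ hconv hid
    fun n => ⟨(hmle (n + 1)).1, (hmle (n + 1)).isMaxOn⟩)

lemma IsRegular.tendsto_empFisher (hf : IsRegular f Θ b c) (hθ₀ : θ₀ ∈ interior Θ)
    (hπ : IsStationaryHist (meanOf f θ₀) b π)
    (hν : MomentBdd fun n => emp Y (n + 1) ω)
    (hconv : ∀ (N : ℕ) (p : Fin N → ℕ), Tendsto (fun n => (emp Y (n + 1) ω).real (cyl N p)) atTop
      (𝓝 (π.real (cyl N p))))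
    (hlim : Tendsto θhat atTop (𝓝 θ₀)) :
    Tendsto (fun n => empFisher Y f Θ n ω (θhat n)) atTop (𝓝 (infoMatrix f Θ θ₀ π)) := by
  have := hπ.prob
  have hp : ∀ n, IsProbabilityMeasure (emp Y (n + 1) ω) := fun n => isProbabilityMeasure_emp Y n ω
  refine (tendsto_add_atTop_iff_nat 1).1 (tendsto_pi_nhds.2 fun i => tendsto_pi_nhds.2 fun j => ?_)
  have ht : Tame b fun (θ : interior Θ) z => info f Θ i j θ (tl z) :=
    (hf.tame_info i j).comp_tl hf.weight
  have hc : ∀ y, ContinuousWithinAt (fun θ => info f Θ i j θ (tl y)) (interior Θ) θ₀ := fun y =>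
    (hf.continuousAt_info hθ₀ i j (tl y)).continuousWithinAt
  have h1 := Tame.tendsto_integral_prod (h := fun θ z => info f Θ i j θ (tl z)) ht
    hf.weight.summable hν hπ.moments hconv hc
  rw [isOpen_interior.nhdsWithin_eq hθ₀] at h1
  have h2 : Tendsto (fun n => (n, θhat (n + 1))) atTop (atTop ×ˢ 𝓝 θ₀) :=
    tendsto_id.prodMk ((tendsto_add_atTop_iff_nat 1).2 hlim)
  refine (h1.comp h2).congr fun n => ?_
  rw [empFisher_apply]
  rfl

/-- The estimation error, scaled by `√n`, is asymptotically the inverse of the information applied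
to the normalized score of the process with its full past. -/
lemma IsRegular.eventually_norm_mle_sub_le (hf : IsRegular f Θ b c) (hθ₀ : θ₀ ∈ interior Θ)
    (hπ : IsStationaryHist (meanOf f θ₀) b π) (hM : (infoMatrix f Θ θ₀ π).PosDef)
    (hν : MomentBdd fun n => emp Y (n + 1) ω)
    (hconv : ∀ (N : ℕ) (p : Fin N → ℕ), Tendsto (fun n => (emp Y (n + 1) ω).real (cyl N p)) atTop
      (𝓝 (π.real (cyl N p))))
    (hmle : ∀ n, IsMLE Y f Θ n ω (θhat n)) (hlim : Tendsto θhat atTop (𝓝 θ₀))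
    (hdiff : ∀ i, Tendsto (fun n : ℕ => (√(n : ℝ))⁻¹ * ∑ t ∈ Finset.range n,
      |score f Θ i θ₀ (hist Y ((t : ℤ) + 1) ω) - score f Θ i θ₀ (hist (posPart Y) ((t : ℤ) + 1) ω)|)
      atTop (𝓝 0)) {ε : ℝ} (hε : 0 < ε) :
    ∀ᶠ n : ℕ in atTop, ‖√(n : ℝ) • (θhat n - θ₀) -
        Matrix.toEuclideanCLM (𝕜 := ℝ) (infoMatrix f Θ θ₀ π)⁻¹ (normScore f Θ θ₀ Y n ω)‖ ≤
      ε * (1 + ‖Matrix.toEuclideanCLM (𝕜 := ℝ) (infoMatrix f Θ θ₀ π)⁻¹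
        (normScore f Θ θ₀ Y n ω)‖) := by
  set M := infoMatrix f Θ θ₀ π with hMdef
  refine eventually_norm_sub_le_of_linearized (S := Matrix.toEuclideanCLM (𝕜 := ℝ) M)
    (A := Matrix.toEuclideanCLM (𝕜 := ℝ) M⁻¹)
    (s := fun n => normScore f Θ θ₀ (posPart Y) n ω) (fun v => ?_) (fun ε hε => ?_) ?_ hε
  · have hMu : IsUnit M.det := (Matrix.isUnit_iff_isUnit_det M).1 hM.isUnit
    have : Matrix.toEuclideanCLM (𝕜 := ℝ) M⁻¹ * Matrix.toEuclideanCLM (𝕜 := ℝ) M = 1 := by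
      rw [← map_mul, Matrix.nonsing_inv_mul _ hMu, map_one]
    exact congrArg (fun L : Param d →L[ℝ] Param d => L v) this
  · refine eventually_of_eventually_succ ?_
    filter_upwards [hf.eventually_norm_info_sub_score_le hθ₀ hπ hν hconv
      ((tendsto_add_atTop_iff_nat 1).2 hlim) (fun n => (hmle (n + 1)).isMaxOn) hε] with n hn
    -- `√(n + 1)` times the average over `n + 1` terms is the normalized sum
    have hs : normScore f Θ θ₀ (posPart Y) (n + 1) ω = √((n + 1 : ℕ) : ℝ) •
        WithLp.toLp 2 fun i => ∫ z, score f Θ i θ₀ z ∂(emp Y (n + 1) ω) := by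
      ext i
      have h0 : (0 : ℝ) < ((n + 1 : ℕ) : ℝ) := by positivity
      simp only [normScore, integral_emp, PiLp.smul_apply, smul_eq_mul]
      rw [← mul_assoc]
      congr 1
      rw [eq_mul_inv_iff_mul_eq₀ h0.ne', ← Real.mul_self_sqrt h0.le]
      field_simp [(Real.sqrt_pos.2 h0).ne']
      rw [Real.sqrt_sq (Real.sqrt_nonneg _)]
    rw [hs, map_smul, ← smul_sub, norm_smul, norm_smul, mul_left_comm]
    exact mul_le_mul_of_nonneg_left hn (norm_nonneg _)
  -- the unobserved past does not matter at the scale `√n`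
  · refine squeeze_zero_norm (fun n => norm_le_sum_abs _) ?_
    have h0 : (0 : ℝ) = ∑ _i : Fin d, 0 := by simp
    rw [h0]
    refine tendsto_finsetSum _ fun i _ => squeeze_zero (fun n => abs_nonneg _) (fun n => ?_)
      (hdiff i)
    simp only [normScore, PiLp.sub_apply]
    rw [← mul_sub, ← Finset.sum_sub_distrib, abs_mul, abs_of_nonneg (by positivity)]
    refine mul_le_mul_of_nonneg_left ((Finset.abs_sum_le_sum_abs _ _).trans
      (Finset.sum_le_sum fun t _ => ?_)) (by positivity)
    rw [abs_sub_comm]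

theorem IsRegular.tendstoInDistribution_mle [MeasurableSpace Ω] {μ : Measure Ω}
    [IsProbabilityMeasure μ] (hf : IsRegular f Θ b c) (hθ₀ : θ₀ ∈ interior Θ)
    (hπ : IsStationaryHist (meanOf f θ₀) b π) (hM : (infoMatrix f Θ θ₀ π).PosDef)
    (hY : ∀ t, Measurable (Y t))
    (hlaw : ∀ t : ℕ, CondLaw μ Y (meanOf f θ₀) (hf.measurable_meanOf (interior_subset hθ₀)) t)
    (hmom : ∀ r : ℕ, ∃ C : ℝ≥0, ∀ t : ℤ, ∫⁻ ω, (Y t ω : ℝ≥0∞) ^ r ∂μ ≤ C)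
    (hgood : ∀ᵐ ω ∂μ, MomentBdd (fun n => emp Y (n + 1) ω) ∧
      ∀ (N : ℕ) (p : Fin N → ℕ), Tendsto (fun n => (emp Y (n + 1) ω).real (cyl N p)) atTop
        (𝓝 (π.real (cyl N p))))
    {θhat : ℕ → Ω → Param d} (hθm : ∀ n, AEMeasurable (θhat n) μ)
    (hmle : ∀ᵐ ω ∂μ, ∀ n, IsMLE Y f Θ n ω (θhat n ω))
    (hlim : ∀ᵐ ω ∂μ, Tendsto (fun n => θhat n ω) atTop (𝓝 θ₀)) :
    TendstoInDistribution (fun (n : ℕ) ω => √(n : ℝ) • (θhat n ω - θ₀)) atTop id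
      (fun _ => μ) (multivariateGaussian 0 (infoMatrix f Θ θ₀ π)⁻¹) := by
  have hdiff : ∀ᵐ ω ∂μ, ∀ i, Tendsto (fun n : ℕ => (√(n : ℝ))⁻¹ * ∑ t ∈ Finset.range n,
      |score f Θ i θ₀ (hist Y ((t : ℤ) + 1) ω) - score f Θ i θ₀ (hist (posPart Y) ((t : ℤ) + 1) ω)|)
      atTop (𝓝 0) :=
    ae_all_iff.2 fun i =>
      (hf.tame_score i).ae_tendsto_sum_sub_posPart hY hmom hf.weight ⟨θ₀, hθ₀⟩
  refine tendstoInDistribution_of_norm_sub_le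
    (tendstoInDistribution_inv_of_charFun hM (hf.measurable_normScore hθ₀ hY)
      (hf.tendsto_charFun_normScore hθ₀ hπ hY hlaw hmom hgood))
    (fun n => ((hθm n).sub_const θ₀).const_smul (√(n : ℝ))) ?_
  filter_upwards [hgood, hdiff, hmle, hlim] with ω h1 h2 h3 h4 ε hε
  exact hf.eventually_norm_mle_sub_le hθ₀ hπ hM h1.1 h1.2 h3 h4 h2 hε

end Estimator

/-! ### From the stated conditions to regularity -/

section Setup

variable {d : ℕ} {b : ℕ → ℝ≥0} {f : MeanFamily d} {Θ : Set (Param d)} {c : ℝ} {θ₀ : Param d}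

lemma isRegular_of_cond {α₀ α₁ α₂ : ℕ → ℝ} {γ : ℝ} (hΘ : IsCompact Θ)
    (hmeas : ∀ θ ∈ Θ, Measurable (f θ)) (hC2 : ∀ y, ContDiffOn ℝ 2 (fun θ => f θ y) Θ)
    (hc : 0 < c) (hlow : ∀ θ ∈ Θ, ∀ y, c ≤ f θ y) (hA0 : CondA0 f Θ α₀) (hA1 : CondA1 f Θ α₁)
    (hA2 : CondA2 f Θ α₂) (hγ : 3 / 2 < γ) (h0 : HasDecay α₀ γ) (h1 : HasDecay α₁ γ)
    (h2 : HasDecay α₂ γ) : IsRegular f Θ (powWeight γ) c where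
  compact := hΘ
  measurable := hmeas
  contDiffOn := hC2
  weight := isWeight_powWeight hγ
  pos := hc
  lower := hlow
  tame := tame_of_condA0 hA0 h0
  tame₁ := tame_of_condA1 hA1 h1
  tame₂ := tame_of_condA2 hA2 h2

section Identification

variable {Ω : Type*} [MeasurableSpace Ω] {μ : Measure Ω} [IsProbabilityMeasure μ] {Y : ℤ → Ω → ℕ}

lemma CondId.eq_of_adm (h : CondId μ Y f Θ) (hY : ∀ t, Measurable (Y t))
    (hmom : ∀ r : ℕ, ∃ C : ℝ≥0, ∀ t : ℤ, ∫⁻ ω, (Y t ω : ℝ≥0∞) ^ r ∂μ ≤ C) (hb : IsWeight b)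
    (hθ₀ : θ₀ ∈ Θ) {θ : Param d} (hθ : θ ∈ Θ)
    (heq : ∀ y, Adm b y → f θ (toHist y) = f θ₀ (toHist y)) : θ = θ₀ := by
  refine h θ hθ θ₀ hθ₀ ⟨0 + 1, by norm_num, ?_⟩
  filter_upwards [ae_adm_hist hY hmom hb] with ω hω
  rw [past_eq]
  exact heq _ (hω 0)

lemma CondVar.eq_zero_of_adm (h : CondVar μ Y f Θ) (hY : ∀ t, Measurable (Y t))
    (hmom : ∀ r : ℕ, ∃ C : ℝ≥0, ∀ t : ℤ, ∫⁻ ω, (Y t ω : ℝ≥0∞) ^ r ∂μ ≤ C) (hb : IsWeight b)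
    (hθ₀ : θ₀ ∈ interior Θ) {u : Param d}
    (heq : ∀ y, Adm b y → ∑ i, u i * partialDeriv f Θ i θ₀ (toHist y) = 0) : u = 0 := by
  have h1 : (u : Fin d → ℝ) = 0 := by
    refine h θ₀ hθ₀ (0 + 1) (by norm_num) _ ?_
    filter_upwards [ae_adm_hist hY hmom hb] with ω hω
    rw [past_eq]
    exact heq _ (hω 0)
  ext i
  exact congrFun h1 i

end Identification

variable {Q : Measure (ℤ → ℕ)}

lemma IsStationaryLaw.exists_moment_bound (h : IsStationaryLaw f θ₀ Q) (r : ℕ) :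
    ∃ C : ℝ≥0, ∀ t, ∫⁻ x, (coord t x : ℝ≥0∞) ^ r ∂Q ≤ C := by
  have hm : ∀ t, Measurable fun x : ℤ → ℕ => (coord t x : ℝ≥0∞) ^ r := fun t =>
    (measurable_from_nat (f := fun n : ℕ => (n : ℝ≥0∞) ^ r)).comp (measurable_coord t)
  have hs : ∀ t, ∫⁻ x, (coord (t + 1) x : ℝ≥0∞) ^ r ∂Q = ∫⁻ x, (coord t x : ℝ≥0∞) ^ r ∂Q := by
    intro t
    conv_rhs => rw [← h.stationary, lintegral_map (hm t) (by fun_prop)]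
    rfl
  have h0 : ∀ t : ℤ, ∫⁻ x, (coord t x : ℝ≥0∞) ^ r ∂Q = ∫⁻ x, (coord 0 x : ℝ≥0∞) ^ r ∂Q := by
    intro t
    induction t using Int.induction_on with
    | zero => rfl
    | succ i ih => rw [hs, ih]
    | pred i ih => rw [← hs, sub_add_cancel, ih]
  refine ⟨(∫⁻ x, (coord 0 x : ℝ≥0∞) ^ r ∂Q).toNNReal, fun t => ?_⟩
  rw [h0, ENNReal.coe_toNNReal (h.moments r 0).ne]

lemma IsStationaryLaw.condLaw [IsProbabilityMeasure Q] (h : IsStationaryLaw f θ₀ Q)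
    (hf : IsRegular f Θ b c) (hθ₀ : θ₀ ∈ Θ) (t : ℤ) :
    CondLaw Q coord (meanOf f θ₀) (hf.measurable_meanOf hθ₀) t :=
  CondPoisson.condLaw measurable_coord (fun y => (hf.coe_meanOf hθ₀ y).symm) (h.condPoisson (t + 1))

lemma IsStationaryLaw.isStationaryHist [IsProbabilityMeasure Q] (h : IsStationaryLaw f θ₀ Q)
    (hf : IsRegular f Θ b c) (hθ₀ : θ₀ ∈ Θ) (t : ℤ) :
    IsStationaryHist (meanOf f θ₀) b (Q.map (hist coord t)) :=
  isStationaryHist_map h.stationary hf.weight h.exists_moment_bound (h.condLaw hf hθ₀)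
    (hf.tame_meanOf hθ₀) t

lemma fisherIntegrand_eq (f : MeanFamily d) (Θ : Set (Param d)) (θ : Param d) (i j : Fin d)
    (x : ℤ → ℕ) : fisherIntegrand f Θ θ i j x = info f Θ i j θ (tl (hist coord 0 x)) := by
  have h1 := past_eq coord (-1) x
  have h2 := tl_hist_succ coord (-1) x
  rw [neg_add_cancel] at h1 h2
  rw [fisherIntegrand, h1, h2, info]

lemma IsRegular.measurable_info (hf : IsRegular f Θ b c) (hθ₀ : θ₀ ∈ interior Θ) (i j : Fin d) :
    Measurable fun z => info f Θ i j θ₀ (tl z) := by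
  have h1 := measurable_toHist.comp measurable_tl
  exact ((((hf.measurable θ₀ (interior_subset hθ₀)).comp h1).inv.mul
    ((hf.measurable_partialDeriv hθ₀ i).comp h1)).mul
    ((hf.measurable_partialDeriv hθ₀ j).comp h1))

lemma IsRegular.fisher_eq (hf : IsRegular f Θ b c) (hθ₀ : θ₀ ∈ interior Θ)
    (Q : Measure (ℤ → ℕ)) :
    fisher f Θ θ₀ Q = infoMatrix f Θ θ₀ (Q.map (hist coord 0)) := by
  ext i j
  rw [fisher, infoMatrix, Matrix.of_apply, Matrix.of_apply,
    integral_map (measurable_hist measurable_coord 0).aemeasurable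
      (hf.measurable_info hθ₀ i j).aestronglyMeasurable]
  simp_rw [fisherIntegrand_eq]

lemma IsRegular.integrable_fisherIntegrand (hf : IsRegular f Θ b c) (hθ₀ : θ₀ ∈ interior Θ)
    (hπ : IsStationaryHist (meanOf f θ₀) b (Q.map (hist coord 0))) (i j : Fin d) :
    Integrable (fisherIntegrand f Θ θ₀ i j) Q := by
  have h1 := hf.integrable_info hθ₀ hπ i j
  rw [integrable_map_measure (hf.measurable_info hθ₀ i j).aestronglyMeasurable
    (measurable_hist measurable_coord 0).aemeasurable] at h1
  exact h1.congr (.of_forall fun x => (fisherIntegrand_eq f Θ θ₀ i j x).symm)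

end Setup

end

end PoissonAR

theorem theorem3p2 {d : ℕ} {Ω : Type*} [MeasurableSpace Ω] (μ : Measure Ω) [IsProbabilityMeasure μ]
    -- the parametric family
    (Θ : Set (PoissonAR.Param d)) (hΘ : IsCompact Θ) (f : PoissonAR.MeanFamily d)
    (hf_meas : ∀ θ ∈ Θ, Measurable (f θ))
    (hf_C2 : ∀ y : PoissonAR.Hist, ContDiffOn ℝ 2 (fun θ => f θ y) Θ)
    (θstar : PoissonAR.Param d) (hθstar : θstar ∈ interior Θ)
    -- the observed process, with unspecified dynamics up to time 0
    (Y : ℤ → Ω → ℕ) (hY_meas : ∀ t, Measurable (Y t))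
    (hY_model : ∀ t : ℤ, 0 < t → PoissonAR.CondPoisson μ Y f θstar t)
    (hY_past : ∀ r : ℕ, ∃ C : ℝ≥0, ∀ t : ℤ, t ≤ 0 → ∫⁻ ω, (Y t ω : ℝ≥0∞) ^ r ∂μ ≤ C)
    -- the conditions D, Id, Var, A₀, A₁, A₂
    (hD : PoissonAR.CondD f Θ) (hId : PoissonAR.CondId μ Y f Θ) (hVar : PoissonAR.CondVar μ Y f Θ)
    (α₀ α₁ α₂ : ℕ → ℝ)
    (hA0 : PoissonAR.CondA0 f Θ α₀) (hA1 : PoissonAR.CondA1 f Θ α₁)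
    (hA2 : PoissonAR.CondA2 f Θ α₂)
    (γ : ℝ) (hγ : 3 / 2 < γ)
    (hα₀ : PoissonAR.HasDecay α₀ γ) (hα₁ : PoissonAR.HasDecay α₁ γ)
    (hα₂ : PoissonAR.HasDecay α₂ γ)
    -- the maximum likelihood estimators
    (θhat : ℕ → Ω → PoissonAR.Param d) (hθhat_meas : ∀ n, AEMeasurable (θhat n) μ)
    (hθhat : ∀ n, ∀ᵐ ω ∂μ, PoissonAR.IsMLE Y f Θ n ω (θhat n ω)) :
    (∃ Q : Measure (ℤ → ℕ), PoissonAR.IsStationaryLaw f θstar Q) ∧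
    ∀ Q : Measure (ℤ → ℕ), PoissonAR.IsStationaryLaw f θstar Q →
      (∀ i j, Integrable (PoissonAR.fisherIntegrand f Θ θstar i j) Q) ∧
      (PoissonAR.fisher f Θ θstar Q).PosDef ∧
      TendstoInDistribution (fun (n : ℕ) ω => √(n : ℝ) • (θhat n ω - θstar)) atTop id
        (fun _ => μ) (multivariateGaussian 0 (PoissonAR.fisher f Θ θstar Q)⁻¹) ∧
      ∀ᵐ ω ∂μ, Tendsto (fun n : ℕ => PoissonAR.empFisher Y f Θ n ω (θhat n ω)) atTop
        (𝓝 (PoissonAR.fisher f Θ θstar Q)) := by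
  obtain ⟨c, hc, hlow⟩ := hD
  have hf := PoissonAR.isRegular_of_cond hΘ hf_meas hf_C2 hc hlow hA0 hA1 hA2 hγ hα₀ hα₁ hα₂
  have hb := hf.weight
  have hθ' := interior_subset hθstar
  have hcoe := fun y => (hf.coe_meanOf hθ' y).symm
  have hlam := hf.measurable_meanOf hθ'
  have hcon := PoissonAR.contractive_meanOf hA0 hθ'
  have hdom : ∃ C : ℝ≥0, ∀ k, (α₀ k).toNNReal ≤ C * PoissonAR.powWeight γ k := by
    obtain ⟨C, hC⟩ := hα₀.exists_le
    exact ⟨C, fun k => Real.toNNReal_le_iff_le_coe.2 (by exact_mod_cast hC k)⟩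
  have hlaw : ∀ t : ℕ, PoissonAR.CondLaw μ Y (PoissonAR.meanOf f θstar) hlam t := fun t =>
    PoissonAR.CondPoisson.condLaw hY_meas hcoe (hY_model _ (by omega))
  have hmom := PoissonAR.exists_moment_bound hY_meas hcon hlaw hY_past
  refine ⟨?_, fun Q hQ => ?_⟩
  · obtain ⟨Q, hprob, hstat, hmomQ, hlawQ⟩ :=
      PoissonAR.exists_stationary hY_meas hcon hlaw hmom hb hdom
    refine ⟨Q, hprob, hstat, fun r t => ?_, fun t => ?_⟩
    · obtain ⟨C, hC⟩ := hmomQ r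
      exact (hC t).trans_lt ENNReal.coe_lt_top
    · have h := PoissonAR.CondLaw.condPoisson PoissonAR.measurable_coord hcoe (hlawQ (t - 1))
      rwa [sub_add_cancel] at h
  have := hQ.isProbabilityMeasure
  have hπ := hQ.isStationaryHist hf hθ' 0
  have := hπ.prob
  obtain ⟨C, hC⟩ := hπ.moments 1
  have hgood := PoissonAR.ae_emp_good hY_meas hcon hlaw hmom hb hdom hπ.invariant (C := C)
    fun k => by simpa using hC () k
  have hmle : ∀ᵐ ω ∂μ, ∀ n, PoissonAR.IsMLE Y f Θ n ω (θhat n ω) := ae_all_iff.2 hθhat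
  have hlim : ∀ᵐ ω ∂μ, Tendsto (fun n => θhat n ω) atTop (𝓝 θstar) := by
    filter_upwards [hgood, hmle] with ω h1 h2
    exact hf.tendsto_mle hθstar hπ
      (fun θ hθ h => hId.eq_of_adm hY_meas hmom hb hθ' hθ h) h1.1 h1.2 h2
  have hM := hf.posDef_infoMatrix hθstar hπ fun u hu =>
    hVar.eq_zero_of_adm hY_meas hmom hb hθstar hu
  rw [hf.fisher_eq hθstar Q]
  refine ⟨hf.integrable_fisherIntegrand hθstar hπ, hM,
    hf.tendstoInDistribution_mle hθstar hπ hM hY_meas hlaw hmom hgood hθhat_meas hmle hlim, ?_⟩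
  filter_upwards [hgood, hlim] with ω h1 h2
  exact hf.tendsto_empFisher hθstar hπ h1.1 h1.2 h2
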